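/- **Language.** Names come in three countably infinite sorts: locations $x\in\mathcal N_\lambda$, functions $f\in\mathcal N_\phi$, continuations $k\in\mathcal N_\kappa$. Values $v$ are finite tuples (up to associativity and unit) of names and integers. Expressions are $$e ::= v \mid z \mid \mathtt{if}(e)\,\mathtt{then}\,\{e\}\,\mathtt{else}\,\{e\} \mid e=e \mid e;e \mid e\star e \mid {*}e \mid \mathtt{return}\,e \mid e(e) \mid (e,e)\mid \mathtt{new}() \mid \mathtt{local}\ z;e$$ with $z$ a bound identifier and $\star$ an arithmetic or logical operator (equality tests apply to all values). A module $M$ consists of finite sets of exported and of imported names, finitely many variable declarations $\mathtt{decl}\ x=n$ ($n\in\mathbb Z$) and finitely many function declarations $\mathtt{decl}\ f(\overline z)\{e\}$ (at most one declaration for each name). Exported names are declared, imported names are location or function names that are not declared, and function bodies are closed and mention only declared or imported names. Un-exported declared names are *private*. If $M,M'$ export no common name, a composite $M\cdot M'$ is a concatenation of $M$ and $M'$ (it exports what $M$ or $M'$ exports and imports what else $M$ or $M'$ imports), after renaming private names so that no private name of one module is a name of the other. **Semantics.** A store $s$ is a pair of finite partial functions, $\mathcal N_\lambda\rightharpoonup\mathbb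 Z+\mathcal N_\lambda+\mathcal N_\phi$ and $\mathcal N_\kappa\rightharpoonup \mathit{FrameStacks}\times\mathcal N_\kappa$. States are program configurations $\langle N\mid P\vdash s,t,e,k\rangle$ and system configurations $\langle\!\langle N\mid P\vdash s\rangle\!\rangle$, with $N$ the finite set of used names, $P$ the finite set of public names, $t$ a frame stack. The initial state $S^0_M$ is $\langle\!\langle N\mid P\vdash s_0\rangle\!\rangle$, with $P$ the exported and imported names, $N$ these and the declared names, and $s_0$ the declared values of the variables. Internal transitions $X\to X'$ are those of the usual call-by-value, left-to-right frame-stack machine, in which a call of a function defined in $M$ unfolds its definition, and $\mathtt{new}$ and $\mathtt{local}$ allocate a location outside $N$ initialised to $0$. Write $\nu$ for the set of occurring names, $Cl(s,\mathcal X)$ for the names reachable from $\mathcal X$ through the location part of $s$, and $s\upharpoonright P_\lambda$ for the restriction of $s$ to the locations in $P$. Labelled transitions $\xrightarrow[s']{\alpha}$ are: - Program call: $\langle N\mid P\vdash s,t\circ f(\square),v,k\rangle\xrightarrow[s\upharpoonright P'_\lambda]{\mathtt{call}\,f,v,k'}\langle\!\langle N\cup\{k'\}\mid P'\cup\{k'\}\vdash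 s[k'\mapsto(t,k)]\rangle\!\rangle$ if $f$ is not defined in $M$ and $k'\notin N$, where $P'=Cl(s,P\cup\nu(v))$. - Program return: $\langle N\mid P\vdash s,-,v,k\rangle\xrightarrow[s\upharpoonright P'_\lambda]{\mathtt{ret}\,v,k}\langle\!\langle N\mid P'\vdash s\rangle\!\rangle$, where $P'=Cl(s,P\cup\nu(v))$ and $-$ is the empty stack. - System call: $\langle\!\langle N\mid P\vdash s\rangle\!\rangle\xrightarrow[s']{\mathtt{call}\,f,v,k}\langle N\cup\{k\}\cup\nu(v,s')\mid P\cup\{k\}\cup\nu(v,s')\vdash s[s'],f(\square),v,k\rangle$ if $f$ is defined in $M$, $k\notin\mathrm{dom}(s)$, $\nu(f,v,s')\cap N\subseteq P$, every location in $v$ is in $\nu(s')$, $s'$ is defined at all locations of $P$ at which $s$ is defined, and $s'$ stores no continuations. - System return: $\langle\!\langle N\mid P\vdash s\rangle\!\rangle\xrightarrow[s']{\mathtt{ret}\,v,k'}\langle N\cup\nu(v,s')\mid P\cup\nu(v,s')\vdash s[s'],t,v,k\rangle$ if $s(k')=(t,k)$, $\nu(v,s')\cap N\subseteq P$, and $v,s'$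 satisfy the last three conditions of the system call. Finite sort-preserving permutations $\pi$ of names act on states by renaming the configuration together with the function definitions of the module. **Bisimilarity.** A relation $\mathcal R$ between states is a simulation if $(X_1,X_2)\in\mathcal R$ implies: (i) $X_1$ and $X_2$ have the same public names; (ii) if $X_1\to X_1'$ then $(X_1',X_2)\in\mathcal R$; (iii) if $X_1\xrightarrow[s]{\alpha}X_1'$ then $(\pi\cdot X_2)\to^*\xrightarrow[s]{\alpha}X_2'$ with $(X_1',X_2')\in\mathcal R$, for some $X_2'$ and some permutation $\pi$ that fixes all public names of $X_1$ and $X_2$. It is a bisimulation if it and its inverse are simulations. Modules $M_1,M_2$ are bisimilar, $M_1\sim M_2$, if $(S^0_{M_1},S^0_{M_2})$ belongs to some bisimulation. **Proposition.** Bisimilarity is a congruence for module composition: $\sim$ is an equivalence relation on modules, and if $M_1\sim M_2$ and $M_1'\sim M_2'$, then $M_1\cdot M_1'\sim M_2\cdot M_2'$ for all composites $M_1\cdot M_1'$ and $M_2\cdot M_2'$. Here it is assumed that $M_1$ and $M_2$ export the same variables in case $M_1$ exports no function, and likewise for $M_1'$ and $M_2'$. -/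

import Mathlib

namespace SLS

/-! ### Finite partial functions -/

/-- Partial functions from `α` to `β` with finite domain. -/
@[ext]
structure FinPFun (α β : Type) where
  toFun : α → Option β
  dom : Finset α
  mem_dom : ∀ a, a ∈ dom ↔ (toFun a).isSome = true

namespace FinPFun

variable {α β γ : Type}

instance : CoeFun (FinPFun α β) (fun _ => α → Option β) := ⟨FinPFun.toFun⟩

/-- The nowhere defined function. -/
def empty : FinPFun α β where
  toFun _ := none
  dom := ∅
  mem_dom := by simp

/-- `s[a ↦ b]` -/
def set [DecidableEq α] (s : FinPFun α β) (a : α) (b : β) : FinPFun α β where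
  toFun c := if c = a then some b else s c
  dom := insert a s.dom
  mem_dom c := by by_cases h : c = a <;> simp [h, s.mem_dom]

/-- `s[s'] = s' ∪ (s ∖ dom s')`: the values of `s'` take precedence. -/
def override [DecidableEq α] (s s' : FinPFun α β) : FinPFun α β where
  toFun a := (s' a).or (s a)
  dom := s.dom ∪ s'.dom
  mem_dom a := by
    simp only [Finset.mem_union, s.mem_dom, s'.mem_dom, Option.isSome_or, Bool.or_eq_true]
    tauto

/-- Restriction of `s` to the arguments that satisfy `p`. -/
def restrict (s : FinPFun α β) (p : α → Prop) [DecidablePred p] : FinPFun α β where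
  toFun a := if p a then s a else none
  dom := s.dom.filter p
  mem_dom a := by by_cases h : p a <;> simp [h, s.mem_dom]

/-- The image of the graph of `s` under `(a, b) ↦ (σ a, g b)`. -/
def bimap [DecidableEq α] (σ : Equiv.Perm α) (g : β → γ) (s : FinPFun α β) : FinPFun α γ where
  toFun a := (s (σ.symm a)).map g
  dom := s.dom.image σ
  mem_dom a := by
    simp only [Finset.mem_image, s.mem_dom, Option.isSome_map]
    constructor
    · rintro ⟨b, hb, rfl⟩
      simpa using hb
    · intro h
      exact ⟨σ.symm a, h, by simp⟩

end FinPFun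

/-! ### Names, values and stores -/

/-- Names come in three countably infinite sorts: locations, functions and continuations. -/
inductive Name where
  | loc (n : ℕ)
  | fn (n : ℕ)
  | cont (n : ℕ)
  deriving DecidableEq

/-- Location names. -/
abbrev Loc := ℕ
/-- Function names. -/
abbrev Fn := ℕ
/-- Continuation names. -/
abbrev Cont := ℕ
/-- Bound identifiers: formal parameters and local variables. -/
abbrev Ident := ℕ

/-- Values that are not tuples. -/
inductive Atom where
  | name (a : Name)
  | int (n : ℤ)
  deriving DecidableEq

/-- Values. Tuples are taken up to associativity and unit, so a value is a list of atoms;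
`[]` is the empty tuple and `[a]` is the atom `a`. -/
abbrev Value := List Atom

/-- What a location can hold: an integer, a location or a function name. -/
inductive Data where
  | int (n : ℤ)
  | loc (x : Loc)
  | fn (f : Fn)
  deriving DecidableEq

/-- Support of an atom. -/
def Atom.names : Atom → Finset Name
  | .name a => {a}
  | .int _ => ∅

/-- Support of a value. -/
def Value.names (v : Value) : Finset Name := v.toFinset.biUnion Atom.names

/-- Support of a stored datum. -/
def Data.names : Data → Finset Name
  | .int _ => ∅
  | .loc x => {.loc x}
  | .fn f => {.fn f}

/-- A stored datum read as a value. -/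
def Data.toValue : Data → Value
  | .int n => [.int n]
  | .loc x => [.name (.loc x)]
  | .fn f => [.name (.fn f)]

/-- The location component of a store. -/
abbrev LocStore := FinPFun Loc Data

/-- Support of (the location component of) a store: all names in its domain or its range. -/
def LocStore.names (s : LocStore) : Finset Name :=
  s.dom.biUnion fun x => insert (.loc x) ((s x).elim ∅ Data.names)

/-! ### Expressions and frames -/

/-- Arithmetic and logical operators. -/
inductive BinOp where
  | add | sub | mul | div | mod | eq | ne | lt | le | and | or

/-- A truth value as a value. -/
def ofBool (b : Bool) : Value := [.int (if b then 1 else 0)]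

/-- Evaluation of the operators. Equality tests work on all values, the others on integers. -/
def BinOp.eval : BinOp → Value → Value → Option Value
  | .add, [.int m], [.int n] => some [.int (m + n)]
  | .sub, [.int m], [.int n] => some [.int (m - n)]
  | .mul, [.int m], [.int n] => some [.int (m * n)]
  | .div, [.int m], [.int n] => if n = 0 then none else some [.int (m.tdiv n)]
  | .mod, [.int m], [.int n] => if n = 0 then none else some [.int (m.tmod n)]
  | .eq, v, w => some (ofBool (v = w))
  | .ne, v, w => some (ofBool (v ≠ w))
  | .lt, [.int m], [.int n] => some (ofBool (m < n))
  | .le, [.int m], [.int n] => some (ofBool (m ≤ n))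
  | .and, [.int m], [.int n] => some (ofBool (m ≠ 0 ∧ n ≠ 0))
  | .or, [.int m], [.int n] => some (ofBool (m ≠ 0 ∨ n ≠ 0))
  | _, _, _ => none

/-- The binary constructs `e = e`, `e; e` and `e ⋆ e`. -/
inductive Op where
  | assign
  | seq
  | bin (b : BinOp)

/-- The unary constructs `* e` and `return e`. -/
inductive UOp where
  | deref
  | ret

/-- Expressions and statements. Names (in particular global variables and functions) and
integers are values; formal parameters and local variables are identifiers. -/
inductive Exp where
  | val (v : Value)
  | var (x : Ident)
  | ite (e e₁ e₂ : Exp)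
  | op (o : Op) (e e' : Exp)
  | uop (o : UOp) (e : Exp)
  | app (e e' : Exp)
  | pair (e e' : Exp)
  | new
  /-- `local x; e` -/
  | localIn (x : Ident) (e : Exp)

/-- Support of an expression. -/
def Exp.names : Exp → Finset Name
  | .val v => Value.names v
  | .var _ => ∅
  | .ite e e₁ e₂ => e.names ∪ e₁.names ∪ e₂.names
  | .op _ e e' => e.names ∪ e'.names
  | .uop _ e => e.names
  | .app e e' => e.names ∪ e'.names
  | .pair e e' => e.names ∪ e'.names
  | .new => ∅
  | .localIn _ e => e.names

/-- Free identifiers of an expression. -/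
def Exp.free : Exp → Finset Ident
  | .val _ => ∅
  | .var x => {x}
  | .ite e e₁ e₂ => e.free ∪ e₁.free ∪ e₂.free
  | .op _ e e' => e.free ∪ e'.free
  | .uop _ e => e.free
  | .app e e' => e.free ∪ e'.free
  | .pair e e' => e.free ∪ e'.free
  | .new => ∅
  | .localIn x e => e.free.erase x

/-- Simultaneous substitution of values for free identifiers. -/
def Exp.subst (σ : Ident → Option Value) : Exp → Exp
  | .val v => .val v
  | .var x => (σ x).elim (.var x) .val
  | .ite e e₁ e₂ => .ite (e.subst σ) (e₁.subst σ) (e₂.subst σ)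
  | .op o e e' => .op o (e.subst σ) (e'.subst σ)
  | .uop o e => .uop o (e.subst σ)
  | .app e e' => .app (e.subst σ) (e'.subst σ)
  | .pair e e' => .pair (e.subst σ) (e'.subst σ)
  | .new => .new
  | .localIn x e => .localIn x (e.subst (Function.update σ x none))

/-- Function definitions: `f(params){body}`. -/
structure Func where
  params : List Ident
  body : Exp

/-- The tuple `v` substituted point-wise for the formal parameters. -/
def Func.inst (F : Func) (v : Value) : Exp :=
  F.body.subst fun x => ((F.params.zip v).lookup x).map fun a => [a]

/-- Evaluation frames. -/
inductive Frame where
  /-- `if (□) then {e₁} else {e₂}` -/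
  | ite (e₁ e₂ : Exp)
  /-- `□ op e` -/
  | opL (o : Op) (e : Exp)
  /-- `v op □` -/
  | opR (v : Value) (o : Op)
  /-- `op □` -/
  | uop (o : UOp)
  /-- `□(e)` -/
  | appL (e : Exp)
  /-- `v(□)` -/
  | appR (v : Value)
  /-- `(□, e)` -/
  | pairL (e : Exp)
  /-- `(v, □)` -/
  | pairR (v : Value)

/-- Frame stacks; the innermost frame comes first. -/
abbrev Stack := List Frame

/-- Stores: location store and stored continuations. -/
@[ext]
structure Store where
  loc : LocStore
  cont : FinPFun Cont (Stack × Cont)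

/-- The names reachable from `X` through the location store `s`. -/
inductive Reach (s : LocStore) (X : Finset Name) : Name → Prop where
  | base {a : Name} : a ∈ X → Reach s X a
  | step {x : Loc} {d : Data} {b : Name} :
      Reach s X (.loc x) → s x = some d → b ∈ d.names → Reach s X b

open Classical in
/-- The closure `Cl(s, X)`. -/
noncomputable def closure (s : LocStore) (X : Finset Name) : Finset Name :=
  (X ∪ s.names).filter (Reach s X)

theorem mem_closure {s : LocStore} {X : Finset Name} {a : Name} :
    a ∈ closure s X ↔ Reach s X a := by
  classical
  simp only [closure, Finset.mem_filter, Finset.mem_union, and_iff_right_iff_imp]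
  intro h
  cases h with
  | base h => exact Or.inl h
  | @step x d _ _ hx hb =>
    refine Or.inr (Finset.mem_biUnion.2 ⟨x, ?_, ?_⟩)
    · rw [s.mem_dom, hx]; rfl
    · simp [hx, hb]

/-- `s ↾ X` for the location store. -/
def LocStore.restrictTo (s : LocStore) (X : Finset Name) : LocStore :=
  s.restrict fun x => Name.loc x ∈ X

/-! ### Transitions -/

/-- Configurations: program configurations `⟨N | P ⊢ s, t, e, k⟩` and system
configurations `⟪N | P ⊢ s⟫`. -/
inductive Config where
  | prog (N P : Finset Name) (s : Store) (t : Stack) (e : Exp) (k : Cont)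
  | sys (N P : Finset Name) (s : Store)

/-- The public names of a configuration. -/
def Config.pub : Config → Finset Name
  | .prog _ P _ _ _ _ => P
  | .sys _ P _ => P

/-- The function definitions of a module: `D f` is the definition of `f`, if there is one. -/
abbrev Code := FinPFun Fn Func

/-- Internal (unlabelled) transitions of the abstract machine. -/
inductive IStep (D : Code) : Config → Config → Prop where
  | iteTrue {N P s t e₁ e₂ k} {n : ℤ} : n ≠ 0 →
      IStep D (.prog N P s (.ite e₁ e₂ :: t) (.val [.int n]) k) (.prog N P s t e₁ k)
  | iteFalse {N P s t e₁ e₂ k} :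
      IStep D (.prog N P s (.ite e₁ e₂ :: t) (.val [.int 0]) k) (.prog N P s t e₂ k)
  | opL {N P s t o e v k} :
      IStep D (.prog N P s (.opL o e :: t) (.val v) k) (.prog N P s (.opR v o :: t) e k)
  | opRBin {N P s t b v v' v'' k} : BinOp.eval b v v' = some v'' →
      IStep D (.prog N P s (.opR v (.bin b) :: t) (.val v') k) (.prog N P s t (.val v'') k)
  | opRSeq {N P s t v v' k} :
      IStep D (.prog N P s (.opR v .seq :: t) (.val v') k) (.prog N P s t (.val v') k)
  | opRAssign {N P s t v k} {x : Loc} {d : Data} : v = d.toValue →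
      IStep D (.prog N P s (.opR [.name (.loc x)] .assign :: t) (.val v) k)
        (.prog N P ⟨s.loc.set x d, s.cont⟩ t (.val []) k)
  | deref {N P s t k} {x : Loc} {d : Data} : s.loc x = some d →
      IStep D (.prog N P s (.uop .deref :: t) (.val [.name (.loc x)]) k)
        (.prog N P s t (.val d.toValue) k)
  | ret {N P s t v k} :
      IStep D (.prog N P s (.uop .ret :: t) (.val v) k) (.prog N P s t (.val v) k)
  | localIn {N P s t x e k} {a : Loc} : Name.loc a ∉ N →
      IStep D (.prog N P s t (.localIn x e) k)
        (.prog (insert (.loc a) N) P ⟨s.loc.set a (.int 0), s.cont⟩ t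
          (e.subst (fun y => if y = x then some [.name (.loc a)] else none)) k)
  | appL {N P s t e v k} :
      IStep D (.prog N P s (.appL e :: t) (.val v) k) (.prog N P s (.appR v :: t) e k)
  | pairL {N P s t e v k} :
      IStep D (.prog N P s (.pairL e :: t) (.val v) k) (.prog N P s (.pairR v :: t) e k)
  | pairR {N P s t v v' k} :
      IStep D (.prog N P s (.pairR v :: t) (.val v') k) (.prog N P s t (.val (v ++ v')) k)
  | call {N P s t v k} {f : Fn} {F : Func} : D f = some F → v.length = F.params.length →
      IStep D (.prog N P s (.appR [.name (.fn f)] :: t) (.val v) k)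
        (.prog N P s t (F.inst v) k)
  | pushIte {N P s t e e₁ e₂ k} :
      IStep D (.prog N P s t (.ite e e₁ e₂) k) (.prog N P s (.ite e₁ e₂ :: t) e k)
  | pushOp {N P s t o e e' k} :
      IStep D (.prog N P s t (.op o e e') k) (.prog N P s (.opL o e' :: t) e k)
  | pushUop {N P s t o e k} :
      IStep D (.prog N P s t (.uop o e) k) (.prog N P s (.uop o :: t) e k)
  | new {N P s t k} {a : Loc} : Name.loc a ∉ N →
      IStep D (.prog N P s t .new k)
        (.prog (insert (.loc a) N) P ⟨s.loc.set a (.int 0), s.cont⟩ t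
          (.val [.name (.loc a)]) k)
  | pushApp {N P s t e e' k} :
      IStep D (.prog N P s t (.app e e') k) (.prog N P s (.appL e' :: t) e k)
  | pushPair {N P s t e e' k} :
      IStep D (.prog N P s t (.pair e e') k) (.prog N P s (.pairL e' :: t) e k)

/-- Labels `call f, v, k` and `ret v, k`. -/
inductive Label where
  | call (f : Fn) (v : Value) (k : Cont)
  | ret (v : Value) (k : Cont)

/-- The epistemic and hygiene conditions under which the system may communicate the names
`X`, the value `v` and the store `s'` in the system configuration `⟪N | P ⊢ s⟫`. -/
def SysMay (N P : Finset Name) (s : Store) (X : Finset Name) (v : Value) (s' : LocStore) :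
    Prop :=
  (X ∪ Value.names v ∪ LocStore.names s') ∩ N ⊆ P ∧
  (∀ x : Loc, Name.loc x ∈ Value.names v → Name.loc x ∈ LocStore.names s') ∧
  (∀ x : Loc, x ∈ s.loc.dom → Name.loc x ∈ P → x ∈ s'.dom)

/-- Labelled transitions between program and system. A label carries a store without
continuations. -/
inductive LStep (D : Code) : Config → Label → LocStore → Config → Prop where
  /-- Program-to-System call -/
  | progCall {N P s t v k} {f : Fn} {k' : Cont} {P' : Finset Name} :
      D f = none → Name.cont k' ∉ N → P' = closure s.loc (P ∪ Value.names v) →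
      LStep D (.prog N P s (.appR [.name (.fn f)] :: t) (.val v) k)
        (.call f v k') (LocStore.restrictTo s.loc P')
        (.sys (insert (.cont k') N) (insert (.cont k') P') ⟨s.loc, s.cont.set k' (t, k)⟩)
  /-- System-to-Program return -/
  | sysRet {N P s t v k s'} {k' : Cont} :
      s.cont k' = some (t, k) → SysMay N P s ∅ v s' →
      LStep D (.sys N P s) (.ret v k') s'
        (.prog (N ∪ (Value.names v ∪ LocStore.names s'))
          (P ∪ (Value.names v ∪ LocStore.names s'))
          ⟨s.loc.override s', s.cont⟩ t (.val v) k)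
  /-- System-to-Program call -/
  | sysCall {N P s v s'} {f : Fn} {k : Cont} :
      (D f).isSome = true → k ∉ s.cont.dom → SysMay N P s {.fn f} v s' →
      LStep D (.sys N P s) (.call f v k) s'
        (.prog (insert (.cont k) N ∪ (Value.names v ∪ LocStore.names s'))
          (insert (.cont k) P ∪ (Value.names v ∪ LocStore.names s'))
          ⟨s.loc.override s', s.cont⟩ [.appR [.name (.fn f)]] (.val v) k)
  /-- Program-to-System return -/
  | progRet {N P s v k} {P' : Finset Name} :
      P' = closure s.loc (P ∪ Value.names v) →
      LStep D (.prog N P s [] (.val v) k) (.ret v k) (LocStore.restrictTo s.loc P')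
        (.sys N P' s)

/-! ### Name permutations -/

/-- Finite sort-preserving permutations of names. -/
structure NPerm where
  loc : Equiv.Perm ℕ
  fn : Equiv.Perm ℕ
  cont : Equiv.Perm ℕ
  finite_loc : {n | loc n ≠ n}.Finite
  finite_fn : {n | fn n ≠ n}.Finite
  finite_cont : {n | cont n ≠ n}.Finite

namespace NPerm

variable (π : NPerm)

/-- Action on names. -/
def name : Name → Name
  | .loc n => .loc (π.loc n)
  | .fn n => .fn (π.fn n)
  | .cont n => .cont (π.cont n)

/-- Action on finite sets of names. -/
def names (X : Finset Name) : Finset Name := X.image π.name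

/-- Action on atoms. -/
def atom : Atom → Atom
  | .name a => .name (π.name a)
  | .int n => .int n

/-- Action on values. -/
def value (v : Value) : Value := v.map π.atom

/-- Action on data. -/
def data : Data → Data
  | .int n => .int n
  | .loc x => .loc (π.loc x)
  | .fn f => .fn (π.fn f)

/-- Action on expressions. -/
def exp (π : NPerm) : Exp → Exp
  | .val v => .val (π.value v)
  | .var x => .var x
  | .ite e e₁ e₂ => .ite (π.exp e) (π.exp e₁) (π.exp e₂)
  | .op o e e' => .op o (π.exp e) (π.exp e')
  | .uop o e => .uop o (π.exp e)
  | .app e e' => .app (π.exp e) (π.exp e')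
  | .pair e e' => .pair (π.exp e) (π.exp e')
  | .new => .new
  | .localIn x e => .localIn x (π.exp e)

/-- Action on function definitions. -/
def func (F : Func) : Func := ⟨F.params, π.exp F.body⟩

/-- Action on frames. -/
def frame : Frame → Frame
  | .ite e₁ e₂ => .ite (π.exp e₁) (π.exp e₂)
  | .opL o e => .opL o (π.exp e)
  | .opR v o => .opR (π.value v) o
  | .uop o => .uop o
  | .appL e => .appL (π.exp e)
  | .appR v => .appR (π.value v)
  | .pairL e => .pairL (π.exp e)
  | .pairR v => .pairR (π.value v)

/-- Action on frame stacks. -/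
def stack (t : Stack) : Stack := t.map π.frame

/-- Action on stores. -/
def store (s : Store) : Store :=
  ⟨s.loc.bimap π.loc π.data, s.cont.bimap π.cont fun p => (π.stack p.1, π.cont p.2)⟩

/-- Action on configurations. -/
def config : Config → Config
  | .prog N P s t e k =>
      .prog (π.names N) (π.names P) (π.store s) (π.stack t) (π.exp e) (π.cont k)
  | .sys N P s => .sys (π.names N) (π.names P) (π.store s)

/-- Action on function tables. -/
def code (D : Code) : Code := D.bimap π.fn π.func

end NPerm

/-! ### Modules and their transition systems -/

/-- Modules: a header with exported and imported names, declarations `decl x = n` of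
variables and declarations of functions. -/
structure Module where
  exports : Finset Name
  imports : Finset Name
  vars : FinPFun Loc ℤ
  funs : Code

namespace Module

variable (M : Module)

/-- The declared names. -/
def declared : Finset Name := M.vars.dom.image .loc ∪ M.funs.dom.image .fn

/-- The public names: exported and imported names. -/
def pub : Finset Name := M.exports ∪ M.imports

/-- All names of the module. -/
def allNames : Finset Name := M.pub ∪ M.declared

/-- The un-exported declared names. -/
def priv : Finset Name := M.declared \ M.exports

/-- Well-formed modules: exported names are declared, imported names are variable or function
names that are not declared, function bodies are closed and mention only names that are
declared or imported. -/
structure WF : Prop where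
  exports_declared : M.exports ⊆ M.declared
  imports_not_declared : Disjoint M.imports M.declared
  imports_sort : ∀ k : Cont, Name.cont k ∉ M.imports
  scope : ∀ f F, M.funs f = some F → F.body.names ⊆ M.declared ∪ M.imports
  closed : ∀ f F, M.funs f = some F → F.body.free ⊆ F.params.toFinset

/-- The initial configuration. -/
def init : Config :=
  .sys M.allNames M.pub ⟨M.vars.bimap 1 Data.int, FinPFun.empty⟩

/-- Renaming of a module. -/
def rename (π : NPerm) : Module where
  exports := π.names M.exports
  imports := π.names M.imports
  vars := M.vars.bimap π.loc id
  funs := π.code M.funs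

/-- Concatenation of modules. -/
def concat (M M' : Module) : Module where
  exports := M.exports ∪ M'.exports
  imports := (M.imports ∪ M'.imports) \ (M.exports ∪ M'.exports)
  vars := M.vars.override M'.vars
  funs := M.funs.override M'.funs

/-- `C` is a composite `M · M'`: a concatenation of `M` and `M'` after a renaming of their
un-exported declared names that prevents clashes. Modules that export a common name
cannot be composed. -/
def IsComp (M M' C : Module) : Prop :=
  Disjoint M.exports M'.exports ∧
  ∃ π π' : NPerm,
    (∀ a ∈ M.pub, π.name a = a) ∧ (∀ a ∈ M'.pub, π'.name a = a) ∧
    Disjoint (M.rename π).priv (M'.rename π').allNames ∧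
    Disjoint (M'.rename π').priv (M.rename π).allNames ∧
    C = (M.rename π).concat (M'.rename π')

end Module

/-- States of the transition systems. A state carries the function definitions of its module,
since these mention un-exported names and are renamed together with the configuration. -/
structure State where
  code : Code
  conf : Config

namespace State

/-- The public names of a state. -/
def pub (X : State) : Finset Name := X.conf.pub

/-- Action of permutations on states. -/
def rename (π : NPerm) (X : State) : State := ⟨π.code X.code, π.config X.conf⟩

/-- Internal transitions. -/
def Step (X X' : State) : Prop := X'.code = X.code ∧ IStep X.code X.conf X'.conf

/-- Labelled transitions. -/
def Trans (X : State) (α : Label) (s : LocStore) (X' : State) : Prop :=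
  X'.code = X.code ∧ LStep X.code X.conf α s X'.conf

/-- Labelled transitions preceded by internal ones. -/
def WeakTrans (X : State) (α : Label) (s : LocStore) (X' : State) : Prop :=
  ∃ Y, Relation.ReflTransGen Step X Y ∧ Trans Y α s X'

end State

/-- The initial state of the transition system of a module. -/
def Module.initState (M : Module) : State := ⟨M.funs, M.init⟩

/-- Simulations. -/
structure IsSimulation (R : State → State → Prop) : Prop where
  pub_eq : ∀ X₁ X₂, R X₁ X₂ → X₁.pub = X₂.pub
  step : ∀ X₁ X₂ X₁', R X₁ X₂ → X₁.Step X₁' → R X₁' X₂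
  trans : ∀ X₁ X₂ α s X₁', R X₁ X₂ → X₁.Trans α s X₁' →
    ∃ π : NPerm, (∀ a ∈ X₁.pub ∪ X₂.pub, π.name a = a) ∧
      ∃ X₂', (X₂.rename π).WeakTrans α s X₂' ∧ R X₁' X₂'

/-- Bisimulations. -/
def IsBisimulation (R : State → State → Prop) : Prop :=
  IsSimulation R ∧ IsSimulation fun X₁ X₂ => R X₂ X₁

/-- Bisimilarity of modules. -/
def Bisimilar (M₁ M₂ : Module) : Prop :=
  ∃ R, IsBisimulation R ∧ R M₁.initState M₂.initState

/-- `M₁` exports a function, or `M₁` and `M₂` export the same variables. -/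
def SameVars (M₁ M₂ : Module) : Prop :=
  (∃ f : Fn, Name.fn f ∈ M₁.exports) ∨
    ∀ x : Loc, Name.loc x ∈ M₁.exports ↔ Name.loc x ∈ M₂.exports

end SLS

/-! A state `C` of a composite is compared with another one through its components. It splits into
states `X` and `X'` of the two modules: either one of them runs while the other waits as a system
configuration (`IsActive`), or both wait (`IsPassive`). The components also exchange labels that the
composite does not show, so they share internal names `I` that are unused in `C`. The frame stack of
`C` is that of the running component followed by the stacks met on following internal continuations
alternately through the two continuation stores (`Unwind`). Two composite states are `Glued` if they
split, over the same `I`, into bisimilar components. Glued states are bisimilar (`Glued.bisim`), and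
initial states of composites of bisimilar modules are glued.

A simulation must answer internal transitions by staying put, which is awkward to verify. Internal
transitions are, however, deterministic up to the choice of the allocated location, and a state with
a labelled transition has no internal ones. Hence internal computations are confluent up to renaming
(`State.Steps.confluent`), and it suffices to find a symmetric equivariant relation that answers
internal transitions by internal computations, up to renaming of private names
(`Bisim.of_weak_simulation`). This gives reflexivity of bisimilarity as well. Transitivity follows
by renaming answers back and forth.

For glued states, let first a component of `C₁` be running. If it is about to call or return to the
other component, the two perform matching labelled transitions while `C₁` itself does not change
(`IsActive.sync`). The bisimilar components of the second composite answer these, and it follows by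
internal computations. A call leaves no interaction pending and a return shortens the unwinding, so
this ends (`ActivePair.exists_normal`). Now a transition of `C₁` is one of its running component. An
internal one needs no answer. For a labelled one the store shown by the composite depends only on
the label of the component and on the public names of the composite (`closure_composite`), so both
composites show the same label. If both components wait, the environment addresses one of them, and
a store `q` supplies the values of the locations that this component shares with the other one but
not with the environment.

Three points need care. The components choose private names independently, so they are kept fresh
for each other and the two renamings are glued to one of the composite (`Bisim.exists_match`,
`IsSplit.exists_rename`). A program may pass on a location without a value, which a system may not
do unless its store mentions it; internal pointers to such locations are added
(`LocStore.exists_pointers`). Finally, both composites must start with the same exported variables;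
if a function is exported, a test call reveals them (`Bisim.code_and_loc`), otherwise `SameVars`
assumes it. -/

namespace SLS

/-! ### Finite partial functions -/

namespace FinPFun

variable {α β γ δ : Type}

theorem ext_apply {f g : FinPFun α β} (h : ∀ a, f a = g a) : f = g := by
  have h₁ : f.toFun = g.toFun := funext h
  refine FinPFun.ext h₁ ?_
  ext a
  rw [f.mem_dom, g.mem_dom, h₁]

theorem mem_dom_iff {f : FinPFun α β} {a : α} : a ∈ f.dom ↔ ∃ b, f a = some b := by
  rw [f.mem_dom, Option.isSome_iff_exists]

theorem notMem_dom_iff {f : FinPFun α β} {a : α} : a ∉ f.dom ↔ f a = none := by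
  rw [f.mem_dom]; simp

theorem ext_some {f g : FinPFun α β} (h₁ : ∀ a b, f a = some b → g a = some b)
    (h₂ : ∀ a b, g a = some b → f a = some b) : f = g :=
  ext_apply fun a => Option.ext fun b => ⟨h₁ a b, h₂ a b⟩

variable [DecidableEq α]

@[simp] theorem set_apply (s : FinPFun α β) (a c : α) (b : β) :
    s.set a b c = if c = a then some b else s c := rfl

@[simp] theorem override_apply (s s' : FinPFun α β) (a : α) :
    s.override s' a = (s' a).or (s a) := rfl


theorem bimap_apply (σ : Equiv.Perm α) (g : β → γ) (s : FinPFun α β) (a : α) :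
    s.bimap σ g a = (s (σ.symm a)).map g := rfl

@[simp] theorem bimap_apply_apply (σ : Equiv.Perm α) (g : β → γ) (s : FinPFun α β) (a : α) :
    s.bimap σ g (σ a) = (s a).map g := by simp [bimap_apply]

theorem bimap_congr {σ σ' : Equiv.Perm α} {g g' : β → γ} {s : FinPFun α β}
    (h : ∀ a b, s a = some b → σ a = σ' a ∧ g b = g' b) : s.bimap σ g = s.bimap σ' g' := by
  apply ext_some
  · intro a b hb
    obtain ⟨a, rfl⟩ := σ.surjective a
    rw [bimap_apply_apply, Option.map_eq_some_iff] at hb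
    obtain ⟨c, hc, rfl⟩ := hb
    obtain ⟨h₁, h₂⟩ := h a c hc
    rw [h₁, h₂, bimap_apply_apply, hc]; rfl
  · intro a b hb
    obtain ⟨a, rfl⟩ := σ'.surjective a
    rw [bimap_apply_apply, Option.map_eq_some_iff] at hb
    obtain ⟨c, hc, rfl⟩ := hb
    obtain ⟨h₁, h₂⟩ := h a c hc
    rw [← h₁, ← h₂, bimap_apply_apply, hc]; rfl

theorem bimap_bimap (σ τ : Equiv.Perm α) (g : β → γ) (h : γ → δ) (s : FinPFun α β) :
    (s.bimap σ g).bimap τ h = s.bimap (τ * σ) (h ∘ g) := by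
  apply ext_apply
  intro a
  simp [bimap_apply, Option.map_map, Equiv.Perm.mul_def]

theorem bimap_one (g : β → β) (hg : ∀ b, g b = b) (s : FinPFun α β) : s.bimap 1 g = s := by
  apply ext_apply
  intro a
  have : g = id := funext hg
  subst this
  rw [bimap_apply, Option.map_id]
  rfl

theorem bimap_set (σ : Equiv.Perm α) (g : β → γ) (s : FinPFun α β) (a : α) (b : β) :
    (s.set a b).bimap σ g = (s.bimap σ g).set (σ a) (g b) := by
  apply ext_apply
  intro c
  obtain ⟨c, rfl⟩ := σ.surjective c
  simp only [bimap_apply_apply, set_apply, σ.injective.eq_iff]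
  split <;> rfl

theorem bimap_override (σ : Equiv.Perm α) (g : β → γ) (s s' : FinPFun α β) :
    (s.override s').bimap σ g = (s.bimap σ g).override (s'.bimap σ g) := by
  apply ext_apply
  intro c
  obtain ⟨c, rfl⟩ := σ.surjective c
  simp only [bimap_apply_apply, override_apply]
  cases s' c <;> rfl

theorem mem_dom_bimap (σ : Equiv.Perm α) (g : β → γ) (s : FinPFun α β) (a : α) :
    σ a ∈ (s.bimap σ g).dom ↔ a ∈ s.dom := by
  rw [FinPFun.mem_dom, FinPFun.mem_dom]; simp

end FinPFun

/-! ### Supports -/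

/-- Support of a frame. -/
def Frame.names : Frame → Finset Name
  | .ite e₁ e₂ => e₁.names ∪ e₂.names
  | .opL _ e => e.names
  | .opR v _ => Value.names v
  | .uop _ => ∅
  | .appL e => e.names
  | .appR v => Value.names v
  | .pairL e => e.names
  | .pairR v => Value.names v

/-- Support of a frame stack. -/
def Stack.names : Stack → Finset Name
  | [] => ∅
  | F :: t => F.names ∪ Stack.names t

@[simp] theorem Stack.names_nil : Stack.names [] = ∅ := rfl

@[simp] theorem Stack.names_cons (F : Frame) (t : Stack) :
    Stack.names (F :: t) = F.names ∪ Stack.names t := rfl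

@[simp] theorem Value.names_nil : Value.names [] = ∅ := rfl

theorem Value.mem_names {v : Value} {a : Name} : a ∈ Value.names v ↔ Atom.name a ∈ v := by
  simp only [Value.names, Finset.mem_biUnion, List.mem_toFinset]
  constructor
  · rintro ⟨b, hb, h⟩
    cases b with
    | name c => simp only [Atom.names, Finset.mem_singleton] at h; exact h ▸ hb
    | int n => simp [Atom.names] at h
  · intro h
    exact ⟨_, h, by simp [Atom.names]⟩

@[simp] theorem Value.names_append (v w : Value) :
    Value.names (v ++ w) = Value.names v ∪ Value.names w := by
  ext a; simp [Value.mem_names]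

@[simp] theorem Value.names_name (a : Name) : Value.names [.name a] = {a} := by
  ext b; simp [Value.mem_names]

@[simp] theorem Value.names_int (n : ℤ) : Value.names [.int n] = ∅ := by
  ext b; simp [Value.mem_names]

@[simp] theorem Data.names_toValue (d : Data) : Value.names d.toValue = d.names := by
  cases d <;> simp [Data.toValue, Data.names]

theorem Data.toValue_injective : Function.Injective Data.toValue := by
  intro d d' h
  cases d <;> cases d' <;> simp_all [Data.toValue]

theorem LocStore.mem_names {s : LocStore} {a : Name} :
    a ∈ LocStore.names s ↔ ∃ x d, s x = some d ∧ (a = .loc x ∨ a ∈ d.names) := by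
  simp only [LocStore.names, Finset.mem_biUnion, FinPFun.mem_dom_iff, Finset.mem_insert]
  constructor
  · rintro ⟨x, ⟨d, hd⟩, h⟩
    refine ⟨x, d, hd, ?_⟩
    simpa [hd] using h
  · rintro ⟨x, d, hd, h⟩
    exact ⟨x, ⟨d, hd⟩, by simpa [hd] using h⟩

theorem LocStore.restrictTo_apply (s : LocStore) (X : Finset Name) (x : Loc) :
    LocStore.restrictTo s X x = if Name.loc x ∈ X then s x else none := rfl

/-- Support of a label. -/
def Label.names : Label → Finset Name
  | .call f v k => insert (.fn f) (insert (.cont k) (Value.names v))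
  | .ret v k => insert (.cont k) (Value.names v)

/-! ### The group of permutations and its actions -/

namespace NPerm

@[ext] theorem ext' {π ρ : NPerm} (h₁ : π.loc = ρ.loc) (h₂ : π.fn = ρ.fn)
    (h₃ : π.cont = ρ.cont) : π = ρ := by
  cases π; cases ρ; simp_all

theorem finite_mul {p q : Equiv.Perm ℕ} (hp : {n | p n ≠ n}.Finite) (hq : {n | q n ≠ n}.Finite) :
    {n | (p * q) n ≠ n}.Finite := by
  refine (hp.union hq).subset ?_
  intro n hn
  by_contra hc
  simp only [Set.mem_union, Set.mem_ofPred_eq, not_or, not_not] at hc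
  exact hn (by simp [hc.1, hc.2])

theorem finite_inv {p : Equiv.Perm ℕ} (hp : {n | p n ≠ n}.Finite) : {n | p⁻¹ n ≠ n}.Finite := by
  refine hp.subset ?_
  intro n hn hc
  exact hn (by rw [Equiv.Perm.inv_eq_iff_eq]; exact hc.symm)

instance : One NPerm := ⟨⟨1, 1, 1, by simp, by simp, by simp⟩⟩

instance : Mul NPerm := ⟨fun π ρ => ⟨π.loc * ρ.loc, π.fn * ρ.fn, π.cont * ρ.cont,
  finite_mul π.finite_loc ρ.finite_loc, finite_mul π.finite_fn ρ.finite_fn,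
  finite_mul π.finite_cont ρ.finite_cont⟩⟩

instance : Inv NPerm := ⟨fun π => ⟨π.loc⁻¹, π.fn⁻¹, π.cont⁻¹,
  finite_inv π.finite_loc, finite_inv π.finite_fn, finite_inv π.finite_cont⟩⟩

@[simp] theorem one_loc : (1 : NPerm).loc = 1 := rfl
@[simp] theorem one_fn : (1 : NPerm).fn = 1 := rfl
@[simp] theorem one_cont : (1 : NPerm).cont = 1 := rfl
@[simp] theorem mul_loc (π ρ : NPerm) : (π * ρ).loc = π.loc * ρ.loc := rfl
@[simp] theorem mul_fn (π ρ : NPerm) : (π * ρ).fn = π.fn * ρ.fn := rfl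
@[simp] theorem mul_cont (π ρ : NPerm) : (π * ρ).cont = π.cont * ρ.cont := rfl
@[simp] theorem inv_loc (π : NPerm) : (π⁻¹).loc = π.loc⁻¹ := rfl
@[simp] theorem inv_fn (π : NPerm) : (π⁻¹).fn = π.fn⁻¹ := rfl
@[simp] theorem inv_cont (π : NPerm) : (π⁻¹).cont = π.cont⁻¹ := rfl

instance : Group NPerm where
  mul_assoc a b c := by ext1 <;> simp [mul_assoc]
  one_mul a := by ext1 <;> simp
  mul_one a := by ext1 <;> simp
  inv_mul_cancel a := by ext1 <;> simp

variable (π ρ : NPerm)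

@[simp] theorem name_loc (x : ℕ) : π.name (.loc x) = .loc (π.loc x) := rfl
@[simp] theorem name_fn (x : ℕ) : π.name (.fn x) = .fn (π.fn x) := rfl
@[simp] theorem name_cont (x : ℕ) : π.name (.cont x) = .cont (π.cont x) := rfl

@[simp] theorem name_one (a : Name) : (1 : NPerm).name a = a := by cases a <;> rfl

@[simp] theorem name_mul (a : Name) : (π * ρ).name a = π.name (ρ.name a) := by cases a <;> rfl

@[simp] theorem name_inv_name (a : Name) : π⁻¹.name (π.name a) = a := by
  rw [← name_mul, inv_mul_cancel, name_one]

@[simp] theorem name_name_inv (a : Name) : π.name (π⁻¹.name a) = a := by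
  rw [← name_mul, mul_inv_cancel, name_one]

theorem name_injective : Function.Injective π.name :=
  Function.LeftInverse.injective (g := π⁻¹.name) (name_inv_name π)

theorem name_surjective : Function.Surjective π.name := fun a => ⟨_, name_name_inv π a⟩

@[simp] theorem name_inj {a b : Name} : π.name a = π.name b ↔ a = b := π.name_injective.eq_iff

theorem inv_name_eq {a : Name} (h : π.name a = a) : π⁻¹.name a = a := by
  conv_lhs => rw [← h]
  simp

@[simp] theorem name_mem_names {a : Name} {X : Finset Name} : π.name a ∈ π.names X ↔ a ∈ X := by
  simp [names]

@[simp] theorem loc_mem_names {x : ℕ} {X : Finset Name} :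
    Name.loc (π.loc x) ∈ π.names X ↔ Name.loc x ∈ X := π.name_mem_names (a := .loc x)

@[simp] theorem fn_mem_names {x : ℕ} {X : Finset Name} :
    Name.fn (π.fn x) ∈ π.names X ↔ Name.fn x ∈ X := π.name_mem_names (a := .fn x)

@[simp] theorem cont_mem_names {x : ℕ} {X : Finset Name} :
    Name.cont (π.cont x) ∈ π.names X ↔ Name.cont x ∈ X := π.name_mem_names (a := .cont x)

theorem mem_names {a : Name} {X : Finset Name} : a ∈ π.names X ↔ π⁻¹.name a ∈ X := by
  have := π.name_mem_names (a := π⁻¹.name a) (X := X)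
  rwa [name_name_inv] at this

@[simp] theorem names_one (X : Finset Name) : (1 : NPerm).names X = X := by
  ext a; simp [mem_names]

@[simp] theorem names_mul (X : Finset Name) : (π * ρ).names X = π.names (ρ.names X) := by
  ext a; simp [mem_names]

@[simp] theorem names_empty : π.names ∅ = ∅ := rfl

@[simp] theorem names_union (X Y : Finset Name) : π.names (X ∪ Y) = π.names X ∪ π.names Y :=
  Finset.image_union _ _

@[simp] theorem names_insert (a : Name) (X : Finset Name) :
    π.names (insert a X) = insert (π.name a) (π.names X) := Finset.image_insert _ _ _

@[simp] theorem names_singleton (a : Name) : π.names {a} = {π.name a} := Finset.image_singleton _ _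

theorem names_inter (X Y : Finset Name) : π.names (X ∩ Y) = π.names X ∩ π.names Y :=
  Finset.image_inter _ _ π.name_injective

theorem names_subset {X Y : Finset Name} : π.names X ⊆ π.names Y ↔ X ⊆ Y :=
  Finset.image_subset_image_iff π.name_injective

/-- The permutation fixes the given names. -/
def Fixes (π : NPerm) (X : Finset Name) : Prop := ∀ a ∈ X, π.name a = a

theorem Fixes.names_eq {π : NPerm} {X : Finset Name} (h : π.Fixes X) : π.names X = X := by
  ext a
  rw [mem_names]
  constructor
  · intro ha
    have := h _ ha
    rw [name_name_inv] at this
    rwa [this]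
  · intro ha
    rwa [inv_name_eq _ (h a ha)]

theorem Fixes.one (X : Finset Name) : (1 : NPerm).Fixes X := fun a _ => name_one a

theorem Fixes.mul {π ρ : NPerm} {X : Finset Name} (h : π.Fixes X) (h' : ρ.Fixes X) :
    (π * ρ).Fixes X := fun a ha => by rw [name_mul, h' a ha, h a ha]

theorem Fixes.inv {π : NPerm} {X : Finset Name} (h : π.Fixes X) : π⁻¹.Fixes X :=
  fun a ha => inv_name_eq _ (h a ha)

theorem Fixes.mono {π : NPerm} {X Y : Finset Name} (h : π.Fixes X) (hY : Y ⊆ X) : π.Fixes Y :=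
  fun a ha => h a (hY ha)

/-! Values -/

theorem atom_one (a : Atom) : (1 : NPerm).atom a = a := by cases a <;> simp [atom]

theorem atom_mul (a : Atom) : (π * ρ).atom a = π.atom (ρ.atom a) := by cases a <;> simp [atom]

theorem value_one (v : Value) : (1 : NPerm).value v = v := by
  have : (1 : NPerm).atom = id := funext atom_one
  simp [value, this]

theorem value_mul (v : Value) : (π * ρ).value v = π.value (ρ.value v) := by
  have : (π * ρ).atom = π.atom ∘ ρ.atom := funext (atom_mul π ρ)
  simp [value, this]

theorem value_injective : Function.Injective π.value :=
  Function.LeftInverse.injective (g := π⁻¹.value) fun v => by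
    rw [← value_mul, inv_mul_cancel, value_one]

@[simp] theorem value_nil : π.value [] = [] := rfl

@[simp] theorem value_append (v w : Value) : π.value (v ++ w) = π.value v ++ π.value w := by
  simp [value]

@[simp] theorem value_name (a : Name) : π.value [.name a] = [.name (π.name a)] := rfl

@[simp] theorem value_int (n : ℤ) : π.value [.int n] = [.int n] := rfl

@[simp] theorem value_ofBool (b : Bool) : π.value (ofBool b) = ofBool b := rfl

@[simp] theorem value_length (v : Value) : (π.value v).length = v.length := by simp [value]

theorem names_value (v : Value) : Value.names (π.value v) = π.names (Value.names v) := by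
  ext a
  rw [mem_names, Value.mem_names, Value.mem_names, value, List.mem_map]
  constructor
  · rintro ⟨b, hb, h⟩
    cases b with
    | name c => simp only [atom, Atom.name.injEq] at h; subst h; simpa using hb
    | int n => simp [atom] at h
  · intro h
    exact ⟨_, h, by simp [atom]⟩

theorem value_congr {π ρ : NPerm} {v : Value} (h : ∀ a ∈ Value.names v, π.name a = ρ.name a) :
    π.value v = ρ.value v := by
  refine List.map_congr_left fun a ha => ?_
  cases a with
  | name c => simp [atom, h c (Value.mem_names.2 ha)]
  | int n => rfl

/-! Data -/

@[simp] theorem data_int (n : ℤ) : π.data (.int n) = .int n := rfl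

theorem data_one (d : Data) : (1 : NPerm).data d = d := by cases d <;> rfl

theorem data_mul (d : Data) : (π * ρ).data d = π.data (ρ.data d) := by cases d <;> rfl

theorem toValue_data (d : Data) : (π.data d).toValue = π.value d.toValue := by cases d <;> rfl

theorem names_data (d : Data) : (π.data d).names = π.names d.names := by
  cases d <;> simp [data, Data.names]

theorem data_congr {π ρ : NPerm} {d : Data} (h : ∀ a ∈ d.names, π.name a = ρ.name a) :
    π.data d = ρ.data d := by
  cases d with
  | int n => rfl
  | loc x => have := h (.loc x) (by simp [Data.names]); simpa [data] using this
  | fn x => have := h (.fn x) (by simp [Data.names]); simpa [data] using this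

/-! Expressions -/

theorem exp_one (e : Exp) : (1 : NPerm).exp e = e := by
  induction e <;> simp_all [exp, value_one]

theorem exp_mul (e : Exp) : (π * ρ).exp e = π.exp (ρ.exp e) := by
  induction e <;> simp_all [exp, value_mul]

theorem names_exp (e : Exp) : (π.exp e).names = π.names e.names := by
  induction e <;> simp_all [exp, Exp.names, names_value]

theorem exp_congr {π ρ : NPerm} {e : Exp} (h : ∀ a ∈ e.names, π.name a = ρ.name a) :
    π.exp e = ρ.exp e := by
  induction e <;>
    simp_all [exp, Exp.names, or_imp, forall_and]
  exact value_congr h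

/-- Identifiers are not names, so a permutation passes binders and acts on the substituted values
only. `σ` is general because `localIn` removes a binding from it. -/
theorem exp_subst (σ : Ident → Option Value) (e : Exp) :
    π.exp (e.subst σ) = (π.exp e).subst fun x => (σ x).map π.value := by
  induction e generalizing σ with
  | var x => simp only [Exp.subst, exp]; cases σ x <;> rfl
  | localIn x e ih =>
    simp only [Exp.subst, exp, ih]
    congr 2
    funext y
    by_cases h : y = x
    · subst h; simp
    · simp [Function.update_of_ne h]
  | _ => simp_all [Exp.subst, exp]

theorem func_inst (F : Func) (v : Value) : π.exp (F.inst v) = (π.func F).inst (π.value v) := by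
  simp only [Func.inst, func, exp_subst]
  congr 1
  funext x
  generalize F.params = l
  induction l generalizing v with
  | nil => simp
  | cons y l ih =>
    cases v with
    | nil => simp
    | cons a v =>
      simp only [value, List.map_cons, List.zip_cons_cons, List.lookup_cons]
      by_cases h : x = y
      · simp [h, value]
      · have : (x == y) = false := by simpa using h
        simpa [this, value] using ih v

theorem func_one (F : Func) : (1 : NPerm).func F = F := by simp [func, exp_one]

theorem func_mul (F : Func) : (π * ρ).func F = π.func (ρ.func F) := by simp [func, exp_mul]

/-! Stacks -/

theorem frame_one (F : Frame) : (1 : NPerm).frame F = F := by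
  cases F <;> simp [frame, exp_one, value_one]

theorem frame_mul (F : Frame) : (π * ρ).frame F = π.frame (ρ.frame F) := by
  cases F <;> simp [frame, exp_mul, value_mul]

theorem names_frame (F : Frame) : (π.frame F).names = π.names F.names := by
  cases F <;> simp [frame, Frame.names, names_exp, names_value]

theorem frame_congr {π ρ : NPerm} {F : Frame} (h : ∀ a ∈ F.names, π.name a = ρ.name a) :
    π.frame F = ρ.frame F := by
  cases F <;> simp only [Frame.names, Finset.mem_union, or_imp, forall_and] at h <;>
    simp only [frame]
  · rw [exp_congr h.1, exp_congr h.2]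
  all_goals first | rw [exp_congr h] | rw [value_congr h]

@[simp] theorem stack_nil : π.stack [] = [] := rfl

@[simp] theorem stack_cons (F : Frame) (t : Stack) :
    π.stack (F :: t) = π.frame F :: π.stack t := rfl

@[simp] theorem stack_append (t u : Stack) : π.stack (t ++ u) = π.stack t ++ π.stack u := by
  simp [stack]

theorem stack_one (t : Stack) : (1 : NPerm).stack t = t := by
  induction t <;> simp_all [frame_one]

theorem stack_mul (t : Stack) : (π * ρ).stack t = π.stack (ρ.stack t) := by
  induction t <;> simp_all [frame_mul]

theorem names_stack (t : Stack) : Stack.names (π.stack t) = π.names (Stack.names t) := by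
  induction t <;> simp_all [names_frame]

theorem stack_congr {π ρ : NPerm} {t : Stack} (h : ∀ a ∈ Stack.names t, π.name a = ρ.name a) :
    π.stack t = ρ.stack t := by
  induction t with
  | nil => rfl
  | cons F t ih =>
    simp only [Stack.names_cons, Finset.mem_union, or_imp, forall_and] at h
    rw [stack_cons, stack_cons, frame_congr h.1, ih h.2]

/-! Stores -/

/-- Action on location stores. -/
def lstore (s : LocStore) : LocStore := s.bimap π.loc π.data

/-- Action on continuation stores. -/
def cstore (c : FinPFun Cont (Stack × Cont)) : FinPFun Cont (Stack × Cont) :=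
  c.bimap π.cont fun p => (π.stack p.1, π.cont p.2)

@[simp] theorem store_loc (s : Store) : (π.store s).loc = π.lstore s.loc := rfl

@[simp] theorem store_cont (s : Store) : (π.store s).cont = π.cstore s.cont := rfl

@[simp] theorem lstore_apply (s : LocStore) (x : Loc) :
    π.lstore s (π.loc x) = (s x).map π.data := FinPFun.bimap_apply_apply _ _ _ _

@[simp] theorem cstore_apply (c : FinPFun Cont (Stack × Cont)) (k : Cont) :
    π.cstore c (π.cont k) = (c k).map fun p => (π.stack p.1, π.cont p.2) :=
  FinPFun.bimap_apply_apply _ _ _ _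

@[simp] theorem code_apply (D : Code) (f : Fn) : π.code D (π.fn f) = (D f).map π.func :=
  FinPFun.bimap_apply_apply _ _ _ _

theorem lstore_one (s : LocStore) : (1 : NPerm).lstore s = s :=
  FinPFun.bimap_one _ data_one s

theorem lstore_mul (s : LocStore) : (π * ρ).lstore s = π.lstore (ρ.lstore s) := by
  have : (π * ρ).data = π.data ∘ ρ.data := funext (data_mul π ρ)
  rw [lstore, lstore, lstore, FinPFun.bimap_bimap, this]; rfl

theorem cstore_one (s : FinPFun Cont (Stack × Cont)) : (1 : NPerm).cstore s = s :=
  FinPFun.bimap_one _ (fun p => by simp [stack_one]) s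

theorem cstore_mul (s : FinPFun Cont (Stack × Cont)) :
    (π * ρ).cstore s = π.cstore (ρ.cstore s) := by
  rw [cstore, cstore, cstore, FinPFun.bimap_bimap]
  congr 1
  funext p
  simp [stack_mul]

theorem code_one (D : Code) : (1 : NPerm).code D = D := FinPFun.bimap_one _ func_one D

theorem code_mul (D : Code) : (π * ρ).code D = π.code (ρ.code D) := by
  have : (π * ρ).func = π.func ∘ ρ.func := funext (func_mul π ρ)
  rw [code, code, code, FinPFun.bimap_bimap, this]; rfl

theorem store_one (s : Store) : (1 : NPerm).store s = s :=
  Store.ext (lstore_one _) (cstore_one _)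

theorem store_mul (s : Store) : (π * ρ).store s = π.store (ρ.store s) :=
  Store.ext (lstore_mul _ _ _) (cstore_mul _ _ _)

theorem config_one (c : Config) : (1 : NPerm).config c = c := by
  cases c <;> simp [config, store_one, stack_one, exp_one]

theorem config_mul (c : Config) : (π * ρ).config c = π.config (ρ.config c) := by
  cases c <;> simp [config, store_mul, stack_mul, exp_mul]

theorem names_lstore (s : LocStore) : LocStore.names (π.lstore s) = π.names (LocStore.names s) := by
  ext a
  obtain ⟨a, rfl⟩ := π.name_surjective a
  rw [name_mem_names, LocStore.mem_names, LocStore.mem_names]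
  constructor
  · rintro ⟨x, d, hd, h⟩
    obtain ⟨x, rfl⟩ := π.loc.surjective x
    rw [lstore_apply, Option.map_eq_some_iff] at hd
    obtain ⟨d, hd, rfl⟩ := hd
    refine ⟨x, d, hd, ?_⟩
    rwa [names_data, name_mem_names, ← name_loc, name_inj] at h
  · rintro ⟨x, d, hd, h⟩
    refine ⟨π.loc x, π.data d, by simp [hd], ?_⟩
    rwa [names_data, name_mem_names, ← name_loc, name_inj]

theorem lstore_override (s s' : LocStore) :
    π.lstore (s.override s') = (π.lstore s).override (π.lstore s') :=
  FinPFun.bimap_override _ _ _ _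

theorem lstore_set (s : LocStore) (x : Loc) (d : Data) :
    π.lstore (s.set x d) = (π.lstore s).set (π.loc x) (π.data d) :=
  FinPFun.bimap_set _ _ _ _ _

theorem cstore_set (s : FinPFun Cont (Stack × Cont)) (k : Cont) (p : Stack × Cont) :
    π.cstore (s.set k p) = (π.cstore s).set (π.cont k) (π.stack p.1, π.cont p.2) :=
  FinPFun.bimap_set _ _ _ _ _

theorem lstore_restrictTo (s : LocStore) (X : Finset Name) :
    π.lstore (LocStore.restrictTo s X) = LocStore.restrictTo (π.lstore s) (π.names X) := by
  apply FinPFun.ext_apply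
  intro x
  obtain ⟨x, rfl⟩ := π.loc.surjective x
  simp only [lstore_apply, LocStore.restrictTo_apply, loc_mem_names]
  split <;> rfl

theorem lstore_congr {π ρ : NPerm} {s : LocStore}
    (h : ∀ a ∈ LocStore.names s, π.name a = ρ.name a) : π.lstore s = ρ.lstore s := by
  refine FinPFun.bimap_congr fun x d hd => ⟨?_, data_congr fun a ha => h a ?_⟩
  · have := h (.loc x) (LocStore.mem_names.2 ⟨x, d, hd, Or.inl rfl⟩)
    simpa using this
  · exact LocStore.mem_names.2 ⟨x, d, hd, Or.inr ha⟩

theorem reach_rename {s : LocStore} {X : Finset Name} {a : Name} (h : Reach s X a) :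
    Reach (π.lstore s) (π.names X) (π.name a) := by
  induction h with
  | base h => exact .base (by simpa using h)
  | step _ hx hb ih =>
    refine Reach.step ih (by rw [lstore_apply, hx]; rfl) ?_
    rw [names_data]
    simpa using hb

/-- Reachability is preserved by `π`; applied to `π⁻¹`, this shows that it is also reflected. -/
theorem names_closure (s : LocStore) (X : Finset Name) :
    closure (π.lstore s) (π.names X) = π.names (closure s X) := by
  ext a
  rw [mem_names, mem_closure, mem_closure]
  constructor
  · intro h
    have := reach_rename π⁻¹ h
    rwa [← lstore_mul, ← names_mul, inv_mul_cancel, lstore_one, names_one] at this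
  · intro h
    have := reach_rename π h
    rwa [name_name_inv] at this

/-- Action on labels. -/
def label : Label → Label
  | .call f v k => .call (π.fn f) (π.value v) (π.cont k)
  | .ret v k => .ret (π.value v) (π.cont k)

theorem label_one (α : Label) : (1 : NPerm).label α = α := by
  cases α <;> simp [label, value_one]

theorem label_mul (α : Label) : (π * ρ).label α = π.label (ρ.label α) := by
  cases α <;> simp [label, value_mul]

theorem label_congr {π ρ : NPerm} {α : Label} (h : ∀ a ∈ α.names, π.name a = ρ.name a) :
    π.label α = ρ.label α := by
  cases α with
  | call f v k =>
    have h₁ := h (.fn f) (by simp [Label.names])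
    have h₂ := h (.cont k) (by simp [Label.names])
    have h₃ := value_congr (v := v) fun a ha => h a (by simp [Label.names, ha])
    simp_all [label]
  | ret v k =>
    have h₂ := h (.cont k) (by simp [Label.names])
    have h₃ := value_congr (v := v) fun a ha => h a (by simp [Label.names, ha])
    simp_all [label]

end NPerm

namespace State

variable (π ρ : NPerm) (X : State)

theorem rename_one : X.rename 1 = X := by
  cases X; simp [rename, NPerm.code_one, NPerm.config_one]

theorem rename_mul : X.rename (π * ρ) = (X.rename ρ).rename π := by
  cases X; simp [rename, NPerm.code_mul, NPerm.config_mul]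

@[simp] theorem rename_inv_rename : (X.rename π).rename π⁻¹ = X := by
  rw [← rename_mul, inv_mul_cancel, rename_one]

@[simp] theorem rename_rename_inv : (X.rename π⁻¹).rename π = X := by
  rw [← rename_mul, mul_inv_cancel, rename_one]

theorem pub_rename : (X.rename π).pub = π.names X.pub := by
  cases X with
  | mk D c => cases c <;> rfl

end State

end SLS

namespace SLS

/-! ### Equivariance of the transitions -/

/-- Only the equality tests see names, and they are invariant because `π.value` is injective. All
results are integers and therefore fixed. -/
theorem BinOp.eval_rename (π : NPerm) {b : BinOp} {v w u : Value} (h : b.eval v w = some u) :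
    b.eval (π.value v) (π.value w) = some (π.value u) := by
  have key : ∀ v w : Value, π.value v = π.value w ↔ v = w := fun v w => π.value_injective.eq_iff
  cases b
  case eq => simp only [BinOp.eval, Option.some.injEq] at h ⊢; subst h; simp [key]
  case ne => simp only [BinOp.eval, Option.some.injEq] at h ⊢; subst h; simp [key]
  all_goals
    unfold BinOp.eval at h
    split at h <;> simp_all [BinOp.eval]
    all_goals first | (subst h; rfl) | (obtain ⟨_, rfl⟩ := h; rfl)

theorem IStep.rename (π : NPerm) {D : Code} {c c' : Config} (h : IStep D c c') :
    IStep (π.code D) (π.config c) (π.config c') := by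
  cases h with
  | iteTrue hn => exact .iteTrue hn
  | iteFalse => exact .iteFalse
  | opL => exact .opL
  | opRBin h => exact .opRBin (BinOp.eval_rename π h)
  | opRSeq => exact .opRSeq
  | @opRAssign N P s t v k x d h =>
    have := @IStep.opRAssign (π.code D) (π.names N) (π.names P) (π.store s) (π.stack t)
      (π.value v) (π.cont k) (π.loc x) (π.data d) (by rw [h, NPerm.toValue_data])
    rw [NPerm.store_loc, ← NPerm.lstore_set] at this
    exact this
  | @deref N P s t k x d h =>
    have := @IStep.deref (π.code D) (π.names N) (π.names P) (π.store s) (π.stack t)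
      (π.cont k) (π.loc x) (π.data d) (by simp [h])
    rw [NPerm.toValue_data] at this
    exact this
  | ret => exact .ret
  | @localIn N P s t x e k a h =>
    have := @IStep.localIn (π.code D) (π.names N) (π.names P) (π.store s) (π.stack t) x
      (π.exp e) (π.cont k) (π.loc a) (by simpa using h)
    rw [NPerm.store_loc, ← NPerm.data_int π 0, ← NPerm.lstore_set, ← NPerm.name_loc,
      ← NPerm.names_insert] at this
    have he : π.exp (e.subst fun y => if y = x then some [.name (.loc a)] else none) =
        (π.exp e).subst fun y => if y = x then some [.name (π.name (.loc a))] else none := by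
      rw [NPerm.exp_subst]
      congr 1
      funext y
      split <;> simp
    rw [← he] at this
    exact this
  | appL => exact .appL
  | pairL => exact .pairL
  | pairR =>
    simp only [NPerm.config, NPerm.exp, NPerm.value_append]
    exact .pairR
  | call hf hl =>
    simp only [NPerm.config, NPerm.func_inst]
    exact .call (by simp [hf]) (by simpa [NPerm.func] using hl)
  | pushIte => exact .pushIte
  | pushOp => exact .pushOp
  | pushUop => exact .pushUop
  | @new N P s t k a h =>
    have := @IStep.new (π.code D) (π.names N) (π.names P) (π.store s) (π.stack t)
      (π.cont k) (π.loc a) (by simpa using h)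
    rw [NPerm.store_loc, ← NPerm.data_int π 0, ← NPerm.lstore_set, ← NPerm.name_loc,
      ← NPerm.names_insert] at this
    exact this
  | pushApp => exact .pushApp
  | pushPair => exact .pushPair

theorem SysMay.rename (π : NPerm) {N P : Finset Name} {s : Store} {X : Finset Name} {v : Value}
    {s' : LocStore} (h : SysMay N P s X v s') :
    SysMay (π.names N) (π.names P) (π.store s) (π.names X) (π.value v) (π.lstore s') := by
  obtain ⟨h₁, h₂, h₃⟩ := h
  refine ⟨?_, ?_, ?_⟩
  · rw [NPerm.names_value, NPerm.names_lstore, ← NPerm.names_union, ← NPerm.names_union,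
      ← NPerm.names_inter, NPerm.names_subset]
    exact h₁
  · intro x
    obtain ⟨x, rfl⟩ := π.loc.surjective x
    rw [NPerm.names_value, NPerm.names_lstore, NPerm.loc_mem_names, NPerm.loc_mem_names]
    exact h₂ x
  · intro x
    obtain ⟨x, rfl⟩ := π.loc.surjective x
    rw [NPerm.store_loc, NPerm.lstore, FinPFun.mem_dom_bimap, NPerm.loc_mem_names, NPerm.lstore,
      FinPFun.mem_dom_bimap]
    exact h₃ x

theorem LStep.rename (π : NPerm) {D : Code} {c c' : Config} {α : Label} {s : LocStore}
    (h : LStep D c α s c') :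
    LStep (π.code D) (π.config c) (π.label α) (π.lstore s) (π.config c') := by
  cases h with
  | @progCall N P s t v k f k' P' hf hk hP =>
    have := @LStep.progCall (π.code D) (π.names N) (π.names P) (π.store s) (π.stack t)
      (π.value v) (π.cont k) (π.fn f) (π.cont k') (π.names P') (by simp [hf]) (by simpa using hk)
      (by rw [hP, ← NPerm.names_closure, NPerm.names_union, NPerm.names_value]; rfl)
    rw [NPerm.store_loc, ← NPerm.lstore_restrictTo] at this
    rw [NPerm.store_cont, ← NPerm.cstore_set π s.cont k' (t, k), ← NPerm.name_cont,
      ← NPerm.names_insert, ← NPerm.names_insert] at this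
    exact this
  | @sysRet N P s' t v k _ k' hk hS =>
    have := @LStep.sysRet (π.code D) (π.names N) (π.names P) (π.store s') (π.stack t)
      (π.value v) (π.cont k) (π.lstore s) (π.cont k') (by simp [hk]) (hS.rename π)
    rw [NPerm.names_value, NPerm.names_lstore, NPerm.store_loc, ← NPerm.lstore_override,
      ← NPerm.names_union, ← NPerm.names_union, ← NPerm.names_union] at this
    exact this
  | @sysCall N P s' v _ f k hf hk hS =>
    have := @LStep.sysCall (π.code D) (π.names N) (π.names P) (π.store s')
      (π.value v) (π.lstore s) (π.fn f) (π.cont k) (by simpa using hf)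
      (by rw [NPerm.store_cont, NPerm.cstore, FinPFun.mem_dom_bimap]; exact hk)
      (by simpa using hS.rename π)
    rw [NPerm.names_value, NPerm.names_lstore, NPerm.store_loc, ← NPerm.lstore_override,
      ← NPerm.name_cont, ← NPerm.names_insert, ← NPerm.names_insert,
      ← NPerm.names_union, ← NPerm.names_union, ← NPerm.names_union] at this
    exact this
  | @progRet N P s v k P' hP =>
    have := @LStep.progRet (π.code D) (π.names N) (π.names P) (π.store s)
      (π.value v) (π.cont k) (π.names P')
      (by rw [hP, ← NPerm.names_closure, NPerm.names_union, NPerm.names_value]; rfl)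
    rw [NPerm.store_loc, ← NPerm.lstore_restrictTo] at this
    exact this

/-! ### Equivariance of computations and of weak transitions -/

open Relation

namespace State

/-- Reachability by internal transitions. -/
abbrev Steps : State → State → Prop := ReflTransGen Step

variable {X Y : State} {α : Label} {s : LocStore}

theorem Step.rename (π : NPerm) (h : X.Step Y) : (X.rename π).Step (Y.rename π) :=
  ⟨by simp [State.rename, h.1], h.2.rename π⟩

theorem Steps.rename (π : NPerm) (h : X.Steps Y) : (X.rename π).Steps (Y.rename π) :=
  by
  induction h with
  | refl => exact .refl
  | tail _ h ih => exact ih.tail (Step.rename π h)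

theorem Trans.rename (π : NPerm) (h : X.Trans α s Y) :
    (X.rename π).Trans (π.label α) (π.lstore s) (Y.rename π) :=
  ⟨by simp [State.rename, h.1], h.2.rename π⟩

theorem WeakTrans.rename (π : NPerm) (h : X.WeakTrans α s Y) :
    (X.rename π).WeakTrans (π.label α) (π.lstore s) (Y.rename π) := by
  obtain ⟨Z, h₁, h₂⟩ := h
  exact ⟨_, Steps.rename π h₁, h₂.rename π⟩

/-- Used to pull a label back along `π⁻¹`, match it there, and carry the answer forward again. -/
theorem WeakTrans.of_inv (π : NPerm) (h : X.WeakTrans (π⁻¹.label α) (π⁻¹.lstore s) Y) :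
    (X.rename π).WeakTrans α s (Y.rename π) := by
  have := h.rename π
  rwa [← NPerm.label_mul, ← NPerm.lstore_mul, mul_inv_cancel, NPerm.label_one,
    NPerm.lstore_one] at this

end State

/-! ### Components of states -/

namespace Config

/-- The used names. -/
def used : Config → Finset Name
  | .prog N _ _ _ _ _ => N
  | .sys N _ _ => N

/-- The store. -/
def store : Config → Store
  | .prog _ _ s _ _ _ => s
  | .sys _ _ s => s

/-- Frame stack, expression and continuation of a program configuration. -/
def ctrl : Config → Option (Stack × Exp × Cont)
  | .prog _ _ _ t e k => some (t, e, k)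
  | .sys _ _ _ => none

end Config

namespace State

/-- The used names. -/
def used (X : State) : Finset Name := X.conf.used

/-- The location store. -/
def loc (X : State) : LocStore := X.conf.store.loc

/-- The stored continuations. -/
def cont (X : State) : FinPFun Cont (Stack × Cont) := X.conf.store.cont

/-- Frame stack, expression and continuation of a program configuration. -/
def ctrl (X : State) : Option (Stack × Exp × Cont) := X.conf.ctrl

variable (π : NPerm) (X : State)

theorem used_rename : (X.rename π).used = π.names X.used := by
  cases X with
  | mk D c => cases c <;> rfl

theorem loc_rename : (X.rename π).loc = π.lstore X.loc := by
  cases X with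
  | mk D c => cases c <;> rfl

theorem cont_rename : (X.rename π).cont = π.cstore X.cont := by
  cases X with
  | mk D c => cases c <;> rfl

theorem code_rename : (X.rename π).code = π.code X.code := rfl

theorem ctrl_rename :
    (X.rename π).ctrl = X.ctrl.map fun p => (π.stack p.1, π.exp p.2.1, π.cont p.2.2) := by
  cases X with
  | mk D c => cases c <;> rfl

variable {X}

theorem eq_of_ctrl_eq_some {t : Stack} {e : Exp} {k : Cont} (h : X.ctrl = some (t, e, k)) :
    X = ⟨X.code, .prog X.used X.pub ⟨X.loc, X.cont⟩ t e k⟩ := by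
  rcases X with ⟨D, c⟩
  cases c with
  | prog => cases h; rfl
  | sys => cases h

theorem eq_of_ctrl_eq_none (h : X.ctrl = none) :
    X = ⟨X.code, .sys X.used X.pub ⟨X.loc, X.cont⟩⟩ := by
  rcases X with ⟨D, c⟩
  cases c with
  | prog => cases h
  | sys => rfl

/-- States whose used names contain their support, and whose private names are locations and
functions with a definition. In system configurations the public names are closed under the
store. -/
structure Good (X : State) : Prop where
  code_names : ∀ f F, X.code f = some F → Name.fn f ∈ X.used ∧ F.body.names ⊆ X.used
  pub_used : X.pub ⊆ X.used
  loc_names : ∀ x d, X.loc x = some d → Name.loc x ∈ X.used ∧ d.names ⊆ X.used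
  cont_names : ∀ k t l, X.cont k = some (t, l) →
    Name.cont k ∈ X.used ∧ Stack.names t ⊆ X.used ∧ Name.cont l ∈ X.used
  ctrl_names : ∀ t e k, X.ctrl = some (t, e, k) →
    Stack.names t ⊆ X.used ∧ e.names ⊆ X.used ∧ Name.cont k ∈ X.used
  private_sort : ∀ a ∈ X.used, a ∉ X.pub → (∃ x, a = .loc x) ∨ ∃ f, a = .fn f ∧ X.code f ≠ none
  closed : X.ctrl = none → ∀ x d, X.loc x = some d → Name.loc x ∈ X.pub → d.names ⊆ X.pub

theorem Good.names_loc {X : State} (h : X.Good) : LocStore.names X.loc ⊆ X.used := by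
  intro a ha
  obtain ⟨x, d, hd, h'⟩ := LocStore.mem_names.1 ha
  rcases h' with rfl | h'
  · exact (h.loc_names x d hd).1
  · exact (h.loc_names x d hd).2 h'

/-- Private names are locations or functions by `private_sort`. Continuations in labels therefore
never reveal anything private. -/
theorem Good.cont_mem_pub {X : State} (h : X.Good) {k : Cont} (hk : Name.cont k ∈ X.used) :
    Name.cont k ∈ X.pub := by
  by_contra hc
  rcases h.private_sort _ hk hc with ⟨x, hx⟩ | ⟨f, hf, _⟩ <;> simp_all

theorem Good.fn_mem_pub {X : State} (h : X.Good) {f : Fn} (hf : Name.fn f ∈ X.used)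
    (hD : X.code f = none) : Name.fn f ∈ X.pub := by
  by_contra hc
  rcases h.private_sort _ hf hc with ⟨x, hx⟩ | ⟨f', hf', h'⟩ <;> simp_all

theorem Good.rename (π : NPerm) {X : State} (h : X.Good) : (X.rename π).Good where
  code_names f F hf := by
    obtain ⟨f, rfl⟩ := π.fn.surjective f
    rw [code_rename, NPerm.code_apply, Option.map_eq_some_iff] at hf
    obtain ⟨F, hF, rfl⟩ := hf
    rw [used_rename, NPerm.fn_mem_names, NPerm.func, NPerm.names_exp, NPerm.names_subset]
    exact h.code_names f F hF
  pub_used := by rw [pub_rename, used_rename, NPerm.names_subset]; exact h.pub_used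
  loc_names x d hd := by
    obtain ⟨x, rfl⟩ := π.loc.surjective x
    rw [loc_rename, NPerm.lstore_apply, Option.map_eq_some_iff] at hd
    obtain ⟨d, hd, rfl⟩ := hd
    rw [used_rename, NPerm.loc_mem_names, NPerm.names_data, NPerm.names_subset]
    exact h.loc_names x d hd
  cont_names k t l hk := by
    obtain ⟨k, rfl⟩ := π.cont.surjective k
    rw [cont_rename, NPerm.cstore_apply, Option.map_eq_some_iff] at hk
    obtain ⟨⟨t, l⟩, hk, h'⟩ := hk
    cases h'
    rw [used_rename, NPerm.cont_mem_names, NPerm.names_stack, NPerm.names_subset,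
      NPerm.cont_mem_names]
    exact h.cont_names k t l hk
  ctrl_names t e k hk := by
    rw [ctrl_rename, Option.map_eq_some_iff] at hk
    obtain ⟨⟨t, e, k⟩, hk, h'⟩ := hk
    cases h'
    rw [used_rename, NPerm.names_exp, NPerm.names_stack, NPerm.names_subset, NPerm.names_subset,
      NPerm.cont_mem_names]
    exact h.ctrl_names t e k hk
  private_sort a ha hb := by
    obtain ⟨a, rfl⟩ := π.name_surjective a
    rw [used_rename, NPerm.name_mem_names] at ha
    rw [pub_rename, NPerm.name_mem_names] at hb
    rcases h.private_sort a ha hb with ⟨x, rfl⟩ | ⟨f, rfl, hf⟩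
    · exact Or.inl ⟨_, rfl⟩
    · refine Or.inr ⟨_, rfl, ?_⟩
      rw [code_rename, NPerm.code_apply]
      simpa using hf
  closed hc x d hd hx := by
    obtain ⟨x, rfl⟩ := π.loc.surjective x
    rw [loc_rename, NPerm.lstore_apply, Option.map_eq_some_iff] at hd
    obtain ⟨d, hd, rfl⟩ := hd
    rw [pub_rename, NPerm.loc_mem_names] at hx
    rw [pub_rename, NPerm.names_data, NPerm.names_subset]
    refine h.closed ?_ x d hd hx
    rwa [ctrl_rename, Option.map_eq_none_iff] at hc

/-- All names that occur in the state are among `X.used`, so the action of a permutation is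
determined there. -/
theorem Good.rename_congr {X : State} (h : X.Good) {π ρ : NPerm}
    (hπ : ∀ a ∈ X.used, π.name a = ρ.name a) : X.rename π = X.rename ρ := by
  have hcode : π.code X.code = ρ.code X.code := by
    refine FinPFun.bimap_congr fun f F hF => ?_
    obtain ⟨h₁, h₂⟩ := h.code_names f F hF
    refine ⟨by simpa using hπ _ h₁, ?_⟩
    rw [NPerm.func, NPerm.func, NPerm.exp_congr fun a ha => hπ a (h₂ ha)]
  have hloc : π.lstore X.loc = ρ.lstore X.loc :=
    NPerm.lstore_congr fun a ha => hπ a (h.names_loc ha)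
  have hcont : π.cstore X.cont = ρ.cstore X.cont := by
    refine FinPFun.bimap_congr fun k p hp => ?_
    obtain ⟨h₁, h₂, h₃⟩ := h.cont_names k p.1 p.2 hp
    refine ⟨by simpa using hπ _ h₁, ?_⟩
    rw [NPerm.stack_congr fun a ha => hπ a (h₂ ha)]
    have : π.cont p.2 = ρ.cont p.2 := by simpa using hπ _ h₃
    rw [this]
  have hN : π.names X.used = ρ.names X.used := Finset.image_congr fun a ha => hπ a ha
  have hP : π.names X.pub = ρ.names X.pub :=
    Finset.image_congr fun a ha => hπ a (h.pub_used ha)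
  cases hc : X.ctrl with
  | none =>
    rw [eq_of_ctrl_eq_none hc]
    simp only [State.rename, NPerm.config, NPerm.store]
    rw [hcode, hN, hP]
    congr 3
  | some p =>
    obtain ⟨t, e, k⟩ := p
    obtain ⟨h₁, h₂, h₃⟩ := h.ctrl_names t e k hc
    have hk : π.cont k = ρ.cont k := by simpa using hπ _ h₃
    rw [eq_of_ctrl_eq_some hc]
    simp only [State.rename, NPerm.config, NPerm.store]
    rw [hcode, hN, hP, NPerm.stack_congr fun a ha => hπ a (h₁ ha),
      NPerm.exp_congr fun a ha => hπ a (h₂ ha), hk]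
    congr 3

theorem Good.rename_eq_self {X : State} (h : X.Good) {π : NPerm} (hπ : π.Fixes X.used) :
    X.rename π = X := by
  rw [h.rename_congr (ρ := 1) fun a ha => by rw [hπ a ha, NPerm.name_one], rename_one]

end State

end SLS

namespace SLS

/-! ### Internal transitions in context -/

/-- Supports of substitution instances. -/
theorem Exp.names_subst_subset {B : Finset Name} {σ : Ident → Option Value}
    (hσ : ∀ x v, σ x = some v → Value.names v ⊆ B) {e : Exp} (he : e.names ⊆ B) :
    (e.subst σ).names ⊆ B := by
  induction e generalizing σ with
  | var x =>
    simp only [Exp.subst]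
    cases h : σ x with
    | none => simp [Exp.names]
    | some v => exact hσ x v h
  | localIn x e ih =>
    refine ih ?_ he
    intro y v hy
    by_cases hxy : y = x
    · subst hxy; simp at hy
    · rw [Function.update_of_ne hxy] at hy
      exact hσ y v hy
  | _ =>
    simp only [Exp.names, Finset.union_subset_iff] at he
    simp only [Exp.subst, Exp.names, Finset.union_subset_iff]
    grind

theorem lookup_zip_mem {l : List Ident} {v : Value} {x : Ident} {a : Atom}
    (h : (l.zip v).lookup x = some a) : a ∈ v := by
  induction l generalizing v with
  | nil => simp at h
  | cons y l ih =>
    cases v with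
    | nil => simp at h
    | cons b v =>
      rw [List.zip_cons_cons, List.lookup_cons] at h
      split at h
      · simp_all
      · exact List.mem_cons_of_mem _ (ih h)

theorem Func.names_inst_subset {B : Finset Name} {F : Func} {v : Value}
    (hF : F.body.names ⊆ B) (hv : Value.names v ⊆ B) : (F.inst v).names ⊆ B := by
  refine Exp.names_subst_subset ?_ hF
  intro x w hw
  rw [Option.map_eq_some_iff] at hw
  obtain ⟨a, ha, rfl⟩ := hw
  intro b hb
  rw [Value.mem_names, List.mem_singleton] at hb
  exact hv (Value.mem_names.2 (hb ▸ lookup_zip_mem ha))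

theorem BinOp.names_eval {b : BinOp} {v w u : Value} (h : b.eval v w = some u) :
    Value.names u = ∅ := by
  unfold BinOp.eval at h
  split at h <;> simp_all
  all_goals first | (subst h; simp [ofBool]) | (obtain ⟨_, rfl⟩ := h; simp)

/-- Optional update of a location store. -/
def updLoc (s : LocStore) : Option (Loc × Data) → LocStore
  | none => s
  | some (x, d) => s.set x d

/-- Optional extension of a set of names by a location. -/
def addLoc (N : Finset Name) : Option Loc → Finset Name
  | none => N
  | some a => insert (.loc a) N

theorem mem_addLoc {N : Finset Name} {A : Option Loc} {a : Name} :
    a ∈ addLoc N A ↔ a ∈ N ∨ ∃ x, A = some x ∧ a = .loc x := by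
  cases A with
  | none => simp [addLoc]
  | some x => simp [addLoc, or_comm]

/-- An internal transition only depends on, and only affects, part of the configuration. -/
theorem IStep.frame {D : Code} {N P : Finset Name} {s : Store} {t : Stack} {e : Exp} {k : Cont}
    {c' : Config} (h : IStep D (.prog N P s t e k) c') :
    ∃ A δ t' e', c' = .prog (addLoc N A) P ⟨updLoc s.loc δ, s.cont⟩ t' e' k ∧
      (∀ a, A = some a → Name.loc a ∉ N) ∧
      (∀ B : Finset Name, (∀ f F, D f = some F → F.body.names ⊆ B) →
        (∀ x d, s.loc x = some d → d.names ⊆ B) → Stack.names t ⊆ B → e.names ⊆ B →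
        (∀ a, A = some a → Name.loc a ∈ B) →
        Stack.names t' ⊆ B ∧ e'.names ⊆ B ∧
          ∀ x d, δ = some (x, d) → Name.loc x ∈ B ∧ d.names ⊆ B) ∧
      ∀ (D₂ : Code) N₂ P₂ (S₂ : Store) u k₂, (∀ f F, D f = some F → D₂ f = some F) →
        (∀ x d, Name.loc x ∈ e.names → s.loc x = some d → S₂.loc x = some d) →
        (∀ a, A = some a → Name.loc a ∉ N₂) →
        IStep D₂ (.prog N₂ P₂ S₂ (t ++ u) e k₂)
          (.prog (addLoc N₂ A) P₂ ⟨updLoc S₂.loc δ, S₂.cont⟩ (t' ++ u) e' k₂) := by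
  -- `A` is the allocated location and `δ` the write to the store, if any. The only rule that reads
  -- the store is `deref`, at a location of the current expression; hence agreement of the stores on
  -- `e.names` is enough.
  cases h with
  | iteTrue hn =>
    refine ⟨none, none, _, _, rfl, by simp, fun B _ _ ht he _ => ?_,
      fun _ _ _ _ _ _ _ _ _ => .iteTrue hn⟩
    simp_all [Frame.names, Finset.union_subset_iff]
  | iteFalse =>
    refine ⟨none, none, _, _, rfl, by simp, fun B _ _ ht he _ => ?_,
      fun _ _ _ _ _ _ _ _ _ => .iteFalse⟩
    simp_all [Frame.names, Finset.union_subset_iff]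
  | opL =>
    refine ⟨none, none, _, _, rfl, by simp, fun B _ _ ht he _ => ?_,
      fun _ _ _ _ _ _ _ _ _ => .opL⟩
    simp_all [Frame.names, Finset.union_subset_iff, Exp.names]
  | opRBin hb =>
    refine ⟨none, none, _, _, rfl, by simp, fun B _ _ ht he _ => ?_,
      fun _ _ _ _ _ _ _ _ _ => .opRBin hb⟩
    simp_all [Frame.names, Finset.union_subset_iff, Exp.names, BinOp.names_eval hb]
  | opRSeq =>
    refine ⟨none, none, _, _, rfl, by simp, fun B _ _ ht he _ => ?_,
      fun _ _ _ _ _ _ _ _ _ => .opRSeq⟩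
    simp_all [Frame.names, Finset.union_subset_iff, Exp.names]
  | @opRAssign _ _ _ _ v _ x d hv =>
    refine ⟨none, some (x, d), _, _, rfl, by simp, fun B _ _ ht he _ => ?_,
      fun _ _ _ _ _ _ _ _ _ => .opRAssign hv⟩
    subst hv
    simp_all [Frame.names, Finset.insert_subset_iff, Exp.names]
  | @deref _ _ _ _ _ x d hd =>
    refine ⟨none, none, _, _, rfl, by simp, fun B _ hs ht he _ => ?_,
      fun _ _ _ _ _ _ _ hs _ => .deref (hs _ _ (by simp [Exp.names]) hd)⟩
    have := hs _ _ hd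
    simp_all [Frame.names, Exp.names]
  | ret =>
    refine ⟨none, none, _, _, rfl, by simp, fun B _ _ ht he _ => ?_,
      fun _ _ _ _ _ _ _ _ _ => .ret⟩
    simp_all [Frame.names, Exp.names]
  | @localIn _ _ _ _ x e _ a ha =>
    refine ⟨some a, some (a, .int 0), _, _, rfl, by simpa using ha, fun B _ _ ht he hA => ?_,
      fun _ _ _ _ _ _ _ _ hA => .localIn (hA _ rfl)⟩
    refine ⟨ht, Exp.names_subst_subset ?_ he, ?_⟩
    · intro y v hy
      have := hA a rfl
      split at hy
      · cases hy; simpa using this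
      · cases hy
    · rintro _ _ ⟨⟩
      exact ⟨hA a rfl, by simp [Data.names]⟩
  | appL =>
    refine ⟨none, none, _, _, rfl, by simp, fun B _ _ ht he _ => ?_,
      fun _ _ _ _ _ _ _ _ _ => .appL⟩
    simp_all [Frame.names, Finset.union_subset_iff, Exp.names]
  | pairL =>
    refine ⟨none, none, _, _, rfl, by simp, fun B _ _ ht he _ => ?_,
      fun _ _ _ _ _ _ _ _ _ => .pairL⟩
    simp_all [Frame.names, Finset.union_subset_iff, Exp.names]
  | pairR =>
    refine ⟨none, none, _, _, rfl, by simp, fun B _ _ ht he _ => ?_,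
      fun _ _ _ _ _ _ _ _ _ => .pairR⟩
    simp_all [Frame.names, Finset.union_subset_iff, Exp.names]
  | call hf hl =>
    refine ⟨none, none, _, _, rfl, by simp, fun B hD _ ht he _ => ?_,
      fun _ _ _ _ _ _ hD _ _ => .call (hD _ _ hf) hl⟩
    refine ⟨?_, Func.names_inst_subset (hD _ _ hf) (by simpa [Exp.names] using he), by simp⟩
    simp_all [Finset.union_subset_iff]
  | pushIte =>
    refine ⟨none, none, _, _, rfl, by simp, fun B _ _ ht he _ => ?_,
      fun _ _ _ _ _ _ _ _ _ => .pushIte⟩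
    simp_all [Frame.names, Finset.union_subset_iff, Exp.names]
  | pushOp =>
    refine ⟨none, none, _, _, rfl, by simp, fun B _ _ ht he _ => ?_,
      fun _ _ _ _ _ _ _ _ _ => .pushOp⟩
    simp_all [Frame.names, Finset.union_subset_iff, Exp.names]
  | pushUop =>
    refine ⟨none, none, _, _, rfl, by simp, fun B _ _ ht he _ => ?_,
      fun _ _ _ _ _ _ _ _ _ => .pushUop⟩
    simp_all [Frame.names, Exp.names]
  | @new _ _ _ _ _ a ha =>
    refine ⟨some a, some (a, .int 0), _, _, rfl, by simpa using ha, fun B _ _ ht he hA => ?_,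
      fun _ _ _ _ _ _ _ _ hA => .new (hA _ rfl)⟩
    refine ⟨ht, by simpa [Exp.names] using hA a rfl, ?_⟩
    rintro _ _ ⟨⟩
    exact ⟨hA a rfl, by simp [Data.names]⟩
  | pushApp =>
    refine ⟨none, none, _, _, rfl, by simp, fun B _ _ ht he _ => ?_,
      fun _ _ _ _ _ _ _ _ _ => .pushApp⟩
    simp_all [Frame.names, Finset.union_subset_iff, Exp.names]
  | pushPair =>
    refine ⟨none, none, _, _, rfl, by simp, fun B _ _ ht he _ => ?_,
      fun _ _ _ _ _ _ _ _ _ => .pushPair⟩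
    simp_all [Frame.names, Finset.union_subset_iff, Exp.names]

/-- An internal transition that does not involve the outer part `u` of the frame stack is
possible without it. -/
theorem IStep.unframe {D₂ : Code} {N₂ P₂ : Finset Name} {S₂ : Store} {t u : Stack} {e : Exp}
    {k₂ : Cont} {c' : Config} (h : IStep D₂ (.prog N₂ P₂ S₂ (t ++ u) e k₂) c')
    {D : Code} {N : Finset Name} (P : Finset Name) {s : Store} (k : Cont)
    (hu : ∀ v, e = .val v → t = [] → u = [])
    (hD : ∀ f F r v, t = .appR [.name (.fn f)] :: r → e = .val v → D₂ f = some F → D f = some F)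
    (hs : ∀ x d, Name.loc x ∈ e.names → S₂.loc x = some d → s.loc x = some d)
    (hN : ∀ x, Name.loc x ∉ N₂ → Name.loc x ∈ c'.used → Name.loc x ∉ N) :
    ∃ A δ t' e', c' = .prog (addLoc N₂ A) P₂ ⟨updLoc S₂.loc δ, S₂.cont⟩ (t' ++ u) e' k₂ ∧
      (∀ a, A = some a → Name.loc a ∉ N₂) ∧
      IStep D (.prog N P s t e k) (.prog (addLoc N A) P ⟨updLoc s.loc δ, s.cont⟩ t' e' k) := by
  -- A value consumes the topmost frame. By `hu` this frame belongs to `t` and not to `u`.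
  have key : ∀ {F T v}, t ++ u = F :: T → e = .val v → ∃ r, t = F :: r ∧ T = r ++ u := by
    intro F T v hT he
    cases t with
    | nil => simp [hu v he rfl] at hT
    | cons G r => simp only [List.cons_append, List.cons.injEq] at hT
                  exact ⟨r, by rw [hT.1], hT.2.symm⟩
  generalize hT : t ++ u = T at h
  cases h with
  | iteTrue hn =>
    obtain ⟨r, rfl, rfl⟩ := key hT rfl
    exact ⟨none, none, _, _, rfl, by simp, .iteTrue hn⟩
  | iteFalse =>
    obtain ⟨r, rfl, rfl⟩ := key hT rfl
    exact ⟨none, none, _, _, rfl, by simp, .iteFalse⟩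
  | opL =>
    obtain ⟨r, rfl, rfl⟩ := key hT rfl
    exact ⟨none, none, _ :: r, _, rfl, by simp, .opL⟩
  | opRBin hb =>
    obtain ⟨r, rfl, rfl⟩ := key hT rfl
    exact ⟨none, none, _, _, rfl, by simp, .opRBin hb⟩
  | opRSeq =>
    obtain ⟨r, rfl, rfl⟩ := key hT rfl
    exact ⟨none, none, _, _, rfl, by simp, .opRSeq⟩
  | @opRAssign _ _ _ _ v _ x d hv =>
    obtain ⟨r, rfl, rfl⟩ := key hT rfl
    exact ⟨none, some (x, d), _, _, rfl, by simp, .opRAssign hv⟩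
  | @deref _ _ _ _ _ x d hd =>
    obtain ⟨r, rfl, rfl⟩ := key hT rfl
    exact ⟨none, none, _, _, rfl, by simp, .deref (hs _ _ (by simp [Exp.names]) hd)⟩
  | ret =>
    obtain ⟨r, rfl, rfl⟩ := key hT rfl
    exact ⟨none, none, _, _, rfl, by simp, .ret⟩
  | @localIn _ _ _ _ x e _ a ha =>
    subst hT
    exact ⟨some a, some (a, .int 0), _, _, rfl, by simpa using ha, .localIn (hN _ ha (by simp [Config.used]))⟩
  | appL =>
    obtain ⟨r, rfl, rfl⟩ := key hT rfl
    exact ⟨none, none, _ :: r, _, rfl, by simp, .appL⟩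
  | pairL =>
    obtain ⟨r, rfl, rfl⟩ := key hT rfl
    exact ⟨none, none, _ :: r, _, rfl, by simp, .pairL⟩
  | pairR =>
    obtain ⟨r, rfl, rfl⟩ := key hT rfl
    exact ⟨none, none, _, _, rfl, by simp, .pairR⟩
  | call hf hl =>
    obtain ⟨r, rfl, rfl⟩ := key hT rfl
    exact ⟨none, none, _, _, rfl, by simp, .call (hD _ _ _ _ rfl rfl hf) hl⟩
  | pushIte =>
    subst hT
    exact ⟨none, none, _ :: t, _, rfl, by simp, .pushIte⟩
  | pushOp =>
    subst hT
    exact ⟨none, none, _ :: t, _, rfl, by simp, .pushOp⟩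
  | pushUop =>
    subst hT
    exact ⟨none, none, _ :: t, _, rfl, by simp, .pushUop⟩
  | @new _ _ _ _ _ a ha =>
    subst hT
    exact ⟨some a, some (a, .int 0), _, _, rfl, by simpa using ha, .new (hN _ ha (by simp [Config.used]))⟩
  | pushApp =>
    subst hT
    exact ⟨none, none, _ :: t, _, rfl, by simp, .pushApp⟩
  | pushPair =>
    subst hT
    exact ⟨none, none, _ :: t, _, rfl, by simp, .pushPair⟩

/-! ### Closures -/

theorem subset_closure {s : LocStore} {X : Finset Name} : X ⊆ closure s X :=
  fun _ h => mem_closure.2 (.base h)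

theorem closure_closed {s : LocStore} {X : Finset Name} {x : Loc} {d : Data} (h : s x = some d)
    (hx : Name.loc x ∈ closure s X) : d.names ⊆ closure s X :=
  fun _ hb => mem_closure.2 (.step (mem_closure.1 hx) h hb)

theorem closure_subset {s : LocStore} {X B : Finset Name} (hX : X ⊆ B)
    (hs : ∀ x d, s x = some d → Name.loc x ∈ B → d.names ⊆ B) : closure s X ⊆ B := by
  intro a ha
  rw [mem_closure] at ha
  induction ha with
  | base h => exact hX h
  | step _ hx hb ih => exact hs _ _ hx ih hb

theorem names_restrictTo_subset {s : LocStore} {X : Finset Name}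
    (hs : ∀ x d, s x = some d → Name.loc x ∈ X → d.names ⊆ X) :
    LocStore.names (LocStore.restrictTo s X) ⊆ X := by
  intro a ha
  obtain ⟨x, d, hd, h⟩ := LocStore.mem_names.1 ha
  rw [LocStore.restrictTo_apply] at hd
  split at hd
  · rename_i hx
    rcases h with rfl | h
    · exact hx
    · exact hs x d hd hx h
  · cases hd

theorem names_restrictTo_closure_subset {s : LocStore} {X : Finset Name} :
    LocStore.names (LocStore.restrictTo s (closure s X)) ⊆ closure s X :=
  names_restrictTo_subset fun _ _ h hx => closure_closed h hx

/-- A name that is reached but not given is the content of a reached location, so the restricted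
store shows it. Thus the names that a transition publishes can be read off its label. -/
theorem closure_subset_union {s : LocStore} {X : Finset Name} :
    closure s X ⊆ X ∪ LocStore.names (LocStore.restrictTo s (closure s X)) := by
  intro a ha
  have ha' := mem_closure.1 ha
  cases ha' with
  | base h => exact Finset.mem_union_left _ h
  | @step x d _ hx hd hb =>
    refine Finset.mem_union_right _ (LocStore.mem_names.2 ⟨x, d, ?_, Or.inr hb⟩)
    rw [LocStore.restrictTo_apply, if_pos (mem_closure.2 hx), hd]

/-- Closures only depend on the reachable part of the store. -/
theorem closure_congr {s w : LocStore} {X B : Finset Name} (hX : X ⊆ B)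
    (hs : ∀ x d, w x = some d → Name.loc x ∈ B → d.names ⊆ B)
    (h : ∀ x, Name.loc x ∈ B → s x = w x) : closure s X = closure w X := by
  have hw : closure w X ⊆ B := closure_subset hX hs
  apply Finset.Subset.antisymm
  · refine closure_subset subset_closure fun x d hd hx => ?_
    rw [h x (hw hx)] at hd
    exact closure_closed hd hx
  · intro a ha
    rw [mem_closure] at ha
    induction ha with
    | base h => exact subset_closure h
    | step hx hd hb ih =>
      refine closure_closed ?_ ih hb
      rw [h _ (hw (mem_closure.2 hx)), hd]

theorem restrictTo_congr {s w : LocStore} {X : Finset Name}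
    (h : ∀ x, Name.loc x ∈ X → s x = w x) :
    LocStore.restrictTo s X = LocStore.restrictTo w X := by
  apply FinPFun.ext_apply
  intro x
  rw [LocStore.restrictTo_apply, LocStore.restrictTo_apply]
  split
  · exact h x ‹_›
  · rfl

namespace State

/-! ### Preservation of supports -/

variable {X Y Z : State} {α : Label} {s : LocStore}

theorem Step.exists_ctrl (h : X.Step Y) : ∃ t e k, X.ctrl = some (t, e, k) := by
  rcases X with ⟨D, c⟩
  cases c with
  | prog N P s t e k => exact ⟨t, e, k, rfl⟩
  | sys N P s => obtain ⟨_, h⟩ := h; cases h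

/-- Internal transitions in terms of the components of states. -/
theorem Step.elim (h : X.Step Y) : ∃ t e k A δ t' e', X.ctrl = some (t, e, k) ∧
    Y = ⟨X.code, .prog (addLoc X.used A) X.pub ⟨updLoc X.loc δ, X.cont⟩ t' e' k⟩ ∧
    (∀ a, A = some a → Name.loc a ∉ X.used) ∧
    (∀ B : Finset Name, (∀ f F, X.code f = some F → F.body.names ⊆ B) →
        (∀ x d, X.loc x = some d → d.names ⊆ B) → Stack.names t ⊆ B → e.names ⊆ B →
        (∀ a, A = some a → Name.loc a ∈ B) →
        Stack.names t' ⊆ B ∧ e'.names ⊆ B ∧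
          ∀ x d, δ = some (x, d) → Name.loc x ∈ B ∧ d.names ⊆ B) ∧
    ∀ (D₂ : Code) N₂ P₂ (S₂ : Store) u k₂, (∀ f F, X.code f = some F → D₂ f = some F) →
        (∀ x d, Name.loc x ∈ e.names → X.loc x = some d → S₂.loc x = some d) →
        (∀ a, A = some a → Name.loc a ∉ N₂) →
        IStep D₂ (.prog N₂ P₂ S₂ (t ++ u) e k₂)
          (.prog (addLoc N₂ A) P₂ ⟨updLoc S₂.loc δ, S₂.cont⟩ (t' ++ u) e' k₂) := by
  obtain ⟨t, e, k, hc⟩ := h.exists_ctrl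
  rw [eq_of_ctrl_eq_some hc] at h
  rcases Y with ⟨D, c⟩
  obtain ⟨rfl, h⟩ := h
  obtain ⟨A, δ, t', e', rfl, h₁, h₂, h₃⟩ := h.frame
  exact ⟨t, e, k, A, δ, t', e', hc, rfl, h₁, h₂, h₃⟩

theorem Step.good (hX : X.Good) (h : X.Step Y) : Y.Good := by
  obtain ⟨t, e, k, A, δ, t', e', hc, rfl, hA, hB, -⟩ := h.elim
  have hsub : X.used ⊆ addLoc X.used A := fun a ha => mem_addLoc.2 (Or.inl ha)
  obtain ⟨h₁, h₂, h₃⟩ := hX.ctrl_names _ _ _ hc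
  obtain ⟨g₁, g₂, g₃⟩ := hB (addLoc X.used A)
    (fun f F hF => (hX.code_names f F hF).2.trans hsub)
    (fun x d hd => (hX.loc_names x d hd).2.trans hsub) (h₁.trans hsub) (h₂.trans hsub)
    (fun a ha => mem_addLoc.2 (Or.inr ⟨a, ha, rfl⟩))
  refine ⟨fun f F hF => ?_, hX.pub_used.trans hsub, fun x d hd => ?_, fun l r m hl => ?_,
    ?_, fun a ha hb => ?_, fun h => nomatch h⟩
  · obtain ⟨h₁, h₂⟩ := hX.code_names f F hF
    exact ⟨hsub h₁, h₂.trans hsub⟩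
  · change updLoc X.loc δ x = some d at hd
    have old : X.loc x = some d → Name.loc x ∈ addLoc X.used A ∧ d.names ⊆ addLoc X.used A := by
      intro hd
      obtain ⟨h₁, h₂⟩ := hX.loc_names x d hd
      exact ⟨hsub h₁, h₂.trans hsub⟩
    rcases δ with _ | ⟨y, d'⟩
    · exact old hd
    · rw [updLoc, FinPFun.set_apply] at hd
      split at hd
      · cases hd
        subst_vars
        exact g₃ _ _ rfl
      · exact old hd
  · obtain ⟨h₁, h₂, h₃⟩ := hX.cont_names l r m hl
    exact ⟨hsub h₁, h₂.trans hsub, hsub h₃⟩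
  · rintro _ _ _ ⟨⟩
    exact ⟨g₁, g₂, hsub h₃⟩
  · rcases mem_addLoc.1 ha with ha | ⟨x, _, rfl⟩
    · exact hX.private_sort a ha hb
    · exact Or.inl ⟨x, rfl⟩

theorem Step.pub_eq (h : X.Step Y) : Y.pub = X.pub := by
  obtain ⟨t, e, k, A, δ, t', e', hc, rfl, -⟩ := h.elim
  rfl

theorem Step.used_subset (h : X.Step Y) : X.used ⊆ Y.used := by
  obtain ⟨t, e, k, A, δ, t', e', hc, rfl, -⟩ := h.elim
  exact fun a ha => mem_addLoc.2 (Or.inl ha)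

theorem Steps.good (hX : X.Good) (h : X.Steps Y) : Y.Good := by
  induction h with
  | refl => exact hX
  | tail _ h ih => exact h.good ih

theorem Steps.pub_eq (h : X.Steps Y) : Y.pub = X.pub := by
  induction h with
  | refl => rfl
  | tail _ h ih => rw [h.pub_eq, ih]

theorem Steps.used_subset (h : X.Steps Y) : X.used ⊆ Y.used := by
  induction h with
  | refl => exact subset_rfl
  | tail _ h ih => exact ih.trans h.used_subset

theorem Steps.eq_of_ctrl_eq_none (h : X.Steps Y) (hX : X.ctrl = none) : X = Y := by
  cases h using Relation.ReflTransGen.head_induction_on with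
  | refl => rfl
  | head h =>
    obtain ⟨t, e, k, h⟩ := h.exists_ctrl
    simp [hX] at h

/-- A labelled transition publishes the names of its label. -/
theorem Trans.pub_used (hX : X.Good) (h : X.Trans α s Y) :
    Y.pub = X.pub ∪ (α.names ∪ LocStore.names s) ∧
      Y.used = X.used ∪ (α.names ∪ LocStore.names s) := by
  rcases X with ⟨D, c⟩
  rcases Y with ⟨D', c'⟩
  obtain ⟨rfl, h⟩ := h
  dsimp only at h
  have hclos : ∀ {N P t e k} {s : Store} {v : Value}, State.Good ⟨D', .prog N P s t e k⟩ →
      Value.names v ⊆ N →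
      closure s.loc (P ∪ Value.names v) ⊆ N := fun hX hv =>
    closure_subset (Finset.union_subset hX.pub_used hv) fun x d hd _ => (hX.loc_names x d hd).2
  cases h with
  | @progCall N P s t v k f k' P' hf hk hP =>
    obtain ⟨h₁, h₂, h₃⟩ := hX.ctrl_names _ _ _ rfl
    -- A used function name without definition cannot be private, so its occurrence in the label
    -- publishes nothing new.
    have hfP : Name.fn f ∈ P := hX.fn_mem_pub (h₁ (by simp [Frame.names])) hf
    have hP₁ : P' ⊆ N := hP ▸ hclos hX h₂
    have hP₂ : P ∪ Value.names v ⊆ P' := hP ▸ subset_closure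
    have hP₃ : P' ⊆ (P ∪ Value.names v) ∪ LocStore.names (LocStore.restrictTo s.loc P') :=
      hP ▸ closure_subset_union
    have hP₄ : LocStore.names (LocStore.restrictTo s.loc P') ⊆ P' :=
      hP ▸ names_restrictTo_closure_subset
    simp only [Finset.subset_iff, Finset.mem_union] at hP₁ hP₂ hP₃ hP₄
    have hPN := @hX.pub_used
    simp only [State.pub, State.used, Config.pub, Config.used, Label.names] at hPN ⊢
    constructor <;> ext a <;> simp only [Finset.mem_union, Finset.mem_insert]
    · grind
    · grind
  | @progRet N P s v k P' hP =>
    obtain ⟨h₁, h₂, h₃⟩ := hX.ctrl_names _ _ _ rfl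
    have hfP : Name.cont k ∈ P := hX.cont_mem_pub h₃
    have hP₁ : P' ⊆ N := hP ▸ hclos hX h₂
    have hP₂ : P ∪ Value.names v ⊆ P' := hP ▸ subset_closure
    have hP₃ : P' ⊆ (P ∪ Value.names v) ∪ LocStore.names (LocStore.restrictTo s.loc P') :=
      hP ▸ closure_subset_union
    have hP₄ : LocStore.names (LocStore.restrictTo s.loc P') ⊆ P' :=
      hP ▸ names_restrictTo_closure_subset
    simp only [Finset.subset_iff, Finset.mem_union] at hP₁ hP₂ hP₃ hP₄
    have hPN := @hX.pub_used
    simp only [State.pub, State.used, Config.pub, Config.used, Label.names] at hPN ⊢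
    constructor <;> ext a <;> simp only [Finset.mem_union, Finset.mem_insert]
    · grind
    · grind
  | @sysRet N P s t v k _ k' hk hS =>
    have h₁ : Name.cont k' ∈ N := (hX.cont_names _ _ _ hk).1
    have h₂ : Name.cont k' ∈ P := hX.cont_mem_pub h₁
    simp only [State.pub, State.used, Config.pub, Config.used, Label.names]
    constructor <;> ext a <;> simp only [Finset.mem_union, Finset.mem_insert] <;> grind
  | @sysCall N P s v _ f k hf hk hS =>
    obtain ⟨F, hF⟩ := Option.isSome_iff_exists.1 hf
    have h₁ : Name.fn f ∈ N := (hX.code_names f F hF).1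
    have h₂ : Name.fn f ∈ P := hS.1 (by simp [h₁])
    simp only [State.pub, State.used, Config.pub, Config.used, Label.names]
    constructor <;> ext a <;> simp only [Finset.mem_union, Finset.mem_insert] <;> grind

/-- By `Trans.pub_used`, names that become used become public at the same time, so no private names
arise. System configurations are entered with a closure, possibly extended by a continuation, as set
of public names; this gives the field `closed`. -/
theorem Trans.good (hX : X.Good) (h : X.Trans α s Y) : Y.Good := by
  obtain ⟨hP, hN⟩ := h.pub_used hX
  have hsub : X.used ⊆ Y.used := hN ▸ Finset.subset_union_left
  have hcode : Y.code = X.code := h.1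
  have c₁ : ∀ f F, Y.code f = some F → Name.fn f ∈ Y.used ∧ F.body.names ⊆ Y.used := by
    intro f F hF
    rw [hcode] at hF
    obtain ⟨h₁, h₂⟩ := hX.code_names f F hF
    exact ⟨hsub h₁, h₂.trans hsub⟩
  have c₂ : Y.pub ⊆ Y.used := by
    rw [hP, hN]
    exact Finset.union_subset_union_left hX.pub_used
  have c₃ : ∀ a ∈ Y.used, a ∉ Y.pub →
      (∃ x, a = .loc x) ∨ ∃ f, a = .fn f ∧ Y.code f ≠ none := by
    intro a ha hb
    rw [hN, Finset.mem_union] at ha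
    rw [hP, Finset.mem_union, not_or] at hb
    rw [hcode]
    rcases ha with ha | ha
    · exact hX.private_sort a ha hb.1
    · exact absurd ha hb.2
  have c₄ : ∀ x d, X.loc x = some d → Name.loc x ∈ Y.used ∧ d.names ⊆ Y.used := by
    intro x d hd
    obtain ⟨h₁, h₂⟩ := hX.loc_names x d hd
    exact ⟨hsub h₁, h₂.trans hsub⟩
  have c₅ : ∀ l r m, X.cont l = some (r, m) →
      Name.cont l ∈ Y.used ∧ Stack.names r ⊆ Y.used ∧ Name.cont m ∈ Y.used := by
    intro l r m hl
    obtain ⟨h₁, h₂, h₃⟩ := hX.cont_names l r m hl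
    exact ⟨hsub h₁, h₂.trans hsub, hsub h₃⟩
  have c₆ : LocStore.names s ⊆ Y.used := by
    rw [hN]
    exact Finset.subset_union_right.trans Finset.subset_union_right
  have c₇ : ∀ x d, X.loc.override s x = some d → Name.loc x ∈ Y.used ∧ d.names ⊆ Y.used := by
    intro x d hd
    rw [FinPFun.override_apply, Option.or_eq_some_iff] at hd
    rcases hd with hd | ⟨_, hd⟩
    · exact ⟨c₆ (LocStore.mem_names.2 ⟨x, d, hd, Or.inl rfl⟩),
        fun a ha => c₆ (LocStore.mem_names.2 ⟨x, d, hd, Or.inr ha⟩)⟩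
    · exact c₄ x d hd
  have c₈ : α.names ⊆ Y.used := by
    rw [hN]
    exact Finset.subset_union_left.trans Finset.subset_union_right
  rcases X with ⟨D, c⟩
  rcases Y with ⟨D', c'⟩
  obtain ⟨rfl, h⟩ := h
  dsimp only at h
  cases h with
  | @progCall N P s t v k f k' P' hf hk hP' =>
    obtain ⟨h₁, h₂, h₃⟩ := hX.ctrl_names _ _ _ rfl
    refine ⟨c₁, c₂, c₄, fun l r m hl => ?_, nofun, c₃, fun _ x d hd hx => ?_⟩
    · change (FinPFun.set s.cont k' (t, k)) l = some (r, m) at hl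
      rw [FinPFun.set_apply] at hl
      split at hl
      · cases hl
        subst_vars
        refine ⟨c₈ (by simp [Label.names]), Finset.Subset.trans ?_ (h₁.trans hsub), hsub h₃⟩
        simp
      · exact c₅ l r m hl
    · subst hP'
      refine Finset.Subset.trans (closure_closed (s := s.loc) hd ?_) (Finset.subset_insert _ _)
      exact (Finset.mem_insert.1 hx).resolve_left nofun
  | @progRet N P s v k P' hP' =>
    refine ⟨c₁, c₂, c₄, c₅, nofun, c₃, fun _ x d hd hx => ?_⟩
    subst hP'
    exact closure_closed hd hx
  | @sysRet N P s t v k _ k' hk hS =>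
    obtain ⟨h₁, h₂, h₃⟩ := c₅ _ _ _ hk
    refine ⟨c₁, c₂, c₇, c₅, ?_, c₃, nofun⟩
    rintro _ _ _ ⟨⟩
    refine ⟨h₂, fun a ha => c₈ ?_, h₃⟩
    simp_all [Label.names, Exp.names]
  | @sysCall N P s v _ f k hf hk hS =>
    obtain ⟨F, hF⟩ := Option.isSome_iff_exists.1 hf
    refine ⟨c₁, c₂, c₇, c₅, ?_, c₃, nofun⟩
    rintro _ _ _ ⟨⟩
    refine ⟨?_, fun a ha => c₈ ?_, c₈ (by simp [Label.names])⟩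
    · simpa [Frame.names] using c₈ (by simp [Label.names])
    · simp_all [Label.names, Exp.names]

/-! ### Control and names in labelled transitions -/

theorem Trans.ctrl_eq_none_iff (h : X.Trans α s Y) : X.ctrl = none ↔ Y.ctrl ≠ none := by
  rcases X with ⟨D, c⟩
  rcases Y with ⟨D', c'⟩
  obtain ⟨rfl, h⟩ := h
  cases h <;> simp [ctrl, Config.ctrl]

/-- The system does not know the private names. -/
theorem Trans.names_inter (hX : X.Good) (h : X.Trans α s Y) (hc : X.ctrl = none) :
    ∀ a ∈ α.names ∪ LocStore.names s, a ∈ X.used → a ∈ X.pub := by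
  rcases X with ⟨D, c⟩
  rcases Y with ⟨D', c'⟩
  obtain ⟨rfl, h⟩ := h
  dsimp only at h
  intro a ha hu
  cases h with
  | progCall => cases hc
  | progRet => cases hc
  | @sysRet N P s t v k _ k' hk hS =>
    by_cases hak : a = .cont k'
    · subst hak; exact hX.cont_mem_pub hu
    · refine hS.1 (Finset.mem_inter.2 ⟨?_, hu⟩)
      simp_all [Label.names]
  | @sysCall N P s v _ f k hf hk hS =>
    by_cases hak : a = .cont k
    · subst hak; exact hX.cont_mem_pub hu
    · refine hS.1 (Finset.mem_inter.2 ⟨?_, hu⟩)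
      simp_all [Label.names]

/-- The program only communicates used names and a fresh continuation. -/
theorem Trans.names_subset (hX : X.Good) (h : X.Trans α s Y) (hc : X.ctrl ≠ none) :
    ∀ a ∈ α.names ∪ LocStore.names s,
      a ∈ X.used ∨ a ∉ X.used ∧ ∃ f v k, α = .call f v k ∧ a = .cont k := by
  rcases X with ⟨D, c⟩
  rcases Y with ⟨D', c'⟩
  obtain ⟨rfl, h⟩ := h
  dsimp only at h
  intro a ha
  have hclos : ∀ {N P t e k} {s : Store} {v : Value}, State.Good ⟨D', .prog N P s t e k⟩ →
      Value.names v ⊆ N →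
      closure s.loc (P ∪ Value.names v) ⊆ N := fun hX hv =>
    closure_subset (Finset.union_subset hX.pub_used hv) fun x d hd _ => (hX.loc_names x d hd).2
  cases h with
  | @progCall N P s t v k f k' P' hf hk hP =>
    obtain ⟨h₁, h₂, h₃⟩ := hX.ctrl_names _ _ _ rfl
    have hP₁ : P' ⊆ N := hP ▸ hclos hX h₂
    have hP₄ : LocStore.names (LocStore.restrictTo s.loc P') ⊆ P' :=
      hP ▸ names_restrictTo_closure_subset
    simp only [Label.names, Finset.mem_union, Finset.mem_insert] at ha
    rcases ha with (rfl | rfl | ha) | ha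
    · exact Or.inl (h₁ (by simp [Frame.names]))
    · exact Or.inr ⟨hk, f, v, k', rfl, rfl⟩
    · exact Or.inl (h₂ ha)
    · exact Or.inl (hP₁ (hP₄ ha))
  | @progRet N P s v k P' hP =>
    obtain ⟨h₁, h₂, h₃⟩ := hX.ctrl_names _ _ _ rfl
    have hP₁ : P' ⊆ N := hP ▸ hclos hX h₂
    have hP₄ : LocStore.names (LocStore.restrictTo s.loc P') ⊆ P' :=
      hP ▸ names_restrictTo_closure_subset
    simp only [Label.names, Finset.mem_union, Finset.mem_insert] at ha
    rcases ha with (rfl | ha) | ha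
    · exact Or.inl h₃
    · exact Or.inl (h₂ ha)
    · exact Or.inl (hP₁ (hP₄ ha))
  | sysRet => exact absurd rfl hc
  | sysCall => exact absurd rfl hc

/-- Transitions are determined by their labels. -/
theorem Trans.eq_of_sys (hc : X.ctrl = none) (h : X.Trans α s Y) (h' : X.Trans α s Z) : Y = Z := by
  rcases X with ⟨D, c⟩
  rcases Y with ⟨D', c'⟩
  rcases Z with ⟨D'', c''⟩
  obtain ⟨rfl, h⟩ := h
  obtain ⟨rfl, h'⟩ := h'
  dsimp only at h h'
  cases h with
  | progCall => cases hc
  | progRet => cases hc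
  | sysRet hk hS =>
    cases h' with
    | sysRet hk' hS' =>
      rw [hk] at hk'
      cases hk'
      rfl
  | sysCall => cases h'; rfl

/-- A program has no choice of the store either: it shows its own store on a closure that `α`
determines. Therefore equality of the stores is part of the conclusion. -/
theorem Trans.eq_of_prog (hc : X.ctrl ≠ none) {s' : LocStore} (h : X.Trans α s Y)
    (h' : X.Trans α s' Z) : s = s' ∧ Y = Z := by
  rcases X with ⟨D, c⟩
  rcases Y with ⟨D', c'⟩
  rcases Z with ⟨D'', c''⟩
  obtain ⟨rfl, h⟩ := h
  obtain ⟨rfl, h'⟩ := h'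
  dsimp only at h h'
  cases h with
  | progCall _ _ hP =>
    cases h' with
    | progCall _ _ hP' =>
      subst hP hP'
      exact ⟨rfl, rfl⟩
  | progRet hP =>
    cases h' with
    | progRet hP' =>
      subst hP hP'
      exact ⟨rfl, rfl⟩
  | sysRet => exact absurd rfl hc
  | sysCall => exact absurd rfl hc

end State

end SLS

namespace SLS

/-! ### Existence of permutations -/

/-- The sort of a name. -/
def Name.sort : Name → ℕ
  | .loc _ => 0
  | .fn _ => 1
  | .cont _ => 2

/-- The index of a name. -/
def Name.idx : Name → ℕ
  | .loc n => n
  | .fn n => n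
  | .cont n => n

theorem finite_swap (a b : ℕ) : {n | Equiv.swap a b n ≠ n}.Finite := by
  refine (Set.toFinite {a, b}).subset fun n hn => ?_
  by_contra hc
  simp only [Set.mem_insert_iff, Set.mem_singleton_iff, not_or] at hc
  exact hn (Equiv.swap_apply_of_ne_of_ne hc.1 hc.2)

namespace NPerm

@[simp] theorem sort_name (π : NPerm) (a : Name) : (π.name a).sort = a.sort := by cases a <;> rfl

/-- The transposition of two names of the same sort. -/
def swap : Name → Name → NPerm
  | .loc a, .loc b => ⟨Equiv.swap a b, 1, 1, finite_swap a b, by simp, by simp⟩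
  | .fn a, .fn b => ⟨1, Equiv.swap a b, 1, by simp, finite_swap a b, by simp⟩
  | .cont a, .cont b => ⟨1, 1, Equiv.swap a b, by simp, by simp, finite_swap a b⟩
  | _, _ => 1

theorem swap_left {a b : Name} (h : a.sort = b.sort) : (swap a b).name a = b := by
  cases a <;> cases b <;> simp_all [swap, Name.sort]

theorem swap_of_ne {a b c : Name} (ha : c ≠ a) (hb : c ≠ b) : (swap a b).name c = c := by
  cases a <;> cases b <;> cases c <;>
    first
    | exact congrArg _ (Equiv.swap_apply_of_ne_of_ne (by simp_all) (by simp_all))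
    | rfl

/-- Finite partial injections on names that respect sorts extend to permutations. -/
theorem exists_extending (S : Finset Name) (g : Name → Name) (hg : Set.InjOn g S)
    (hs : ∀ a ∈ S, (g a).sort = a.sort) : ∃ π : NPerm, ∀ a ∈ S, π.name a = g a := by
  induction S using Finset.induction_on with
  | empty => exact ⟨1, by simp⟩
  | insert a S ha ih =>
    obtain ⟨e, hS⟩ := ih (hg.mono (by simp)) fun b hb => hs b (by simp [hb])
    -- The transposition corrects the value at `a`. It does not disturb the values on `S`, which
    -- differ from `e.name a` because `e` is injective, and from `g a` because `g` is.
    refine ⟨swap (e.name a) (g a) * e, ?_⟩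
    intro n hn
    rw [Finset.mem_insert] at hn
    rcases hn with rfl | hn
    · rw [name_mul, swap_left]
      rw [sort_name, hs n (by simp)]
    · have hna : n ≠ a := fun h => ha (h ▸ hn)
      rw [name_mul, hS n hn]
      apply swap_of_ne
      · rw [← hS n hn]
        exact fun h => hna (e.name_injective h)
      · exact fun h => hna (hg (by simp [hn]) (by simp) h)

/-- Finitely many names can be made fresh. -/
theorem exists_fresh (A B F : Finset Name) (hAB : Disjoint A B) :
    ∃ π : NPerm, π.Fixes B ∧ ∀ a ∈ A, π.name a ∉ F := by
  classical
  -- `m` exceeds all indices in `B ∪ F`, so a shift of indices by `m` leads out of this set.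
  let m := (B ∪ F).sup Name.idx + 1
  have hm : ∀ a ∈ B ∪ F, a.idx < m := fun a ha =>
    Nat.lt_succ_of_le (Finset.le_sup (f := Name.idx) ha)
  let sh : Name → Name := fun a => match a with
    | .loc n => .loc (n + m)
    | .fn n => .fn (n + m)
    | .cont n => .cont (n + m)
  have sh_inj : Function.Injective sh := by
    intro a b h
    cases a <;> cases b <;> simp_all [sh]
  have sh_fresh : ∀ a, sh a ∉ B ∪ F := by
    intro a ha
    have := hm _ ha
    cases a <;> simp [sh, Name.idx] at this
  let g : Name → Name := fun a => if a ∈ B then a else sh a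
  obtain ⟨π, hπ⟩ := exists_extending (A ∪ B) g (by
    intro a _ b _ h
    simp only [g] at h
    have ha := sh_fresh a
    have hb := sh_fresh b
    split at h <;> split at h
    · exact h
    · subst h; simp_all
    · subst h; simp_all
    · exact sh_inj h) (by
    intro a _
    simp only [g]
    split
    · rfl
    · cases a <;> rfl)
  refine ⟨π, fun a ha => ?_, fun a ha => ?_⟩
  · rw [hπ a (by simp [ha])]
    simp [g, ha]
  · have hb : a ∉ B := Finset.disjoint_left.1 hAB ha
    rw [hπ a (by simp [ha])]
    simp only [g, if_neg hb]
    exact fun h => sh_fresh a (by simp [h])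

end NPerm

/-! ### Determinacy of internal transitions -/

namespace State

variable {X Y Z W : State} {α : Label} {s : LocStore}

/-- Internal transitions are deterministic up to the choice of the allocated location. -/
theorem Step.exists_rename_eq (hX : X.Good) (h : X.Step Y) (h' : X.Step Z) :
    ∃ π : NPerm, π.Fixes X.used ∧ Z = Y.rename π := by
  have triv : ∀ {A B : State}, A = B → ∃ π : NPerm, π.Fixes X.used ∧ B = A.rename π :=
    fun h => ⟨1, NPerm.Fixes.one _, by rw [State.rename_one, h]⟩
  -- Two choices of a fresh location are exchanged by a transposition, which fixes the used names of
  -- `X` and hence `X` itself.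
  have swp : ∀ a b : Loc, Name.loc a ∉ X.used → Name.loc b ∉ X.used →
      ∃ π : NPerm, π.Fixes X.used ∧ π.loc a = b := by
    intro a b ha hb
    refine ⟨NPerm.swap (.loc a) (.loc b), fun c hc => NPerm.swap_of_ne ?_ ?_, ?_⟩
    · rintro rfl; exact ha hc
    · rintro rfl; exact hb hc
    · simpa using NPerm.swap_left (a := .loc a) (b := .loc b) rfl
  rcases X with ⟨D, c⟩
  rcases Y with ⟨D', c'⟩
  rcases Z with ⟨D'', c''⟩
  obtain ⟨rfl, h⟩ := h
  obtain ⟨rfl, h'⟩ := h'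
  dsimp only at h h'
  cases h with
  | iteTrue hn =>
    cases h' with
    | iteTrue => exact triv rfl
    | iteFalse => exact absurd rfl hn
  | iteFalse =>
    cases h' with
    | iteTrue hn => exact absurd rfl hn
    | iteFalse => exact triv rfl
  | opL => cases h'; exact triv rfl
  | opRBin hb =>
    cases h' with
    | opRBin hb' =>
      rw [hb] at hb'
      cases hb'
      exact triv rfl
  | opRSeq => cases h'; exact triv rfl
  | opRAssign hv =>
    cases h' with
    | opRAssign hv' =>
      rw [hv] at hv'
      cases Data.toValue_injective hv'
      exact triv rfl
  | deref hd =>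
    cases h' with
    | deref hd' =>
      rw [hd] at hd'
      cases hd'
      exact triv rfl
  | ret => cases h'; exact triv rfl
  | @localIn N P s t x e k a ha =>
    cases h' with
    | @localIn _ _ _ _ _ _ _ b hb =>
      obtain ⟨π, hπ, hab⟩ := swp a b ha hb
      refine ⟨π, hπ, ?_⟩
      have he := hX.rename_eq_self hπ
      simp only [State.rename, State.mk.injEq, NPerm.config, Config.prog.injEq, NPerm.exp,
        Exp.localIn.injEq, true_and] at he
      obtain ⟨h₁, h₂, h₃, h₄, h₅, h₆, h₇⟩ := he
      have h₄' := congrArg Store.loc h₄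
      have h₄'' := congrArg Store.cont h₄
      rw [NPerm.store_loc] at h₄'
      rw [NPerm.store_cont] at h₄''
      simp only [State.rename, NPerm.config, h₁, h₃, h₅, h₇, NPerm.names_insert, h₂,
        NPerm.name_loc, hab, NPerm.exp_subst, h₆]
      congr 2
      · exact Store.ext (by rw [NPerm.store_loc, NPerm.lstore_set, h₄', hab]; rfl) h₄''.symm
      · congr 1
        funext y
        split <;> simp [hab]
  | appL => cases h'; exact triv rfl
  | pairL => cases h'; exact triv rfl
  | pairR => cases h'; exact triv rfl
  | call hf =>
    cases h' with
    | call hf' =>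
      rw [hf] at hf'
      cases hf'
      exact triv rfl
  | pushIte => cases h'; exact triv rfl
  | pushOp => cases h'; exact triv rfl
  | pushUop => cases h'; exact triv rfl
  | @new N P s t k a ha =>
    cases h' with
    | @new _ _ _ _ _ b hb =>
      obtain ⟨π, hπ, hab⟩ := swp a b ha hb
      refine ⟨π, hπ, ?_⟩
      have he := hX.rename_eq_self hπ
      simp only [State.rename, State.mk.injEq, NPerm.config, Config.prog.injEq, NPerm.exp,
        true_and] at he
      obtain ⟨h₁, h₂, h₃, h₄, h₅, h₆⟩ := he
      have h₄' := congrArg Store.loc h₄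
      have h₄'' := congrArg Store.cont h₄
      rw [NPerm.store_loc] at h₄'
      rw [NPerm.store_cont] at h₄''
      simp only [State.rename, NPerm.config, h₁, h₃, h₅, h₆, NPerm.names_insert, h₂,
        NPerm.name_loc, hab, NPerm.exp, NPerm.value_name]
      congr 2
      exact Store.ext (by rw [NPerm.store_loc, NPerm.lstore_set, h₄', hab]; rfl) h₄''.symm
  | pushApp => cases h'; exact triv rfl
  | pushPair => cases h'; exact triv rfl

/-- The call rules exclude each other, since one needs an undefined and the other a defined
function; a value on the empty stack and a system configuration have no internal transitions. So a
labelled transition is possible only where internal computation has come to an end. -/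
theorem Trans.not_step (h : X.Trans α s Y) : ¬ X.Step Z := by
  rintro ⟨-, h'⟩
  obtain ⟨-, h⟩ := h
  rcases X with ⟨D, c⟩
  rcases Y with ⟨D₂, c₂⟩
  rcases Z with ⟨D₃, c₃⟩
  dsimp only at h h'
  cases h with
  | progCall hf => cases h' with | call hf' => simp [hf] at hf'
  | progRet => cases h'
  | sysRet => cases h'
  | sysCall => cases h'

/-- All internal computations lead to the state in which a labelled transition is possible. -/
theorem Steps.confluent (hX : X.Good) (h : X.Steps Y) (h' : X.Steps Z) (hZ : Z.Trans α s W) :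
    ∃ π : NPerm, π.Fixes X.used ∧ Y.Steps (Z.rename π) := by
  induction h using Relation.ReflTransGen.head_induction_on generalizing Z α s W with
  | refl => exact ⟨1, NPerm.Fixes.one _, by rwa [State.rename_one]⟩
  | @head X X₁ h₁ _ ih =>
    cases h' using Relation.ReflTransGen.head_induction_on with
    | refl => exact absurd h₁ hZ.not_step
    | head h₂ h₃ =>
      -- The first steps of the two computations agree up to `τ`. After renaming the rest of the
      -- second one by `τ`, both continue from `X₁`.
      obtain ⟨τ, hτ, rfl⟩ := h₂.exists_rename_eq hX h₁
      obtain ⟨π, hπ, h⟩ := ih (h₁.good hX) (Steps.rename τ h₃) (hZ.rename τ)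
      refine ⟨π * τ, (hπ.mono h₁.used_subset).mul hτ, ?_⟩
      rwa [rename_mul]

end State

/-! ### Bisimilarity of states -/

/-- Bisimilarity of states. -/
def Bisim (X Y : State) : Prop := ∃ R, IsBisimulation R ∧ R X Y

namespace Bisim

open State

variable {X Y Z X' Y' : State} {α : Label} {s : LocStore}

theorem symm (h : Bisim X Y) : Bisim Y X := by
  obtain ⟨R, ⟨h₁, h₂⟩, h⟩ := h
  exact ⟨fun X Y => R Y X, ⟨h₂, h₁⟩, h⟩

theorem pub_eq (h : Bisim X Y) : X.pub = Y.pub := by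
  obtain ⟨R, ⟨h₁, h₂⟩, h⟩ := h
  exact h₁.pub_eq _ _ h

theorem step (h : Bisim X Y) (hX : X.Step X') : Bisim X' Y := by
  obtain ⟨R, hR, h⟩ := h
  exact ⟨R, hR, hR.1.step _ _ _ h hX⟩

theorem steps (h : Bisim X Y) (hX : X.Steps X') : Bisim X' Y := by
  induction hX with
  | refl => exact h
  | tail _ h' ih => exact ih.step h'

theorem trans_label (h : Bisim X Y) (hX : X.Trans α s X') :
    ∃ π : NPerm, π.Fixes X.pub ∧ ∃ Y', (Y.rename π).WeakTrans α s Y' ∧ Bisim X' Y' := by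
  obtain ⟨R, hR, h⟩ := h
  obtain ⟨π, hπ, Y', h₁, h₂⟩ := hR.1.trans _ _ _ _ _ h hX
  exact ⟨π, fun a ha => hπ a (by simp [ha]), Y', h₁, R, hR, h₂⟩

/-- A symmetric simulation is contained in bisimilarity. -/
theorem of_symm_simulation {R : State → State → Prop} (hs : ∀ X Y, R X Y → R Y X)
    (hp : ∀ X Y, R X Y → X.pub = Y.pub) (h₁ : ∀ X Y X', R X Y → X.Step X' → R X' Y)
    (h₂ : ∀ X Y α s X', R X Y → X.Trans α s X' →
      ∃ π : NPerm, π.Fixes X.pub ∧ ∃ Y', (Y.rename π).WeakTrans α s Y' ∧ R X' Y')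
    (h : R X Y) : Bisim X Y := by
  have hR : IsSimulation R := by
    refine ⟨hp, h₁, fun X Y α s X' h hX => ?_⟩
    obtain ⟨π, hπ, h'⟩ := h₂ X Y α s X' h hX
    refine ⟨π, fun a ha => ?_, h'⟩
    rw [← hp X Y h, Finset.union_self] at ha
    exact hπ a ha
  have e : (fun X₁ X₂ => R X₂ X₁) = R := by
    funext X Y
    exact propext ⟨hs _ _, hs _ _⟩
  exact ⟨R, ⟨hR, by rw [e]; exact hR⟩, h⟩

/-- The permutation used for matching is conjugated by `π`. -/
theorem rename (π : NPerm) (h : Bisim X Y) : Bisim (X.rename π) (Y.rename π) := by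
  refine of_symm_simulation (R := fun X Y => Bisim (X.rename π⁻¹) (Y.rename π⁻¹))
    (fun X Y => symm) (fun X Y h => ?_) (fun X Y X' h hX => h.step (hX.rename _))
    (fun X Y α s X' h hX => ?_) (by simpa using h)
  · have := h.pub_eq
    rw [pub_rename, pub_rename] at this
    have := congrArg π.names this
    rwa [← NPerm.names_mul, ← NPerm.names_mul, mul_inv_cancel, NPerm.names_one,
      NPerm.names_one] at this
  · obtain ⟨ρ, hρ, Y', h₁, h₂⟩ := h.trans_label (hX.rename π⁻¹)
    refine ⟨π * ρ * π⁻¹, fun a ha => ?_, Y'.rename π, ?_, by simpa using h₂⟩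
    · rw [NPerm.name_mul, NPerm.name_mul, hρ, NPerm.name_name_inv]
      rwa [pub_rename, NPerm.name_mem_names]
    · rw [rename_mul, rename_mul]
      exact h₁.of_inv π

/-- The answer of the middle state may begin with internal transitions of a renamed `Y`. Renamed
back, these are internal transitions of `Y`, which preserve bisimilarity with `Z`; then `Z` matches
the labelled transition that follows. -/
protected theorem trans (h : Bisim X Y) (h' : Bisim Y Z) : Bisim X Z := by
  refine of_symm_simulation (R := fun X Z => ∃ Y, Bisim X Y ∧ Bisim Y Z)
    ?_ ?_ ?_ ?_ ⟨Y, h, h'⟩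
  · rintro X Z ⟨Y, h, h'⟩
    exact ⟨Y, h'.symm, h.symm⟩
  · rintro X Z ⟨Y, h, h'⟩
    rw [h.pub_eq, h'.pub_eq]
  · rintro X Z X' ⟨Y, h, h'⟩ hX
    exact ⟨Y, h.step hX, h'⟩
  · rintro X Z α s X' ⟨Y, h, h'⟩ hX
    obtain ⟨π, hπ, Y', ⟨Y₁, h₁, h₂⟩, h₃⟩ := h.trans_label hX
    have h₄ : Bisim (Y₁.rename π⁻¹) Z := by
      refine h'.steps ?_
      simpa using Steps.rename π⁻¹ h₁
    obtain ⟨ρ, hρ, Z', h₅, h₆⟩ := h₄.trans_label (h₂.rename π⁻¹)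
    refine ⟨π * ρ, hπ.mul ?_, Z'.rename π, ?_, Y', h₃, by simpa using h₆.rename π⟩
    · rwa [h₄.pub_eq, ← h'.pub_eq, ← h.pub_eq] at hρ
    · rw [rename_mul]
      exact h₅.of_inv π

/-- Renaming of private names does not affect bisimilarity. -/
theorem rename_right (h : Bisim X Y) {π : NPerm} (hπ : π.Fixes X.pub) :
    Bisim X (Y.rename π) := by
  refine of_symm_simulation
    (R := fun X Y => ∃ π : NPerm, π.Fixes X.pub ∧ Bisim X (Y.rename π)) ?_ ?_ ?_ ?_
    ⟨π⁻¹, hπ.inv, by simpa using h⟩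
  · rintro X Y ⟨π, hπ, h⟩
    have := (h.rename π⁻¹).symm
    rw [rename_inv_rename] at this
    refine ⟨π⁻¹, ?_, this⟩
    rw [this.pub_eq, pub_rename, hπ.inv.names_eq]
    exact hπ.inv
  · rintro X Y ⟨π, hπ, h⟩
    have := h.pub_eq
    rw [pub_rename] at this
    rw [← hπ.inv.names_eq, this, ← NPerm.names_mul, inv_mul_cancel, NPerm.names_one]
  · rintro X Y X' ⟨π, hπ, h⟩ hX
    exact ⟨π, by rwa [hX.pub_eq], h.step hX⟩
  · rintro X Y α s X' ⟨π, hπ, h⟩ hX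
    obtain ⟨ρ, hρ, Y', h₁, h₂⟩ := h.trans_label hX
    -- The matching permutation absorbs `π`. It could not be kept in the relation, as it need not
    -- fix the names that `α` makes public.
    refine ⟨ρ * π, hρ.mul hπ, Y', by rwa [rename_mul], 1, NPerm.Fixes.one _, ?_⟩
    rwa [rename_one]

/-! ### Weak simulations -/

/-- One state reaches the other, up to renaming of private names. -/
def Conn (X Y : State) : Prop :=
  ∃ π : NPerm, π.Fixes X.pub ∧ ((X.rename π).Steps Y ∨ Y.Steps (X.rename π))

theorem Conn.refl (X : State) : Conn X X :=
  ⟨1, NPerm.Fixes.one _, by rw [rename_one]; exact Or.inl .refl⟩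

theorem Conn.pub_eq (h : Conn X Y) : X.pub = Y.pub := by
  obtain ⟨π, hπ, h⟩ := h
  have e : (X.rename π).pub = X.pub := by rw [pub_rename, hπ.names_eq]
  rcases h with h | h
  · rw [h.pub_eq, e]
  · rw [← h.pub_eq, e]

/-- A state ahead of `X` moves further ahead. A state behind `X` makes, by determinacy and up to
renaming, the next step of its way to `X`. -/
theorem Conn.step (h : Conn X Y) (hY : Y.Good) (h' : Y.Step Y') : Conn X Y' := by
  have hp := h.pub_eq
  obtain ⟨π, hπ, h⟩ := h
  rcases h with h | h
  · exact ⟨π, hπ, Or.inl (h.tail h')⟩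
  · cases h using Relation.ReflTransGen.head_induction_on with
    | refl => exact ⟨π, hπ, Or.inl (.single h')⟩
    | head h₁ h₂ =>
      obtain ⟨τ, hτ, rfl⟩ := h₁.exists_rename_eq hY h'
      refine ⟨τ * π, (hτ.mono ?_).mul hπ, Or.inr ?_⟩
      · rw [hp]; exact hY.pub_used
      · rw [rename_mul]
        exact Steps.rename τ h₂

/-- A state with a labelled transition has no internal ones and cannot be strictly behind `X`. -/
theorem Conn.steps_of_trans (h : Conn X Y) (h' : Y.Trans α s Y') :
    ∃ π : NPerm, π.Fixes X.pub ∧ (X.rename π).Steps Y := by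
  obtain ⟨π, hπ, h | h⟩ := h
  · exact ⟨π, hπ, h⟩
  · cases h using Relation.ReflTransGen.head_induction_on with
    | refl => exact ⟨π, hπ, .refl⟩
    | head h₁ => exact absurd h₁ h'.not_step

/-- If `Y` is ahead of `X`, then by confluence it can still reach, up to renaming, the state that
performs the transition. If it is behind, it catches up with `X` first. -/
theorem Conn.weakTrans (h : Conn X Y) (hX : X.Good) {π : NPerm} (hπ : π.Fixes X.pub)
    (h' : (X.rename π).WeakTrans α s X') :
    ∃ ρ : NPerm, ρ.Fixes X.pub ∧ (Y.rename ρ).WeakTrans α s X' := by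
  obtain ⟨W, h₁, h₂⟩ := h'
  obtain ⟨τ, hτ, h | h⟩ := h
  · have hY : X.Steps (Y.rename τ⁻¹) := by simpa using Steps.rename τ⁻¹ h
    have hW : X.Steps (W.rename π⁻¹) := by simpa using Steps.rename π⁻¹ h₁
    obtain ⟨σ, hσ, h₃⟩ := Steps.confluent hX hY hW (h₂.rename π⁻¹)
    refine ⟨π * σ⁻¹ * τ⁻¹, (hπ.mul (hσ.mono hX.pub_used).inv).mul hτ.inv, W, ?_, h₂⟩
    rw [rename_mul, rename_mul]
    simpa using Steps.rename π (Steps.rename σ⁻¹ h₃)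
  · refine ⟨π * τ⁻¹, hπ.mul hτ.inv, W, ?_, h₂⟩
    rw [rename_mul]
    refine Relation.ReflTransGen.trans ?_ h₁
    have := Steps.rename π (Steps.rename τ⁻¹ h)
    rwa [rename_inv_rename] at this

/-- A symmetric equivariant relation that is a simulation in the weak sense is contained in
bisimilarity. -/
theorem of_weak_simulation {R : State → State → Prop} (hs : ∀ X Y, R X Y → R Y X)
    (hr : ∀ X Y (π : NPerm), R X Y → R (X.rename π) (Y.rename π))
    (hg : ∀ X Y, R X Y → X.Good)
    (hp : ∀ X Y, R X Y → X.pub = Y.pub)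
    (h₁ : ∀ X Y X', R X Y → X.Step X' →
      ∃ π : NPerm, π.Fixes X.pub ∧ ∃ Y', (Y.rename π).Steps Y' ∧ R X' Y')
    (h₂ : ∀ X Y α s X', R X Y → X.Trans α s X' →
      ∃ π : NPerm, π.Fixes X.pub ∧ ∃ Y', (Y.rename π).WeakTrans α s Y' ∧ R X' Y')
    (h : R X Y) : Bisim X Y := by
  have hsteps : ∀ X Y X', R X Y → X.Steps X' →
      ∃ π : NPerm, π.Fixes X.pub ∧ ∃ Y', (Y.rename π).Steps Y' ∧ R X' Y' := by
    intro X Y X' h hX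
    induction hX with
    | refl => exact ⟨1, NPerm.Fixes.one _, Y, by rw [rename_one], h⟩
    | @tail X₁ X₂ hX h' ih =>
      obtain ⟨π, hπ, Y₁, hY₁, hR⟩ := ih
      obtain ⟨ρ, hρ, Y₂, hY₂, hR₂⟩ := h₁ _ _ _ hR h'
      refine ⟨ρ * π, ?_, Y₂, ?_, hR₂⟩
      · rw [Steps.pub_eq hX] at hρ
        exact hρ.mul hπ
      · rw [rename_mul]
        exact (Steps.rename ρ hY₁).trans hY₂
  -- `R` is closed under internal computation, in both directions and on both sides. An internal
  -- transition then stays within the relation without an answer, as simulations require.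
  refine of_symm_simulation
    (R := fun X Y => X.Good ∧ Y.Good ∧ ∃ X₀ Y₀, R X₀ Y₀ ∧ Conn X₀ X ∧ Conn Y₀ Y)
    ?_ ?_ ?_ ?_ ⟨hg _ _ h, hg _ _ (hs _ _ h), X, Y, h, Conn.refl _, Conn.refl _⟩
  · rintro X Y ⟨gX, gY, X₀, Y₀, h, cX, cY⟩
    exact ⟨gY, gX, Y₀, X₀, hs _ _ h, cY, cX⟩
  · rintro X Y ⟨gX, gY, X₀, Y₀, h, cX, cY⟩
    rw [← cX.pub_eq, ← cY.pub_eq, hp _ _ h]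
  · rintro X Y X' ⟨gX, gY, X₀, Y₀, h, cX, cY⟩ hX
    exact ⟨hX.good gX, gY, X₀, Y₀, h, cX.step gX hX, cY⟩
  · rintro X Y α s X' ⟨gX, gY, X₀, Y₀, h, cX, cY⟩ hX
    have gY₀ := hg _ _ (hs _ _ h)
    -- As `X` performs a labelled transition, it is ahead of `X₀`. The state `Y₀` answers the
    -- computation from `X₀` to `X` and then the transition, and `Y` can do what `Y₀` does.
    obtain ⟨π, hπ, sX⟩ := cX.steps_of_trans hX
    obtain ⟨ρ, hρ, Y₁, sY, hR⟩ := hsteps _ _ _ (hr _ _ π h) sX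
    obtain ⟨σ, hσ, Y', ⟨W, hW, tW⟩, hR'⟩ := h₂ _ _ _ _ _ hR hX
    rw [pub_rename, hπ.names_eq] at hρ
    rw [← cX.pub_eq] at hσ
    have hw : (Y₀.rename (σ * ρ * π)).WeakTrans α s Y' := by
      refine ⟨W, ?_, tW⟩
      rw [rename_mul, rename_mul]
      exact (Steps.rename σ sY).trans hW
    obtain ⟨τ, hτ, hY⟩ := cY.weakTrans gY₀ (π := σ * ρ * π)
      (by rw [← hp _ _ h]; exact (hσ.mul hρ).mul hπ) hw
    refine ⟨τ, ?_, Y', hY, hX.good gX, hg _ _ (hs _ _ hR'), X', Y', hR', Conn.refl _, Conn.refl _⟩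
    rwa [← cX.pub_eq, hp _ _ h]

/-- Equality is not a simulation, because an internal transition of one side alone destroys it. It
is one in the weak sense. -/
protected theorem refl (h : X.Good) : Bisim X X := by
  refine of_weak_simulation (R := fun X Y => X = Y ∧ X.Good) ?_ ?_ ?_ ?_ ?_ ?_ ⟨rfl, h⟩
  · rintro X _ ⟨rfl, h⟩
    exact ⟨rfl, h⟩
  · rintro X _ π ⟨rfl, h⟩
    exact ⟨rfl, h.rename π⟩
  · rintro X _ ⟨rfl, h⟩
    exact h
  · rintro X _ ⟨rfl, h⟩
    rfl
  · rintro X _ X' ⟨rfl, h⟩ hX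
    exact ⟨1, NPerm.Fixes.one _, X', by rw [rename_one]; exact .single hX, rfl, hX.good h⟩
  · rintro X _ α s X' ⟨rfl, h⟩ hX
    exact ⟨1, NPerm.Fixes.one _, X', by rw [rename_one]; exact ⟨X, .refl, hX⟩, rfl, hX.good h⟩

end Bisim

end SLS

namespace SLS

open State

/-! ### Decomposition of composite states -/

/-- Continuation stores. -/
abbrev ContStore := FinPFun Cont (Stack × Cont)

/-- `Unwind I n σ σ' k u l`: in a component with continuation store `σ` that runs towards the
continuation `k`, next to a component with continuation store `σ'`, the composite frame stack
continues with `u` and then returns to the external continuation `l`. The internal continuations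
are those in `I`, and `n` of them are met on the way. -/
inductive Unwind (I : Finset Name) : ℕ → ContStore → ContStore → Cont → Stack → Cont → Prop
  | ext {σ σ' : ContStore} {k : Cont} : Name.cont k ∉ I → Unwind I 0 σ σ' k [] k
  | int {n : ℕ} {σ σ' : ContStore} {k l m : Cont} {t u : Stack} : Name.cont k ∈ I →
      σ' k = some (t, l) → Unwind I n σ' σ l u m → Unwind I (n + 1) σ σ' k (t ++ u) m

theorem Unwind.rename (π : NPerm) {I : Finset Name} {n : ℕ} {σ σ' : ContStore} {k l : Cont}
    {u : Stack} (h : Unwind I n σ σ' k u l) :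
    Unwind (π.names I) n (π.cstore σ) (π.cstore σ') (π.cont k) (π.stack u) (π.cont l) := by
  induction h with
  | ext h => exact .ext (by simpa using h)
  | int h h' _ ih =>
    rw [NPerm.stack_append]
    exact .int (by simpa using h) (by simp [h']) ih

/-- Unwinding does not depend on unrelated internal names and continuations. -/
theorem Unwind.extend {I I' U : Finset Name} {n : ℕ} {σ σ' τ τ' : ContStore} {k l : Cont}
    {u : Stack} (h : Unwind I n σ σ' k u l) (hk : Name.cont k ∈ U)
    (hI : ∀ a ∈ U, a ∈ I' ↔ a ∈ I)
    (hσ : ∀ k t l, σ k = some (t, l) → Name.cont l ∈ U)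
    (hσ' : ∀ k t l, σ' k = some (t, l) → Name.cont l ∈ U)
    (hτ : ∀ k, Name.cont k ∈ U → τ k = σ k) (hτ' : ∀ k, Name.cont k ∈ U → τ' k = σ' k) :
    Unwind I' n τ τ' k u l := by
  induction h generalizing τ τ' with
  | ext h => exact .ext (by rwa [hI _ hk])
  | int h h' _ ih =>
    refine .int (by rwa [hI _ hk]) (by rw [hτ' _ hk, h']) (ih (hσ' _ _ _ h') hσ' hσ hτ' hτ)

/-- The composite continuation store at the continuation `k`. -/
inductive ContSplit (I : Finset Name) (σC σ σ' : ContStore) (k : Cont) : Prop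
  | none : σC k = none → σ k = none → σ' k = none → ContSplit I σC σ σ' k
  | left {n : ℕ} {t u : Stack} {l m : Cont} : σ k = some (t, l) → σ' k = Option.none →
      Unwind I n σ σ' l u m → σC k = some (t ++ u, m) → ContSplit I σC σ σ' k
  | right {n : ℕ} {t u : Stack} {l m : Cont} : σ' k = some (t, l) → σ k = Option.none →
      Unwind I n σ' σ l u m → σC k = some (t ++ u, m) → ContSplit I σC σ σ' k

theorem ContSplit.symm {I : Finset Name} {σC σ σ' : ContStore} {k : Cont}
    (h : ContSplit I σC σ σ' k) : ContSplit I σC σ' σ k := by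
  cases h with
  | none h₁ h₂ h₃ => exact .none h₁ h₃ h₂
  | left h₁ h₂ h₃ h₄ => exact .right h₁ h₂ h₃ h₄
  | right h₁ h₂ h₃ h₄ => exact .left h₁ h₂ h₃ h₄

theorem ContSplit.rename (π : NPerm) {I : Finset Name} {σC σ σ' : ContStore} {k : Cont}
    (h : ContSplit I σC σ σ' k) :
    ContSplit (π.names I) (π.cstore σC) (π.cstore σ) (π.cstore σ') (π.cont k) := by
  cases h with
  | none h₁ h₂ h₃ => exact .none (by simp [h₁]) (by simp [h₂]) (by simp [h₃])
  | left h₁ h₂ h₃ h₄ =>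
    exact .left (by rw [NPerm.cstore_apply, h₁]; rfl) (by rw [NPerm.cstore_apply, h₂]; rfl)
      (h₃.rename π) (by rw [NPerm.cstore_apply, h₄, ← NPerm.stack_append]; rfl)
  | right h₁ h₂ h₃ h₄ =>
    exact .right (by rw [NPerm.cstore_apply, h₁]; rfl) (by rw [NPerm.cstore_apply, h₂]; rfl)
      (h₃.rename π) (by rw [NPerm.cstore_apply, h₄, ← NPerm.stack_append]; rfl)

theorem ContSplit.extend {I I' U : Finset Name} {σC σ σ' τC τ τ' : ContStore} {k : Cont}
    (h : ContSplit I σC σ σ' k) (hI : ∀ a ∈ U, a ∈ I' ↔ a ∈ I)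
    (hσ : ∀ k t l, σ k = some (t, l) → Name.cont l ∈ U)
    (hσ' : ∀ k t l, σ' k = some (t, l) → Name.cont l ∈ U)
    (hτ : ∀ k, Name.cont k ∈ U → τ k = σ k) (hτ' : ∀ k, Name.cont k ∈ U → τ' k = σ' k)
    (hkC : τC k = σC k) (hk : τ k = σ k) (hk' : τ' k = σ' k) : ContSplit I' τC τ τ' k := by
  cases h with
  | none h₁ h₂ h₃ => exact .none (hkC.trans h₁) (hk.trans h₂) (hk'.trans h₃)
  | left h₁ h₂ h₃ h₄ =>
    exact .left (hk.trans h₁) (hk'.trans h₂) (h₃.extend (hσ _ _ _ h₁) hI hσ hσ' hτ hτ')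
      (hkC.trans h₄)
  | right h₁ h₂ h₃ h₄ =>
    exact .right (hk'.trans h₁) (hk.trans h₂) (h₃.extend (hσ' _ _ _ h₁) hI hσ' hσ hτ' hτ)
      (hkC.trans h₄)

/-- The state `C` of a composite module splits into states `X` and `X'` of the components, which
share the internal names `I` that do not occur in `C`. Apart from these they only share public
names. -/
structure IsSplit (I : Finset Name) (C X X' : State) : Prop where
  good : C.Good
  good_left : X.Good
  good_right : X'.Good
  code_eq : ∀ f, C.code f = (X.code f).or (X'.code f)
  code_disj : ∀ f, X.code f = none ∨ X'.code f = none
  mem_used : ∀ a, a ∈ C.used ↔ (a ∈ X.used ∨ a ∈ X'.used) ∧ a ∉ I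
  int_used : ∀ a ∈ I, a ∈ X.used ∨ a ∈ X'.used
  int_pub : ∀ a ∈ I, (a ∈ X.used → a ∈ X.pub) ∧ (a ∈ X'.used → a ∈ X'.pub)
  common : ∀ a, a ∈ X.used → a ∈ X'.used → a ∈ X.pub ∧ a ∈ X'.pub
  pub : ∀ a ∈ C.pub, (a ∈ X.used → a ∈ X.pub) ∧ (a ∈ X'.used → a ∈ X'.pub)
  cont : ∀ k, Name.cont k ∉ I → ContSplit I C.cont X.cont X'.cont k

/-- A split of a program configuration in which the component `X` is running. The store of the
suspended component `X'` is only up to date on its private locations. -/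
structure IsActive (n : ℕ) (I : Finset Name) (C X X' : State) : Prop extends
    IsSplit I C X X' where
  ctrl_right : X'.ctrl = none
  ctrl : ∃ t e k u l, X.ctrl = some (t, e, k) ∧ C.ctrl = some (t ++ u, e, l) ∧
    Unwind I n X.cont X'.cont k u l
  loc_right : ∀ x, Name.loc x ∈ X'.used → Name.loc x ∉ X'.pub → C.loc x = X'.loc x
  loc_left : ∀ x, Name.loc x ∉ I → (Name.loc x ∈ X'.used → Name.loc x ∈ X'.pub) →
    C.loc x = X.loc x
  loc_sub : ∀ x, Name.loc x ∈ X'.pub → X'.loc x ≠ none →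
    X.loc x ≠ none ∧ Name.loc x ∈ X.pub

/-- A split of a system configuration. The store `q` holds the current values of all locations
that are public for one of the components. -/
structure IsPassive (I : Finset Name) (q : LocStore) (C X X' : State) : Prop extends
    IsSplit I C X X' where
  ctrl_left : X.ctrl = none
  ctrl_right : X'.ctrl = none
  ctrl : C.ctrl = none
  loc_left : ∀ x, Name.loc x ∈ X.used → Name.loc x ∉ X.pub → C.loc x = X.loc x
  loc_right : ∀ x, Name.loc x ∈ X'.used → Name.loc x ∉ X'.pub → C.loc x = X'.loc x
  loc_pub : ∀ x, Name.loc x ∉ I → (Name.loc x ∈ X.used → Name.loc x ∈ X.pub) →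
    (Name.loc x ∈ X'.used → Name.loc x ∈ X'.pub) → C.loc x = q x
  dom_left : ∀ x, Name.loc x ∈ X.pub → X.loc x ≠ none → q x ≠ none
  dom_right : ∀ x, Name.loc x ∈ X'.pub → X'.loc x ≠ none → q x ≠ none
  q_used : ∀ a ∈ LocStore.names q, a ∈ X.used ∨ a ∈ X'.used
  q_pub : ∀ a ∈ LocStore.names q, (a ∈ X.used → a ∈ X.pub) ∧ (a ∈ X'.used → a ∈ X'.pub)

/-! ### Symmetry and renaming of splits -/

section

variable {I : Finset Name} {q : LocStore} {C X X' : State} {n : ℕ}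

theorem IsSplit.symm (h : IsSplit I C X X') : IsSplit I C X' X where
  good := h.good
  good_left := h.good_right
  good_right := h.good_left
  code_eq f := by
    rw [h.code_eq]
    rcases h.code_disj f with h | h <;> simp [h]
  code_disj f := (h.code_disj f).symm
  mem_used a := by rw [h.mem_used, or_comm (a := a ∈ X.used)]
  int_used a ha := (h.int_used a ha).symm
  int_pub a ha := (h.int_pub a ha).symm
  common a h₁ h₂ := (h.common a h₂ h₁).symm
  pub a ha := (h.pub a ha).symm
  cont k hk := (h.cont k hk).symm

theorem IsPassive.symm (h : IsPassive I q C X X') : IsPassive I q C X' X where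
  toIsSplit := h.toIsSplit.symm
  ctrl_left := h.ctrl_right
  ctrl_right := h.ctrl_left
  ctrl := h.ctrl
  loc_left := h.loc_right
  loc_right := h.loc_left
  loc_pub x h₁ h₂ h₃ := h.loc_pub x h₁ h₃ h₂
  dom_left := h.dom_right
  dom_right := h.dom_left
  q_used a ha := (h.q_used a ha).symm
  q_pub a ha := (h.q_pub a ha).symm

theorem IsSplit.rename (π : NPerm) (h : IsSplit I C X X') :
    IsSplit (π.names I) (C.rename π) (X.rename π) (X'.rename π) where
  good := h.good.rename π
  good_left := h.good_left.rename π
  good_right := h.good_right.rename π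
  code_eq f := by
    obtain ⟨f, rfl⟩ := π.fn.surjective f
    rw [code_rename, code_rename, code_rename, NPerm.code_apply, NPerm.code_apply,
      NPerm.code_apply, h.code_eq]
    cases X.code f <;> rfl
  code_disj f := by
    obtain ⟨f, rfl⟩ := π.fn.surjective f
    rw [code_rename, code_rename, NPerm.code_apply, NPerm.code_apply, Option.map_eq_none_iff,
      Option.map_eq_none_iff]
    exact h.code_disj f
  mem_used a := by
    obtain ⟨a, rfl⟩ := π.name_surjective a
    simp only [used_rename, NPerm.name_mem_names]
    exact h.mem_used a
  int_used a := by
    obtain ⟨a, rfl⟩ := π.name_surjective a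
    simp only [used_rename, NPerm.name_mem_names]
    exact h.int_used a
  int_pub a := by
    obtain ⟨a, rfl⟩ := π.name_surjective a
    simp only [used_rename, pub_rename, NPerm.name_mem_names]
    exact h.int_pub a
  common a := by
    obtain ⟨a, rfl⟩ := π.name_surjective a
    simp only [used_rename, pub_rename, NPerm.name_mem_names]
    exact h.common a
  pub a := by
    obtain ⟨a, rfl⟩ := π.name_surjective a
    simp only [used_rename, pub_rename, NPerm.name_mem_names]
    exact h.pub a
  cont k := by
    obtain ⟨k, rfl⟩ := π.cont.surjective k
    rw [NPerm.cont_mem_names, cont_rename, cont_rename, cont_rename]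
    exact fun hk => (h.cont k hk).rename π

theorem IsActive.rename (π : NPerm) (h : IsActive n I C X X') :
    IsActive n (π.names I) (C.rename π) (X.rename π) (X'.rename π) where
  toIsSplit := h.toIsSplit.rename π
  ctrl_right := by rw [ctrl_rename, h.ctrl_right]; rfl
  ctrl := by
    obtain ⟨t, e, k, u, l, h₁, h₂, h₃⟩ := h.ctrl
    refine ⟨π.stack t, π.exp e, π.cont k, π.stack u, π.cont l, ?_, ?_, ?_⟩
    · rw [ctrl_rename, h₁]; rfl
    · rw [ctrl_rename, h₂, ← NPerm.stack_append]; rfl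
    · rw [cont_rename, cont_rename]; exact h₃.rename π
  loc_right x := by
    obtain ⟨x, rfl⟩ := π.loc.surjective x
    simp only [used_rename, pub_rename, NPerm.loc_mem_names, loc_rename, NPerm.lstore_apply]
    exact fun h₁ h₂ => by rw [h.loc_right x h₁ h₂]
  loc_left x := by
    obtain ⟨x, rfl⟩ := π.loc.surjective x
    simp only [used_rename, pub_rename, NPerm.loc_mem_names, loc_rename, NPerm.lstore_apply]
    exact fun h₁ h₂ => by rw [h.loc_left x h₁ h₂]
  loc_sub x := by
    obtain ⟨x, rfl⟩ := π.loc.surjective x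
    simp only [pub_rename, NPerm.loc_mem_names, loc_rename, NPerm.lstore_apply, ne_eq,
      Option.map_eq_none_iff]
    exact h.loc_sub x

theorem IsPassive.rename (π : NPerm) (h : IsPassive I q C X X') :
    IsPassive (π.names I) (π.lstore q) (C.rename π) (X.rename π) (X'.rename π) where
  toIsSplit := h.toIsSplit.rename π
  ctrl_left := by rw [ctrl_rename, h.ctrl_left]; rfl
  ctrl_right := by rw [ctrl_rename, h.ctrl_right]; rfl
  ctrl := by rw [ctrl_rename, h.ctrl]; rfl
  loc_left x := by
    obtain ⟨x, rfl⟩ := π.loc.surjective x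
    simp only [used_rename, pub_rename, NPerm.loc_mem_names, loc_rename, NPerm.lstore_apply]
    exact fun h₁ h₂ => by rw [h.loc_left x h₁ h₂]
  loc_right x := by
    obtain ⟨x, rfl⟩ := π.loc.surjective x
    simp only [used_rename, pub_rename, NPerm.loc_mem_names, loc_rename, NPerm.lstore_apply]
    exact fun h₁ h₂ => by rw [h.loc_right x h₁ h₂]
  loc_pub x := by
    obtain ⟨x, rfl⟩ := π.loc.surjective x
    simp only [used_rename, pub_rename, NPerm.loc_mem_names, loc_rename, NPerm.lstore_apply]
    exact fun h₁ h₂ h₃ => by rw [h.loc_pub x h₁ h₂ h₃]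
  dom_left x := by
    obtain ⟨x, rfl⟩ := π.loc.surjective x
    simp only [pub_rename, NPerm.loc_mem_names, loc_rename, NPerm.lstore_apply, ne_eq,
      Option.map_eq_none_iff]
    exact h.dom_left x
  dom_right x := by
    obtain ⟨x, rfl⟩ := π.loc.surjective x
    simp only [pub_rename, NPerm.loc_mem_names, loc_rename, NPerm.lstore_apply, ne_eq,
      Option.map_eq_none_iff]
    exact h.dom_right x
  q_used a := by
    obtain ⟨a, rfl⟩ := π.name_surjective a
    simp only [NPerm.names_lstore, used_rename, NPerm.name_mem_names]
    exact h.q_used a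
  q_pub a := by
    obtain ⟨a, rfl⟩ := π.name_surjective a
    simp only [NPerm.names_lstore, used_rename, pub_rename, NPerm.name_mem_names]
    exact h.q_pub a

/-- Renamings of the private names of the components, apart from each other, are induced by a
renaming of the composite. -/
theorem IsSplit.exists_rename (h : IsSplit I C X X') {π π' : NPerm} (hπ : π.Fixes X.pub)
    (hπ' : π'.Fixes X'.pub)
    (hd : ∀ a, a ∈ π.names X.used → a ∈ π'.names X'.used → a ∈ X.pub ∧ a ∈ X'.pub) :
    ∃ ρ : NPerm, ρ.Fixes C.pub ∧ ρ.Fixes I ∧ ρ.Fixes X.pub ∧ ρ.Fixes X'.pub ∧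
      X.rename ρ = X.rename π ∧ X'.rename ρ = X'.rename π' := by
  classical
  -- Common names are public in both components and so fixed by both permutations, which therefore
  -- glue to one function.
  let g : Name → Name := fun a => if a ∈ X.used then π.name a else π'.name a
  have g₁ : ∀ a ∈ X.used, g a = π.name a := fun a ha => if_pos ha
  have g₂ : ∀ a ∈ X'.used, g a = π'.name a := by
    intro a ha
    by_cases ha' : a ∈ X.used
    · obtain ⟨h₁, h₂⟩ := h.common a ha' ha
      rw [g₁ a ha', hπ a h₁, hπ' a h₂]
    · exact if_neg ha'
  -- By `hd`, a common image is public in both components, hence fixed by `π` and by `π'`; so both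
  -- arguments equal it.
  have cross : ∀ a ∈ X.used, ∀ b ∈ X'.used, g a = g b → a = b := by
    intro a ha b hb hab
    rw [g₁ a ha, g₂ b hb] at hab
    obtain ⟨h₁, h₂⟩ := hd (π.name a) (by simpa using ha) (by rw [hab]; simpa using hb)
    have e₁ := hπ _ h₁
    rw [hab] at h₂
    have e₂ := hπ' _ h₂
    rw [NPerm.name_inj] at e₁ e₂
    rw [← e₁, hab, e₂]
  obtain ⟨ρ, hρ⟩ := NPerm.exists_extending (X.used ∪ X'.used) g (by
    intro a ha b hb hab
    simp only [Finset.coe_union, Set.mem_union, Finset.mem_coe] at ha hb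
    rcases ha with ha | ha <;> rcases hb with hb | hb
    · rwa [g₁ a ha, g₁ b hb, NPerm.name_inj] at hab
    · exact cross a ha b hb hab
    · exact (cross b hb a ha hab.symm).symm
    · rwa [g₂ a ha, g₂ b hb, NPerm.name_inj] at hab) (by
    intro a _
    simp only [g]
    split <;> simp)
  have r₁ : ∀ a ∈ X.used, ρ.name a = π.name a := fun a ha => by
    rw [hρ a (by simp [ha]), g₁ a ha]
  have r₂ : ∀ a ∈ X'.used, ρ.name a = π'.name a := fun a ha => by
    rw [hρ a (by simp [ha]), g₂ a ha]
  have key : ∀ a, a ∈ X.used ∨ a ∈ X'.used → (a ∈ X.used → a ∈ X.pub) →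
      (a ∈ X'.used → a ∈ X'.pub) → ρ.name a = a := by
    rintro a (ha | ha) h₁ h₂
    · rw [r₁ a ha, hπ a (h₁ ha)]
    · rw [r₂ a ha, hπ' a (h₂ ha)]
  refine ⟨ρ, fun a ha => ?_, fun a ha => ?_, fun a ha => ?_, fun a ha => ?_,
    h.good_left.rename_congr r₁, h.good_right.rename_congr r₂⟩
  · exact key a ((h.mem_used a).1 (h.good.pub_used ha)).1 (h.pub a ha).1 (h.pub a ha).2
  · exact key a (h.int_used a ha) (h.int_pub a ha).1 (h.int_pub a ha).2
  · rw [r₁ a (h.good_left.pub_used ha), hπ a ha]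
  · rw [r₂ a (h.good_right.pub_used ha), hπ' a ha]

theorem IsActive.exists_rename (h : IsActive n I C X X') {π π' : NPerm} (hπ : π.Fixes X.pub)
    (hπ' : π'.Fixes X'.pub)
    (hd : ∀ a, a ∈ π.names X.used → a ∈ π'.names X'.used → a ∈ X.pub ∧ a ∈ X'.pub) :
    ∃ ρ : NPerm, ρ.Fixes C.pub ∧ IsActive n I (C.rename ρ) (X.rename π) (X'.rename π') := by
  obtain ⟨ρ, h₁, h₂, -, -, h₅, h₆⟩ := h.toIsSplit.exists_rename hπ hπ' hd
  refine ⟨ρ, h₁, ?_⟩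
  have := h.rename ρ
  rwa [h₂.names_eq, h₅, h₆] at this

theorem IsPassive.exists_rename (h : IsPassive I q C X X') {π π' : NPerm} (hπ : π.Fixes X.pub)
    (hπ' : π'.Fixes X'.pub)
    (hd : ∀ a, a ∈ π.names X.used → a ∈ π'.names X'.used → a ∈ X.pub ∧ a ∈ X'.pub) :
    ∃ ρ : NPerm, ρ.Fixes C.pub ∧ IsPassive I q (C.rename ρ) (X.rename π) (X'.rename π') := by
  obtain ⟨ρ, h₁, h₂, h₃, h₄, h₅, h₆⟩ := h.toIsSplit.exists_rename hπ hπ' hd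
  refine ⟨ρ, h₁, ?_⟩
  have := h.rename ρ
  -- Every name of `q` is used by a component and public there, so `ρ` fixes it.
  have hq : ρ.lstore q = q := by
    rw [NPerm.lstore_congr (ρ := 1), NPerm.lstore_one]
    intro a ha
    rw [NPerm.name_one]
    rcases h.q_used a ha with h' | h'
    · exact h₃ a ((h.q_pub a ha).1 h')
    · exact h₄ a ((h.q_pub a ha).2 h')
  rwa [h₂.names_eq, h₅, h₆, hq] at this

end

end SLS

namespace SLS

open State

/-! ### Transitions of composite states -/

/-- The value of a label. -/
def Label.val : Label → Value
  | .call _ v _ => v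
  | .ret v _ => v

theorem Label.names_val_subset (α : Label) : Value.names α.val ⊆ α.names := by
  cases α <;> intro a ha <;> simp_all [Label.val, Label.names]

theorem LocStore.names_override_subset {s s' : LocStore} {a : Name}
    (h : a ∈ LocStore.names (s.override s')) : a ∈ LocStore.names s ∨ a ∈ LocStore.names s' := by
  obtain ⟨x, d, hd, h⟩ := LocStore.mem_names.1 h
  rw [FinPFun.override_apply, Option.or_eq_some_iff] at hd
  rcases hd with hd | ⟨-, hd⟩
  · exact Or.inr (LocStore.mem_names.2 ⟨x, d, hd, h⟩)
  · exact Or.inl (LocStore.mem_names.2 ⟨x, d, hd, h⟩)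

theorem LocStore.names_subset_override {s s' : LocStore} {a : Name}
    (h : a ∈ LocStore.names s') : a ∈ LocStore.names (s.override s') := by
  obtain ⟨x, d, hd, h⟩ := LocStore.mem_names.1 h
  exact LocStore.mem_names.2 ⟨x, d, by rw [FinPFun.override_apply, hd]; rfl, h⟩

theorem LocStore.loc_mem_names {s : LocStore} {x : Loc} (h : s x ≠ none) :
    Name.loc x ∈ LocStore.names s := by
  obtain ⟨d, hd⟩ := Option.ne_none_iff_exists'.1 h
  exact LocStore.mem_names.2 ⟨x, d, hd, Or.inl rfl⟩

namespace State

variable {X Y : State} {α : Label} {s : LocStore}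

theorem Trans.of_lstep {D : Code} {c c' : Config} (h : LStep D c α s c') :
    Trans ⟨D, c⟩ α s ⟨D, c'⟩ := ⟨rfl, h⟩

theorem conf_eq_of_ctrl_eq_some {t : Stack} {e : Exp} {k : Cont} (h : X.ctrl = some (t, e, k)) :
    X.conf = .prog X.used X.pub ⟨X.loc, X.cont⟩ t e k := congrArg State.conf (eq_of_ctrl_eq_some h)

theorem conf_eq_of_ctrl_eq_none (h : X.ctrl = none) :
    X.conf = .sys X.used X.pub ⟨X.loc, X.cont⟩ := congrArg State.conf (eq_of_ctrl_eq_none h)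

theorem Good.loc_eq_none (h : X.Good) {x : Loc} (hx : Name.loc x ∉ X.used) : X.loc x = none := by
  by_contra hc
  exact hx (h.names_loc (LocStore.loc_mem_names hc))

theorem Good.cont_eq_none (h : X.Good) {k : Cont} (hk : Name.cont k ∉ X.used) :
    X.cont k = none := by
  by_contra hc
  obtain ⟨⟨t, l⟩, hd⟩ := Option.ne_none_iff_exists'.1 hc
  exact hk (h.cont_names _ _ _ hd).1

theorem Trans.sys_stores (h : X.Trans α s Y) (hc : X.ctrl = none) :
    Y.loc = X.loc.override s ∧ Y.cont = X.cont := by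
  rcases X with ⟨D, c⟩
  rcases Y with ⟨D', c'⟩
  obtain ⟨rfl, h⟩ := h
  cases h with
  | progCall => cases hc
  | progRet => cases hc
  | sysRet => exact ⟨rfl, rfl⟩
  | sysCall => exact ⟨rfl, rfl⟩

/-- Inversion of transitions from system configurations. -/
theorem Trans.sys_cases (h : X.Trans α s Y) (hc : X.ctrl = none) :
    (∃ f v k, α = .call f v k ∧ (X.code f).isSome = true ∧ X.cont k = none ∧
      Y.ctrl = some ([.appR [.name (.fn f)]], .val v, k)) ∨
    (∃ v k t l, α = .ret v k ∧ X.cont k = some (t, l) ∧ Y.ctrl = some (t, .val v, l)) := by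
  rcases X with ⟨D, c⟩
  rcases Y with ⟨D', c'⟩
  obtain ⟨rfl, h⟩ := h
  cases h with
  | progCall => cases hc
  | progRet => cases hc
  | @sysRet _ _ _ t v k _ l hk => exact Or.inr ⟨v, l, t, k, rfl, hk, rfl⟩
  | @sysCall _ _ _ v _ f k hf hk => exact Or.inl ⟨f, v, k, rfl, hf, FinPFun.notMem_dom_iff.1 hk, rfl⟩

/-- The side conditions of transitions from system configurations. -/
theorem Trans.sys_side (h : X.Trans α s Y) (hc : X.ctrl = none) :
    (∀ x, Name.loc x ∈ Value.names α.val → Name.loc x ∈ LocStore.names s) ∧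
    (∀ x, X.loc x ≠ none → Name.loc x ∈ X.pub → s x ≠ none) := by
  have key : ∀ {N P} {S : Store} {F v}, SysMay N P S F v s →
      ∀ x, S.loc x ≠ none → Name.loc x ∈ P → s x ≠ none := by
    intro N P S F v hS x h₁ h₂ h₃
    have h₁ : x ∈ S.loc.dom := by
      by_contra hc
      exact h₁ (FinPFun.notMem_dom_iff.1 hc)
    exact FinPFun.notMem_dom_iff.2 h₃ (hS.2.2 x h₁ h₂)
  rcases X with ⟨D, c⟩
  rcases Y with ⟨D', c'⟩
  obtain ⟨rfl, h⟩ := h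
  cases h with
  | progCall => cases hc
  | progRet => cases hc
  | sysRet _ hS => exact ⟨hS.2.1, key hS⟩
  | sysCall _ _ hS => exact ⟨hS.2.1, key hS⟩

theorem sysMay_of (hX : ∀ a ∈ α.names ∪ LocStore.names s, a ∈ X.used → a ∈ X.pub)
    (hv : ∀ x, Name.loc x ∈ Value.names α.val → Name.loc x ∈ LocStore.names s)
    (hd : ∀ x, X.loc x ≠ none → Name.loc x ∈ X.pub → s x ≠ none) {F : Finset Name}
    (hF : F ⊆ α.names) : SysMay X.used X.pub ⟨X.loc, X.cont⟩ F α.val s := by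
  refine ⟨?_, hv, ?_⟩
  · intro a ha
    rw [Finset.mem_inter, Finset.mem_union, Finset.mem_union] at ha
    obtain ⟨(ha | ha) | ha, hu⟩ := ha
    · exact hX a (Finset.mem_union_left _ (hF ha)) hu
    · exact hX a (Finset.mem_union_left _ (α.names_val_subset ha)) hu
    · exact hX a (Finset.mem_union_right _ ha) hu
  · intro x h₁ h₂
    by_contra h₃
    refine hd x ?_ h₂ (FinPFun.notMem_dom_iff.1 h₃)
    exact fun h => FinPFun.notMem_dom_iff.2 h h₁

/-- Existence of calls from system configurations. -/
theorem exists_sysCall (hc : X.ctrl = none) {f : Fn} {v : Value} {k : Cont}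
    (hf : (X.code f).isSome = true) (hk : X.cont k = none)
    (hX : ∀ a ∈ (Label.call f v k).names ∪ LocStore.names s, a ∈ X.used → a ∈ X.pub)
    (hv : ∀ x, Name.loc x ∈ Value.names v → Name.loc x ∈ LocStore.names s)
    (hd : ∀ x, X.loc x ≠ none → Name.loc x ∈ X.pub → s x ≠ none) :
    ∃ Y, X.Trans (.call f v k) s Y := by
  have hS : SysMay X.used X.pub ⟨X.loc, X.cont⟩ {.fn f} v s :=
    sysMay_of (α := .call f v k) hX hv hd (by simp [Label.names])
  have h := LStep.sysCall (D := X.code) (s := ⟨X.loc, X.cont⟩) hf (FinPFun.notMem_dom_iff.2 hk) hS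
  rw [← conf_eq_of_ctrl_eq_none hc] at h
  exact ⟨_, Trans.of_lstep h⟩

/-- Existence of returns from system configurations. -/
theorem exists_sysRet (hc : X.ctrl = none) {v : Value} {k : Cont}
    (hk : X.cont k ≠ none)
    (hX : ∀ a ∈ (Label.ret v k).names ∪ LocStore.names s, a ∈ X.used → a ∈ X.pub)
    (hv : ∀ x, Name.loc x ∈ Value.names v → Name.loc x ∈ LocStore.names s)
    (hd : ∀ x, X.loc x ≠ none → Name.loc x ∈ X.pub → s x ≠ none) :
    ∃ Y, X.Trans (.ret v k) s Y := by
  obtain ⟨⟨t, l⟩, hk⟩ := Option.ne_none_iff_exists'.1 hk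
  have hS : SysMay X.used X.pub ⟨X.loc, X.cont⟩ ∅ v s :=
    sysMay_of (α := .ret v k) hX hv hd (by simp)
  have h := LStep.sysRet (D := X.code) (s := ⟨X.loc, X.cont⟩) hk hS
  rw [← conf_eq_of_ctrl_eq_none hc] at h
  exact ⟨_, Trans.of_lstep h⟩

/-- Inversion of transitions from program configurations. -/
theorem Trans.prog_cases (h : X.Trans α s Y) (hc : X.ctrl ≠ none) :
    (∃ f v k r l, α = .call f v k ∧ X.code f = none ∧ Name.cont k ∉ X.used ∧
      X.ctrl = some (.appR [.name (.fn f)] :: r, .val v, l) ∧ Y.cont = X.cont.set k (r, l)) ∨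
    (∃ v k, α = .ret v k ∧ X.ctrl = some ([], .val v, k) ∧ Y.cont = X.cont) := by
  rcases X with ⟨D, c⟩
  rcases Y with ⟨D', c'⟩
  obtain ⟨rfl, h⟩ := h
  cases h with
  | @progCall _ _ _ t v k f k' _ hf hk => exact Or.inl ⟨f, v, k', t, k, rfl, hf, hk, rfl, rfl⟩
  | @progRet _ _ _ v k _ => exact Or.inr ⟨v, k, rfl, rfl, rfl⟩
  | sysRet => exact absurd rfl hc
  | sysCall => exact absurd rfl hc

theorem Trans.prog_stores (h : X.Trans α s Y) (hc : X.ctrl ≠ none) :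
    Y.loc = X.loc ∧ s = LocStore.restrictTo X.loc (closure X.loc (X.pub ∪ Value.names α.val)) ∧
      s = LocStore.restrictTo X.loc Y.pub := by
  rcases X with ⟨D, c⟩
  rcases Y with ⟨D', c'⟩
  obtain ⟨rfl, h⟩ := h
  cases h with
  | @progCall N P s t v k f k' P' hf hk hP =>
    subst hP
    refine ⟨rfl, rfl, ?_⟩
    apply FinPFun.ext_apply
    intro x
    simp [LocStore.restrictTo_apply, State.pub, Config.pub, State.loc, Config.store]
  | @progRet _ _ _ v k _ hP =>
    subst hP
    exact ⟨rfl, rfl, rfl⟩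
  | sysRet => exact absurd rfl hc
  | sysCall => exact absurd rfl hc

theorem exists_progCall {f : Fn} {r : Stack} {v : Value} {l k : Cont}
    (hc : X.ctrl = some (.appR [.name (.fn f)] :: r, .val v, l)) (hf : X.code f = none)
    (hk : Name.cont k ∉ X.used) :
    ∃ Y, X.Trans (.call f v k)
      (LocStore.restrictTo X.loc (closure X.loc (X.pub ∪ Value.names v))) Y := by
  have h := LStep.progCall (P := X.pub) (s := ⟨X.loc, X.cont⟩) (t := r) (v := v) (k := l) hf hk rfl
  rw [← conf_eq_of_ctrl_eq_some hc] at h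
  exact ⟨_, Trans.of_lstep h⟩

theorem exists_progRet {v : Value} {l : Cont} (hc : X.ctrl = some ([], .val v, l)) :
    ∃ Y, X.Trans (.ret v l)
      (LocStore.restrictTo X.loc (closure X.loc (X.pub ∪ Value.names v))) Y := by
  have h := LStep.progRet (D := X.code) (N := X.used) (P := X.pub) (s := ⟨X.loc, X.cont⟩) (v := v)
    (k := l) rfl
  rw [← conf_eq_of_ctrl_eq_some hc] at h
  exact ⟨_, Trans.of_lstep h⟩

end State

/-! ### Internal transitions of the running component -/

section

variable {I : Finset Name} {q : LocStore} {C X X' : State} {n : ℕ}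

/-- The running component is about to interact with the other one. -/
def Pending (I : Finset Name) (X X' : State) : Prop :=
  ∃ t v k, X.ctrl = some (t, .val v, k) ∧
    ((t = [] ∧ Name.cont k ∈ I) ∨
      ∃ f r, t = .appR [.name (.fn f)] :: r ∧ X'.code f ≠ none)

theorem IsSplit.notMem_int (h : IsSplit I C X X') {a : Name} (ha : a ∈ C.used) : a ∉ I :=
  ((h.mem_used a).1 ha).2

theorem IsSplit.code_left (h : IsSplit I C X X') {f : Fn} {F : Func} (hf : X.code f = some F) :
    C.code f = some F := by
  rw [h.code_eq, hf]; rfl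

/-- Internal transitions of the running component are those of the composite. -/
theorem IsActive.local_step (h : IsActive n I C X X') {t' u : Stack} {e' : Exp} {k l : Cont}
    {A : Option Loc} {δ : Option (Loc × Data)}
    (hA : ∀ a, A = some a → Name.loc a ∉ X'.used)
    (hδ : ∀ x d, δ = some (x, d) → Name.loc x ∈ addLoc X.used A)
    (hA' : ∀ a, A = some a → Name.loc a ∉ X.used)
    (hu : Unwind I n X.cont X'.cont k u l)
    (gC : State.Good ⟨C.code, .prog (addLoc C.used A) C.pub ⟨updLoc C.loc δ, C.cont⟩ (t' ++ u) e' l⟩)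
    (gX : State.Good ⟨X.code, .prog (addLoc X.used A) X.pub ⟨updLoc X.loc δ, X.cont⟩ t' e' k⟩) :
    IsActive n I
      ⟨C.code, .prog (addLoc C.used A) C.pub ⟨updLoc C.loc δ, C.cont⟩ (t' ++ u) e' l⟩
      ⟨X.code, .prog (addLoc X.used A) X.pub ⟨updLoc X.loc δ, X.cont⟩ t' e' k⟩ X' where
  good := gC
  good_left := gX
  good_right := h.good_right
  code_eq := h.code_eq
  code_disj := h.code_disj
  mem_used a := by
    change a ∈ addLoc C.used A ↔ (a ∈ addLoc X.used A ∨ a ∈ X'.used) ∧ a ∉ I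
    rw [mem_addLoc, mem_addLoc, h.mem_used]
    constructor
    · rintro (⟨h₁ | h₁, h₂⟩ | ⟨x, hx, rfl⟩)
      · exact ⟨Or.inl (Or.inl h₁), h₂⟩
      · exact ⟨Or.inr h₁, h₂⟩
      · refine ⟨Or.inl (Or.inr ⟨x, hx, rfl⟩), fun hI => ?_⟩
        exact (h.int_used _ hI).elim (hA' x hx) (hA x hx)
    · rintro ⟨(h₁ | h₁) | h₁, h₂⟩
      · exact Or.inl ⟨Or.inl h₁, h₂⟩
      · exact Or.inr h₁
      · exact Or.inl ⟨Or.inr h₁, h₂⟩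
  int_used a ha := (h.int_used a ha).imp (fun h => mem_addLoc.2 (Or.inl h)) id
  int_pub a ha := by
    refine ⟨fun h' => ?_, (h.int_pub a ha).2⟩
    rcases mem_addLoc.1 h' with h' | ⟨x, hx, rfl⟩
    · exact (h.int_pub a ha).1 h'
    · exact absurd (h.int_used _ ha) (by simp [hA x hx, hA' x hx])
  common a h₁ h₂ := by
    rcases mem_addLoc.1 h₁ with h₁ | ⟨x, hx, rfl⟩
    · exact h.common a h₁ h₂
    · exact absurd h₂ (hA x hx)
  pub a ha := by
    refine ⟨fun h' => ?_, (h.pub a ha).2⟩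
    rcases mem_addLoc.1 h' with h' | ⟨x, hx, rfl⟩
    · exact (h.pub a ha).1 h'
    · rcases ((h.mem_used _).1 (h.good.pub_used ha)).1 with h' | h'
      · exact absurd h' (hA' x hx)
      · exact absurd h' (hA x hx)
  cont := h.cont
  ctrl_right := h.ctrl_right
  ctrl := ⟨t', e', k, u, l, rfl, rfl, hu⟩
  loc_right x h₁ h₂ := by
    change updLoc C.loc δ x = X'.loc x
    rcases δ with _ | ⟨y, d⟩
    · exact h.loc_right x h₁ h₂
    · have hy := hδ y d rfl
      rw [updLoc, FinPFun.set_apply, if_neg]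
      · exact h.loc_right x h₁ h₂
      · rintro rfl
        rcases mem_addLoc.1 hy with hy | ⟨z, hz, hzx⟩
        · exact h₂ (h.common _ hy h₁).2
        · exact hA z hz (hzx ▸ h₁)
  loc_left x h₁ h₂ := by
    change updLoc C.loc δ x = updLoc X.loc δ x
    rcases δ with _ | ⟨y, d⟩
    · exact h.loc_left x h₁ h₂
    · rw [updLoc, updLoc, FinPFun.set_apply, FinPFun.set_apply, h.loc_left x h₁ h₂]
  loc_sub x h₁ h₂ := by
    obtain ⟨h₃, h₄⟩ := h.loc_sub x h₁ h₂
    refine ⟨?_, h₄⟩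
    change updLoc X.loc δ x ≠ none
    rcases δ with _ | ⟨y, d⟩
    · exact h₃
    · rw [updLoc, FinPFun.set_apply]
      split
      · nofun
      · exact h₃

/-- The transition depends only on functions of `X` and on locations in its current expression,
where `C` and `X` have the same values. By `hY` a location allocated by `X` is fresh for `X'`, and
then also for `C`. -/
theorem IsActive.exists_step (h : IsActive n I C X X') {Y : State} (hX : X.Step Y)
    (hY : ∀ a ∈ Y.used, a ∉ X.used → a ∉ X'.used) :
    ∃ D, C.Step D ∧ IsActive n I D Y X' := by
  obtain ⟨t, e, k, u, l, h₁, h₂, hu⟩ := h.ctrl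
  have gY := hX.good h.good_left
  obtain ⟨t₁, e₁, k₁, A, δ, t', e', h₃, rfl, hA, hB, hfr⟩ := hX.elim
  rw [h₁] at h₃
  cases h₃
  have hA' : ∀ a, A = some a → Name.loc a ∉ X'.used := fun a ha =>
    hY _ (mem_addLoc.2 (Or.inr ⟨a, ha, rfl⟩)) (hA a ha)
  have he := (h.good.ctrl_names _ _ _ h₂).2.1
  have hst : C.Step
      ⟨C.code, .prog (addLoc C.used A) C.pub ⟨updLoc C.loc δ, C.cont⟩ (t' ++ u) e' l⟩ := by
    refine ⟨rfl, ?_⟩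
    rw [conf_eq_of_ctrl_eq_some h₂]
    refine hfr C.code C.used C.pub ⟨C.loc, C.cont⟩ u l (fun f F hf => h.code_left hf) ?_ ?_
    · intro x d hx hd
      have hx' := he hx
      have hxX : Name.loc x ∈ X.used := (h.good_left.ctrl_names _ _ _ h₁).2.1 hx
      change C.loc x = some d
      rw [h.loc_left x (h.notMem_int hx') fun hx'' => (h.common _ hxX hx'').2, hd]
    · intro a ha hc
      exact ((h.mem_used _).1 hc).1.elim (hA a ha) (hA' a ha)
  refine ⟨_, hst, h.local_step hA' ?_ hA hu (hst.good h.good) gY⟩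
  intro x d hd
  rcases δ with _ | ⟨y, d'⟩
  · cases hd
  · cases hd
    exact (gY.loc_names x d (by
      change updLoc X.loc (some (x, d)) x = some d
      simp [updLoc])).1

theorem IsActive.exists_steps (h : IsActive n I C X X') {Y : State} (hX : X.Steps Y)
    (hY : ∀ a ∈ Y.used, a ∉ X.used → a ∉ X'.used) :
    ∃ D, C.Steps D ∧ IsActive n I D Y X' := by
  induction hX with
  | refl => exact ⟨C, .refl, h⟩
  | @tail Y Z hX hZ ih =>
    obtain ⟨D, hD, hY'⟩ := ih fun a ha => hY a (hZ.used_subset ha)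
    obtain ⟨E, hE, hZ'⟩ := hY'.exists_step hZ fun a ha hb =>
      hY a ha fun hc => hb (Steps.used_subset hX hc)
    exact ⟨E, hD.tail hE, hZ'⟩

/-- If nothing is pending, the topmost frame belongs to the running component, and a function that
is unfolded is one of its own. Since `C` does not use the names in `I`, it might allocate one of
them; `hI` excludes this. -/
theorem IsActive.step_left (h : IsActive n I C X X') (hp : ¬ Pending I X X') {D : State}
    (hC : C.Step D) (hI : ∀ a ∈ D.used, a ∉ I) : ∃ Y, X.Step Y ∧ IsActive n I D Y X' := by
  obtain ⟨t, e, k, u, l, h₁, h₂, hu⟩ := h.ctrl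
  have gD := hC.good h.good
  have he := (h.good.ctrl_names _ _ _ h₂).2.1
  have heX := (h.good_left.ctrl_names _ _ _ h₁).2.1
  obtain ⟨hcode, hC'⟩ := id hC
  rw [conf_eq_of_ctrl_eq_some h₂] at hC'
  have hfr : ∃ A δ t' e', D.conf =
        .prog (addLoc C.used A) C.pub ⟨updLoc C.loc δ, C.cont⟩ (t' ++ u) e' l ∧
      (∀ a, A = some a → Name.loc a ∉ C.used) ∧
      IStep X.code (.prog X.used X.pub ⟨X.loc, X.cont⟩ t e k)
        (.prog (addLoc X.used A) X.pub ⟨updLoc X.loc δ, X.cont⟩ t' e' k) := by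
    refine hC'.unframe X.pub (s := ⟨X.loc, X.cont⟩) k ?_ ?_ ?_ ?_
    · intro v he ht
      subst he ht
      by_contra hne
      cases hu with
      | ext => exact hne rfl
      | int hk => exact hp ⟨_, _, _, h₁, Or.inl ⟨rfl, hk⟩⟩
    · intro f F r v ht he hf
      subst he ht
      rw [h.code_eq, Option.or_eq_some_iff] at hf
      rcases hf with hf | ⟨-, hf⟩
      · exact hf
      · exact absurd ⟨_, _, _, h₁, Or.inr ⟨f, r, rfl, by simp [hf]⟩⟩ hp
    · intro x d hx hd
      rw [← h.loc_left x (h.notMem_int (he hx)) fun hx' => (h.common _ (heX hx) hx').2]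
      exact hd
    · intro x hx hx'
      rw [h.mem_used] at hx
      have := hI (.loc x) hx'
      tauto
  obtain ⟨A, δ, t', e', hD, hA, hXst⟩ := hfr
  have hst : X.Step
      ⟨X.code, .prog (addLoc X.used A) X.pub ⟨updLoc X.loc δ, X.cont⟩ t' e' k⟩ := by
    refine ⟨rfl, ?_⟩
    rw [conf_eq_of_ctrl_eq_some h₁]
    exact hXst
  have gY := hst.good h.good_left
  obtain rfl : D = ⟨C.code, .prog (addLoc C.used A) C.pub ⟨updLoc C.loc δ, C.cont⟩
      (t' ++ u) e' l⟩ := by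
    rcases D with ⟨D, c⟩
    exact congrArg₂ State.mk hcode hD
  have hA₂ : ∀ a, A = some a → Name.loc a ∉ X.used ∧ Name.loc a ∉ X'.used := by
    intro a ha
    have ha' := hA a ha
    rw [h.mem_used] at ha'
    have := hI (.loc a) (mem_addLoc.2 (Or.inr ⟨a, ha, rfl⟩))
    tauto
  refine ⟨_, hst, h.local_step (fun a ha => (hA₂ a ha).2) ?_ (fun a ha => (hA₂ a ha).1) hu gD gY⟩
  intro x d hd
  rcases δ with _ | ⟨y, d'⟩
  · cases hd
  · cases hd
    exact (gY.loc_names x d (by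
      change updLoc X.loc (some (x, d)) x = some d
      simp [updLoc])).1

end

end SLS

namespace SLS

open State

/-! ### Labelled transitions of composite states -/

section

variable {I : Finset Name} {q : LocStore} {C X X' : State} {n : ℕ}

/-- The running component passes control to the environment of the composite. -/
theorem IsActive.emit (h : IsActive n I C X X') {D Y : State} {w : LocStore}
    {P₁ P₂ K : Finset Name} (gD : D.Good) (gY : Y.Good)
    (hcX : Y.code = X.code) (hcC : D.code = C.code) (hX : Y.ctrl = none) (hC : D.ctrl = none)
    (hlX : Y.loc = X.loc) (hlC : D.loc = C.loc)
    (huX : Y.used = X.used ∪ K) (huC : D.used = C.used ∪ K)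
    (hpX : Y.pub = P₁ ∪ K) (hpC : D.pub = P₂ ∪ K)
    (hP₁ : X.pub ⊆ P₁) (hP₁' : P₁ ⊆ X.used) (hP₂ : P₂ ⊆ C.pub ∪ P₁)
    (hK : ∀ a ∈ K, a ∉ X.used ∧ a ∉ X'.used)
    (hw : w = LocStore.restrictTo X.loc P₁) (hw' : LocStore.names w ⊆ P₁)
    (hcont : ∀ k, Name.cont k ∉ I → ContSplit I D.cont Y.cont X'.cont k) :
    IsPassive I w D Y X' := by
  -- `K` is meant to hold the fresh continuation of a call and to be empty for a return; `P₁` and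
  -- `P₂` are the closures that component and composite make public.
  have hIK : ∀ a ∈ I, a ∉ K := fun a ha hk =>
    (h.int_used a ha).elim (hK a hk).1 (hK a hk).2
  have hcom := h.common
  have hint := h.int_pub
  have hpub := h.pub
  have hloc : ∀ x, Name.loc x ∉ I → Name.loc x ∈ X.used → C.loc x = X.loc x :=
    fun x h₁ h₂ => h.loc_left x h₁ fun h₃ => (h.common _ h₂ h₃).2
  have hnone : ∀ x, Name.loc x ∉ X.used → X.loc x = none := fun x => h.good_left.loc_eq_none
  simp only [Finset.subset_iff, Finset.mem_union] at hP₁ hP₁' hP₂ hw'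
  have hwx : ∀ x, w x = if Name.loc x ∈ P₁ then X.loc x else none := fun x => by
    rw [hw, LocStore.restrictTo_apply]
  exact {
    good := gD
    good_left := gY
    good_right := h.good_right
    code_eq := by rw [hcX, hcC]; exact h.code_eq
    code_disj := by rw [hcX]; exact h.code_disj
    mem_used := fun a => by
      have := h.mem_used a
      simp only [huX, huC, Finset.mem_union]
      grind
    int_used := fun a ha => by
      have := h.int_used a ha
      simp only [huX, Finset.mem_union]
      grind
    int_pub := fun a ha => by
      have := h.int_pub a ha
      simp only [huX, hpX, Finset.mem_union]
      grind
    common := fun a => by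
      have := h.common a
      simp only [huX, hpX, Finset.mem_union]
      grind
    pub := fun a => by
      have := h.pub a
      simp only [huX, hpX, hpC, Finset.mem_union]
      grind
    cont := hcont
    ctrl_left := hX
    ctrl_right := h.ctrl_right
    ctrl := hC
    loc_left := fun x => by
      simp only [huX, hpX, hlX, hlC, Finset.mem_union]
      intro h₁ h₂
      refine hloc x ?_ ?_ <;> grind
    loc_right := by rw [hlC]; exact h.loc_right
    loc_pub := fun x h₁ => by
      simp only [huX, hpX, hlC, Finset.mem_union]
      intro h₂ h₃
      rw [h.loc_left x h₁ h₃, hwx]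
      split
      · rfl
      · exact hnone x (by grind)
    dom_left := fun x => by
      rw [hlX, hwx, hpX, Finset.mem_union]
      intro h₁ h₂
      rw [if_pos]
      · exact h₂
      · by_contra h₃
        have := hK (.loc x)
        exact h₂ (hnone x (by grind))
    dom_right := fun x h₁ h₂ => by
      obtain ⟨h₃, h₄⟩ := h.loc_sub x h₁ h₂
      rw [hwx, if_pos (hP₁ h₄)]
      exact h₃
    q_used := fun a ha => by
      rw [huX, Finset.mem_union]
      exact Or.inl (Or.inl (hP₁' (hw' ha)))
    q_pub := fun a ha => by
      have := h.common a
      simp only [huX, hpX, Finset.mem_union]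
      grind }

/-- What the composite shows of its store can be computed from the store `w` on the label of the
component. Indeed `C.loc` agrees with `w` on a set that contains the starting names and is closed
under `w`. -/
theorem closure_composite (h : IsActive n I C X X') {v : Value} {w : LocStore}
    (hv : Value.names v ⊆ C.used) (hvX : Value.names v ⊆ X.used)
    (hw : w = LocStore.restrictTo X.loc (closure X.loc (X.pub ∪ Value.names v))) :
    closure C.loc (C.pub ∪ Value.names v) = closure w (C.pub ∪ Value.names v) ∧
    LocStore.restrictTo C.loc (closure C.loc (C.pub ∪ Value.names v)) =
      LocStore.restrictTo w (closure w (C.pub ∪ Value.names v)) ∧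
    closure C.loc (C.pub ∪ Value.names v) ⊆ C.pub ∪ closure X.loc (X.pub ∪ Value.names v) := by
  set P₁ := closure X.loc (X.pub ∪ Value.names v) with hP₁
  have hP₁X : X.pub ∪ Value.names v ⊆ P₁ := subset_closure
  have hP₁' : P₁ ⊆ X.used :=
    closure_subset (Finset.union_subset h.good_left.pub_used hvX)
      fun x d hd _ => (h.good_left.loc_names x d hd).2
  have hwx : ∀ x, w x = if Name.loc x ∈ P₁ then X.loc x else none := fun x => by
    rw [hw, LocStore.restrictTo_apply]
  have hloc : ∀ x, Name.loc x ∉ I → Name.loc x ∈ X.used → C.loc x = X.loc x :=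
    fun x h₁ h₂ => h.loc_left x h₁ fun h₃ => (h.common _ h₂ h₃).2
  -- Internal names have to be left out, since `C` has no values for them. The set remains closed:
  -- what `w` stores at a location in `B` is also stored there by `C`, which uses no internal names.
  let B := (C.pub ∪ P₁) \ I
  have hB : ∀ a, a ∈ B ↔ (a ∈ C.pub ∨ a ∈ P₁) ∧ a ∉ I := fun a => by
    simp only [B, Finset.mem_sdiff, Finset.mem_union]
  have hXB : C.pub ∪ Value.names v ⊆ B := by
    intro a ha
    rw [hB]
    rw [Finset.mem_union] at ha
    rcases ha with ha | ha
    · exact ⟨Or.inl ha, h.notMem_int (h.good.pub_used ha)⟩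
    · exact ⟨Or.inr (hP₁X (Finset.mem_union_right _ ha)), h.notMem_int (hv ha)⟩
  have hwB : ∀ x d, w x = some d → Name.loc x ∈ B → d.names ⊆ B := by
    intro x d hd hx a ha
    rw [hB] at hx
    rw [hwx] at hd
    split at hd
    · rename_i hxP
      refine (hB a).2 ⟨Or.inr (closure_closed hd hxP ha), h.notMem_int ?_⟩
      rw [← hloc x hx.2 (hP₁' hxP)] at hd
      exact (h.good.loc_names x d hd).2 ha
    · cases hd
  have hCw : ∀ x, Name.loc x ∈ B → C.loc x = w x := by
    intro x hx
    rw [hB] at hx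
    rw [hwx]
    split
    · rename_i hxP
      exact hloc x hx.2 (hP₁' hxP)
    · rename_i hxP
      -- A public location of `C` outside the closure is not used by `X`, so neither `X` nor `C` has
      -- a value there.
      have hxC := hx.1.resolve_right hxP
      rw [h.loc_left x hx.2 (h.pub _ hxC).2]
      refine h.good_left.loc_eq_none fun hxX => hxP ?_
      exact hP₁X (Finset.mem_union_left _ ((h.pub _ hxC).1 hxX))
  have e := closure_congr hXB hwB hCw
  have hsub : closure w (C.pub ∪ Value.names v) ⊆ B := closure_subset hXB hwB
  refine ⟨e, ?_, ?_⟩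
  · rw [e]
    exact restrictTo_congr fun x hx => hCw x (hsub hx)
  · rw [e]
    refine hsub.trans fun a ha => ?_
    rw [Finset.mem_union]
    exact ((hB a).1 ha).1

/-- Labelled transitions of the running component that are directed to the environment of the
composite. -/
theorem IsActive.exists_emit (h : IsActive n I C X X') {α : Label} {w : LocStore} {Y : State}
    (hX : X.Trans α w Y)
    (hcall : ∀ f v k, α = .call f v k → X'.code f = none ∧ Name.cont k ∉ X'.used)
    (hret : ∀ v k, α = .ret v k → Name.cont k ∉ I) :
    ∃ D, C.Trans α (LocStore.restrictTo w (closure w (C.pub ∪ Value.names α.val))) D ∧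
      IsPassive I w D Y X' := by
  obtain ⟨t, e, k, u, l, h₁, h₂, hu⟩ := h.ctrl
  have hne : X.ctrl ≠ none := by rw [h₁]; nofun
  have hneC : C.ctrl ≠ none := by rw [h₂]; nofun
  have gX := h.good_left
  have gY := hX.good gX
  obtain ⟨hlX, hw, -⟩ := hX.prog_stores hne
  have hctY : Y.ctrl = none := by
    by_contra hc
    exact hne (hX.ctrl_eq_none_iff.2 hc)
  rcases hX.prog_cases hne with ⟨f, v, k', r, l', rfl, hf, hk', hctrl, hcY⟩ |
    ⟨v, k', rfl, hctrl, hcY⟩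
  · obtain ⟨hf', hk''⟩ := hcall f v k' rfl
    rw [h₁] at hctrl
    cases hctrl
    have hvX : Value.names v ⊆ X.used := (gX.ctrl_names _ _ _ h₁).2.1
    have hvC : Value.names v ⊆ C.used := (h.good.ctrl_names _ _ _ h₂).2.1
    -- The store on the label of the composite now depends on `w`, `C.pub` and `v` only, not on
    -- private parts of `C`.
    obtain ⟨e₁, e₂, e₃⟩ := closure_composite h hvC hvX hw
    have hfC : C.code f = none := by rw [h.code_eq, hf, hf']; rfl
    have hkC : Name.cont k' ∉ C.used := by
      rw [h.mem_used]
      tauto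
    have hCD := LStep.progCall (P := C.pub) (s := ⟨C.loc, C.cont⟩) (t := r ++ u) (v := v)
      (k := l) hfC hkC rfl
    rw [← List.cons_append, ← conf_eq_of_ctrl_eq_some h₂] at hCD
    dsimp only at hCD
    rw [e₂] at hCD
    have tD := Trans.of_lstep hCD
    have pY : Y.pub = closure X.loc (X.pub ∪ Value.names v) ∪ {Name.cont k'} ∧
        Y.used = X.used ∪ {Name.cont k'} := by
      have hXY := LStep.progCall (P := X.pub) (s := ⟨X.loc, X.cont⟩) (t := r) (v := v)
        (k := k) hf hk' rfl
      rw [← conf_eq_of_ctrl_eq_some h₁] at hXY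
      obtain ⟨-, rfl⟩ := hX.eq_of_prog hne (Trans.of_lstep hXY)
      exact ⟨by change insert _ _ = _; rw [Finset.insert_eq, Finset.union_comm],
        by change insert _ _ = _; rw [Finset.insert_eq, Finset.union_comm]⟩
    refine ⟨_, tD, h.emit (K := {.cont k'}) (tD.good h.good) gY hX.1 rfl hctY rfl hlX rfl pY.2
      (by change insert _ _ = _; rw [Finset.insert_eq, Finset.union_comm]) pY.1
      (by change insert _ _ = _; rw [Finset.insert_eq, Finset.union_comm])
      (Finset.union_subset_left subset_closure)
      (closure_subset (Finset.union_subset gX.pub_used hvX)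
        fun x d hd _ => (gX.loc_names x d hd).2) e₃ ?_ hw (hw ▸ names_restrictTo_closure_subset)
      ?_⟩
    · intro a ha
      rw [Finset.mem_singleton] at ha
      subst ha
      exact ⟨hk', hk''⟩
    · intro m hm
      have hkl : ∀ m, Name.cont m ∈ X.used ∪ X'.used → m ≠ k' := by
        rintro m hm rfl
        simp [hk', hk''] at hm
      have hτ : ∀ m, m ≠ k' → Y.cont m = X.cont m := fun m hm => by
        rw [hcY, FinPFun.set_apply, if_neg hm]
      have hσ : ∀ m t l, X.cont m = some (t, l) → Name.cont l ∈ X.used ∪ X'.used :=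
        fun m t l hm => Finset.mem_union_left _ (gX.cont_names _ _ _ hm).2.2
      have hσ' : ∀ m t l, X'.cont m = some (t, l) → Name.cont l ∈ X.used ∪ X'.used :=
        fun m t l hm => Finset.mem_union_right _ (h.good_right.cont_names _ _ _ hm).2.2
      by_cases hmk : m = k'
      · subst hmk
        -- The component stores its remaining stack `r` with target `k`. From `k` the composite
        -- would continue with `u` to `l`, so it stores `r ++ u` with target `l`.
        refine .left (t := r) (u := u) (l := k) (m := l) (n := n) ?_ ?_ ?_ ?_
        · rw [hcY, FinPFun.set_apply, if_pos rfl]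
        · exact h.good_right.cont_eq_none hk''
        · exact hu.extend (U := X.used ∪ X'.used)
            (Finset.mem_union_left _ (gX.ctrl_names _ _ _ h₁).2.2) (fun _ _ => Iff.rfl) hσ hσ'
            (fun k hk => hτ k (hkl k hk)) fun _ _ => rfl
        · change (C.cont.set m (r ++ u, l)) m = _
          rw [FinPFun.set_apply, if_pos rfl]
      · refine (h.cont m hm).extend (U := X.used ∪ X'.used) (fun _ _ => Iff.rfl) hσ hσ'
            (fun k hk => hτ k (hkl k hk)) (fun _ _ => rfl) ?_ (hτ m hmk) rfl
        change (C.cont.set k' (r ++ u, l)) m = _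
        rw [FinPFun.set_apply, if_neg hmk]
  · have hk' := hret v k' rfl
    rw [h₁] at hctrl
    cases hctrl
    have hvX : Value.names v ⊆ X.used := (gX.ctrl_names _ _ _ h₁).2.1
    have hvC : Value.names v ⊆ C.used := (h.good.ctrl_names _ _ _ h₂).2.1
    obtain ⟨e₁, e₂, e₃⟩ := closure_composite h hvC hvX hw
    obtain ⟨rfl, rfl⟩ : u = [] ∧ l = k := by
      cases hu with
      | ext => exact ⟨rfl, rfl⟩
      | int hk => exact absurd hk hk'
    have hCD := LStep.progRet (D := C.code) (N := C.used) (P := C.pub) (s := ⟨C.loc, C.cont⟩)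
      (v := v) (k := l) rfl
    rw [List.append_nil] at h₂
    rw [← conf_eq_of_ctrl_eq_some h₂] at hCD
    dsimp only at hCD
    rw [e₂] at hCD
    have tD := Trans.of_lstep hCD
    have pY : Y.pub = closure X.loc (X.pub ∪ Value.names v) ∪ ∅ ∧
        Y.used = X.used ∪ ∅ := by
      have hXY := LStep.progRet (D := X.code) (N := X.used) (P := X.pub) (s := ⟨X.loc, X.cont⟩)
        (v := v) (k := l) rfl
      rw [← conf_eq_of_ctrl_eq_some h₁] at hXY
      obtain ⟨-, rfl⟩ := hX.eq_of_prog hne (Trans.of_lstep hXY)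
      exact ⟨(Finset.union_empty _).symm, (Finset.union_empty _).symm⟩
    refine ⟨_, tD, h.emit (K := ∅) (tD.good h.good) gY hX.1 rfl hctY rfl hlX rfl pY.2
      (Finset.union_empty _).symm pY.1 (Finset.union_empty _).symm
      (Finset.union_subset_left subset_closure)
      (closure_subset (Finset.union_subset gX.pub_used hvX)
        fun x d hd _ => (gX.loc_names x d hd).2) e₃ (by simp) hw
      (hw ▸ names_restrictTo_closure_subset) ?_⟩
    rw [hcY]
    exact h.cont

/-- A component receives control from the environment of the composite. -/
theorem IsPassive.exists_receive (h : IsPassive I q C X X') {α : Label} {s : LocStore} {Y : State}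
    (hX : X.Trans α (q.override s) Y)
    (hI : ∀ a ∈ α.names ∪ LocStore.names s, a ∉ I)
    (hC : ∀ a ∈ α.names ∪ LocStore.names s, a ∈ C.used → a ∈ C.pub)
    (hv : ∀ x, Name.loc x ∈ Value.names α.val → Name.loc x ∈ LocStore.names s)
    (hd : ∀ x, C.loc x ≠ none → Name.loc x ∈ C.pub → s x ≠ none)
    (hk : ∀ f v k, α = .call f v k → X'.cont k = none) :
    ∃ D, C.Trans α s D ∧ ∃ n, IsActive n I D Y X' := by
  -- The component receives `q.override s` where the composite receives `s`: some of its public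
  -- locations are private in the composite, and `q` has their current values.
  have hkI : ∀ k, Name.cont k ∈ α.names → Name.cont k ∉ I := fun k hk =>
    hI _ (Finset.mem_union_left _ hk)
  have key : ∃ D, C.Trans α s D ∧ ∃ n t e k u l, Y.ctrl = some (t, e, k) ∧
      D.ctrl = some (t ++ u, e, l) ∧ Unwind I n X.cont X'.cont k u l := by
    rcases hX.sys_cases h.ctrl_left with ⟨f, v, k, rfl, hf, hXk, hY⟩ |
      ⟨v, k, t, l, rfl, hXk, hY⟩
    · have hkI' := hkI k (by simp [Label.names])
      have hCk : C.cont k = none := by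
        cases h.cont k hkI' with
        | none h _ _ => exact h
        | left h => simp [h] at hXk
        | right h => simp [h] at hk
      obtain ⟨F, hF⟩ := Option.isSome_iff_exists.1 hf
      obtain ⟨D, hD⟩ := exists_sysCall h.ctrl (f := f) (v := v) (s := s)
        (by rw [h.code_left hF]; rfl) hCk hC hv hd
      refine ⟨D, hD, 0, _, _, _, [], k, hY, ?_, .ext hkI'⟩
      rcases hD.sys_cases h.ctrl with ⟨_, _, _, h', _, _, hD⟩ | ⟨_, _, _, _, h', _⟩
      · cases h'
        exact hD
      · cases h'
    · have hkI' := hkI k (by simp [Label.names])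
      cases h.cont k hkI' with
      | none _ h => simp [h] at hXk
      | right _ h => simp [h] at hXk
      | @left n t' u l' m h₁ h₂ h₃ h₄ =>
        rw [hXk] at h₁
        cases h₁
        obtain ⟨D, hD⟩ := exists_sysRet h.ctrl (v := v) (s := s) (k := k) (by rw [h₄]; nofun)
          hC hv hd
        refine ⟨D, hD, n, _, _, _, u, m, hY, ?_, h₃⟩
        rcases hD.sys_cases h.ctrl with ⟨_, _, _, h', _⟩ | ⟨_, _, _, _, h', hk', hD⟩
        · cases h'
        · cases h'
          rw [h₄] at hk'
          cases hk'
          exact hD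
  obtain ⟨D, tD, n, hctrl⟩ := key
  refine ⟨D, tD, n, ?_⟩
  obtain ⟨pY, uY⟩ := hX.pub_used h.good_left
  obtain ⟨pD, uD⟩ := tD.pub_used h.good
  obtain ⟨lY, cY⟩ := hX.sys_stores h.ctrl_left
  obtain ⟨lD, cD⟩ := tD.sys_stores h.ctrl
  have hsub : ∀ a ∈ LocStore.names (q.override s), a ∈ LocStore.names q ∨ a ∈ LocStore.names s :=
    fun a => LocStore.names_override_subset
  have hsup : ∀ a ∈ LocStore.names s, a ∈ LocStore.names (q.override s) :=
    fun a => LocStore.names_subset_override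
  have hq₁ := h.q_used
  have hq₂ := h.q_pub
  simp only [Finset.mem_union] at hI hC
  -- A location in `s` that `C` uses is public in `C`, and so public for every component that uses
  -- it. The environment never writes to private locations of a component.
  have hpriv : ∀ x, (Name.loc x ∈ X.used ∧ Name.loc x ∉ X.pub) ∨
      (Name.loc x ∈ X'.used ∧ Name.loc x ∉ X'.pub) → s x = none := by
    intro x hx
    by_contra hs
    have hs := LocStore.loc_mem_names hs
    have h₁ := hI _ (Or.inr hs)
    have h₂ := hC _ (Or.inr hs)
    have h₃ := h.mem_used (.loc x)
    have h₄ := h.pub (.loc x)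
    grind
  exact {
    good := tD.good h.good
    good_left := hX.good h.good_left
    good_right := h.good_right
    code_eq := by rw [hX.1, tD.1]; exact h.code_eq
    code_disj := by rw [hX.1]; exact h.code_disj
    mem_used := fun a => by
      have := h.mem_used a
      simp only [uY, uD, Finset.mem_union]
      grind
    int_used := fun a ha => by
      have := h.int_used a ha
      simp only [uY, Finset.mem_union]
      grind
    int_pub := fun a ha => by
      have := h.int_pub a ha
      simp only [uY, pY, Finset.mem_union]
      grind
    common := fun a => by
      have h₁ := h.common a
      have h₂ := h.mem_used a
      have h₃ := h.pub a
      simp only [uY, pY, Finset.mem_union]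
      grind
    pub := fun a => by
      have h₁ := h.common a
      have h₂ := h.mem_used a
      have h₃ := h.pub a
      simp only [uY, pY, pD, Finset.mem_union]
      grind
    cont := by rw [cY, cD]; exact h.cont
    ctrl_right := h.ctrl_right
    ctrl := by rw [cY]; exact hctrl
    loc_right := fun x h₁ h₂ => by
      rw [lD, FinPFun.override_apply, hpriv x (Or.inr ⟨h₁, h₂⟩)]
      exact h.loc_right x h₁ h₂
    loc_left := fun x h₁ h₂ => by
      rw [lD, lY, FinPFun.override_apply, FinPFun.override_apply, FinPFun.override_apply]
      cases hs : s x with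
      | some d => rfl
      | none =>
        -- Where `s` is silent, a private location of `X` is outside `q` and has its value in `X`.
        -- Any other location has its value in `q`, and if there is none then `X` has none either.
        change C.loc x = (q x).or (X.loc x)
        by_cases hx : Name.loc x ∈ X.used ∧ Name.loc x ∉ X.pub
        · have : q x = none := by
            by_contra hqx
            exact hx.2 ((hq₂ _ (LocStore.loc_mem_names hqx)).1 hx.1)
          rw [this, h.loc_left x hx.1 hx.2]
          rfl
        · rw [h.loc_pub x h₁ (by tauto) h₂]
          cases hqx : q x with
          | some d => rfl
          | none =>
            change none = X.loc x
            symm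
            by_contra hXx
            have h₃ := h.good_left.names_loc (LocStore.loc_mem_names hXx)
            exact h.dom_left x (by tauto) hXx hqx
    loc_sub := fun x h₁ h₂ => by
      have h₃ := h.dom_right x h₁ h₂
      have h₄ : (q.override s) x ≠ none := by
        rw [FinPFun.override_apply]
        cases s x <;> simp [h₃]
      refine ⟨?_, ?_⟩
      · rw [lY, FinPFun.override_apply]
        cases hqs : (q.override s) x with
        | none => exact absurd hqs h₄
        | some d => simp
      · rw [pY]
        simp only [Finset.mem_union]
        exact Or.inr (Or.inr (LocStore.loc_mem_names h₄)) }

/-- Control passes from one component to the other. The composite does not change. -/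
theorem IsActive.sync (h : IsActive n I C X X') {α : Label} {w w' : LocStore} {Y Y' : State}
    {J K : Finset Name} (hX : X.Trans α w Y) (hX' : X'.Trans α w' Y')
    (hK : ∀ a, a ∈ K ↔ ∃ f v k, α = .call f v k ∧ a = .cont k)
    (hKX' : ∀ a ∈ K, a ∉ X'.used)
    (hret : ∀ v k, α = .ret v k → Name.cont k ∈ I)
    (hJ : ∀ a ∈ J, a ∉ X.used ∧ a ∉ X'.used)
    (hw₁ : ∀ a, a ∈ α.names ∪ LocStore.names w' ↔ a ∈ α.names ∪ LocStore.names w ∨ a ∈ J)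
    (hw₂ : ∀ x, Name.loc x ∉ J → w' x = w x) :
    ∃ m, IsActive m (I ∪ (J ∪ K)) C Y' Y ∧
      ((∃ f v k, α = .call f v k) ∧ m = n + 1 ∨ (∃ v k, α = .ret v k) ∧ n = m + 1) := by
  obtain ⟨t, e, k, u, l, h₁, h₂, hu⟩ := h.ctrl
  have hne : X.ctrl ≠ none := by rw [h₁]; nofun
  have gX := h.good_left
  have gX' := h.good_right
  obtain ⟨lY, -, hw⟩ := hX.prog_stores hne
  obtain ⟨pY, uY⟩ := hX.pub_used gX
  obtain ⟨pY', uY'⟩ := hX'.pub_used gX'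
  obtain ⟨lY', cY'⟩ := hX'.sys_stores h.ctrl_right
  have hctY : Y.ctrl = none := by
    by_contra hc
    exact hne (hX.ctrl_eq_none_iff.2 hc)
  have hL : ∀ a ∈ α.names ∪ LocStore.names w, a ∈ X.used ∨ a ∈ K := by
    intro a ha
    rcases hX.names_subset gX hne a ha with h' | ⟨-, h'⟩
    · exact Or.inl h'
    · exact Or.inr ((hK a).2 h')
  have hKL : ∀ a ∈ K, a ∈ α.names ∪ LocStore.names w ∧ a ∉ X.used := by
    intro a ha
    obtain ⟨f, v, k', rfl, rfl⟩ := (hK a).1 ha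
    refine ⟨by simp [Label.names], ?_⟩
    rcases hX.prog_cases hne with ⟨_, _, _, _, _, h', _, hk, _⟩ | ⟨_, _, h', _⟩
    · cases h'
      exact hk
    · cases h'
  rw [← Finset.union_assoc] at pY uY pY' uY'
  have uY'' : ∀ a, a ∈ Y.used ↔ a ∈ X.used ∨ a ∈ α.names ∪ LocStore.names w := by
    intro a; rw [uY]; simp
  have pY'' : ∀ a, a ∈ Y.pub ↔ a ∈ X.pub ∨ a ∈ α.names ∪ LocStore.names w := by
    intro a; rw [pY]; simp
  have uY''' : ∀ a, a ∈ Y'.used ↔ a ∈ X'.used ∨ a ∈ α.names ∪ LocStore.names w ∨ a ∈ J := by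
    intro a; rw [uY', ← hw₁]; simp
  have pY''' : ∀ a, a ∈ Y'.pub ↔ a ∈ X'.pub ∨ a ∈ α.names ∪ LocStore.names w ∨ a ∈ J := by
    intro a; rw [pY', ← hw₁]; simp
  clear pY uY pY' uY' hw₁
  generalize α.names ∪ LocStore.names w = L at *
  have hwx : ∀ x, w x = if Name.loc x ∈ Y.pub then X.loc x else none := fun x => by
    rw [hw, LocStore.restrictTo_apply]
  have hnone : ∀ x, Name.loc x ∉ X.used → X.loc x = none := fun x => gX.loc_eq_none
  -- The new internal names are used by neither component before the transition, so they do not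
  -- affect the unwinding found so far.
  have hU : ∀ a ∈ X.used ∪ X'.used, a ∈ I ∪ (J ∪ K) ↔ a ∈ I := by
    intro a ha
    have h₁ := hJ a
    have h₂ := hKL a
    have h₃ := hKX' a
    simp only [Finset.mem_union] at ha ⊢
    grind
  have hσ : ∀ m t l, X.cont m = some (t, l) → Name.cont l ∈ X.used ∪ X'.used :=
    fun m t l hm => Finset.mem_union_left _ (gX.cont_names _ _ _ hm).2.2
  have hσ' : ∀ m t l, X'.cont m = some (t, l) → Name.cont l ∈ X.used ∪ X'.used :=
    fun m t l hm => Finset.mem_union_right _ (gX'.cont_names _ _ _ hm).2.2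
  have hτ : ∀ m, Name.cont m ∉ K → Y.cont m = X.cont m := by
    intro m hm
    rcases hX.prog_cases hne with ⟨f, v, k', r, l', rfl, hf, hk', hctrl, hcY⟩ |
      ⟨v, k', rfl, hctrl, hcY⟩
    · rw [hcY, FinPFun.set_apply, if_neg]
      rintro rfl
      exact hm ((hK _).2 ⟨_, _, _, rfl, rfl⟩)
    · rw [hcY]
  have hτU : ∀ m, Name.cont m ∈ X.used ∪ X'.used → Y.cont m = X.cont m := by
    intro m hm
    refine hτ m fun hmK => ?_
    have h₂ := (hKL _ hmK).2
    have h₃ := hKX' _ hmK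
    simp [h₂, h₃] at hm
  have hτU' : ∀ m, Name.cont m ∈ X.used ∪ X'.used → Y'.cont m = X'.cont m := fun m _ => by
    rw [cY']
  -- A call stores the rest `r` of the stack under a new internal continuation, so the part `u`
  -- outside the running component becomes `r ++ u`. A return takes the topmost piece of the
  -- unwinding as the stack of the resumed component.
  have key : ∃ m, (∃ t e k u l, Y'.ctrl = some (t, e, k) ∧ C.ctrl = some (t ++ u, e, l) ∧
      Unwind (I ∪ (J ∪ K)) m Y'.cont Y.cont k u l) ∧
      ((∃ f v k, α = .call f v k) ∧ m = n + 1 ∨ (∃ v k, α = .ret v k) ∧ n = m + 1) := by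
    rcases hX.prog_cases hne with ⟨f, v, k', r, l', rfl, hf, hk', hctrl, hcY⟩ |
      ⟨v, k', rfl, hctrl, hcY⟩
    · rw [h₁] at hctrl
      cases hctrl
      rcases hX'.sys_cases h.ctrl_right with ⟨_, _, _, h', _, hk, hY'⟩ | ⟨_, _, _, _, h', _⟩
      · cases h'
        refine ⟨n + 1, ⟨_, _, _, r ++ u, l, hY', h₂, .int (l := k) ?_ ?_ ?_⟩,
          Or.inl ⟨⟨_, _, _, rfl⟩, rfl⟩⟩
        · simp only [Finset.mem_union]
          exact Or.inr (Or.inr ((hK _).2 ⟨_, _, _, rfl, rfl⟩))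
        · rw [hcY, FinPFun.set_apply, if_pos rfl]
        · exact hu.extend (U := X.used ∪ X'.used)
            (Finset.mem_union_left _ (gX.ctrl_names _ _ _ h₁).2.2) hU hσ hσ' hτU hτU'
      · cases h'
    · rw [h₁] at hctrl
      cases hctrl
      have hkI := hret v k rfl
      rcases hX'.sys_cases h.ctrl_right with ⟨_, _, _, h', _⟩ | ⟨_, _, t₂, l₂, h', hk, hY'⟩
      · cases h'
      · cases h'
        cases hu with
        | ext hkI' => exact absurd hkI hkI'
        | @int m _ _ _ l₃ _ t₃ u₃ _ hk₃ hu =>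
          rw [hk] at hk₃
          cases hk₃
          refine ⟨m, ⟨_, _, _, u₃, l, hY', h₂, ?_⟩, Or.inr ⟨⟨_, _, rfl⟩, rfl⟩⟩
          exact hu.extend (U := X.used ∪ X'.used)
            (Finset.mem_union_right _ (gX'.cont_names _ _ _ hk).2.2) hU hσ' hσ hτU' hτU
  obtain ⟨m, hctrl, hm⟩ := key
  refine ⟨m, ?_, hm⟩
  exact {
    good := h.good
    good_left := hX'.good gX'
    good_right := hX.good gX
    code_eq := by rw [hX.1, hX'.1]; exact h.toIsSplit.symm.code_eq
    code_disj := by rw [hX.1, hX'.1]; exact h.toIsSplit.symm.code_disj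
    mem_used := fun a => by
      have h₁ := h.mem_used a
      have h₂ := hJ a
      have h₃ := hKL a
      have h₄ := hKX' a
      have h₅ := hL a
      simp only [uY'', uY''', Finset.mem_union]
      grind
    int_used := fun a => by
      have h₁ := h.int_used a
      have h₃ := hKL a
      simp only [uY'', uY''', Finset.mem_union]
      grind
    int_pub := fun a => by
      have h₁ := h.int_pub a
      have h₂ := hJ a
      have h₃ := hKL a
      have h₄ := hKX' a
      have h₅ := hL a
      simp only [uY'', uY''', pY'', pY''', Finset.mem_union]
      grind
    common := fun a => by
      have h₁ := h.common a
      have h₂ := hJ a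
      have h₃ := hKL a
      have h₄ := hKX' a
      have h₅ := hL a
      simp only [uY'', uY''', pY'', pY''']
      grind
    pub := fun a => by
      have h₁ := h.pub a
      simp only [uY'', uY''', pY'', pY''']
      grind
    cont := fun k hk => by
      simp only [Finset.mem_union, not_or] at hk
      refine ((h.cont k hk.1).extend (U := X.used ∪ X'.used) hU hσ hσ' hτU hτU' rfl
        (hτ k hk.2.2) (by rw [cY'])).symm
    ctrl_right := hctY
    ctrl := hctrl
    loc_right := fun x h₁ h₂ => by
      rw [uY''] at h₁
      rw [pY'', not_or] at h₂
      have h₃ := h₁.resolve_right h₂.2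
      rw [lY]
      refine h.loc_left x (fun hI => h₂.1 ((h.int_pub _ hI).1 h₃)) fun h₄ => ?_
      exact (h.common _ h₃ h₄).2
    loc_left := fun x h₁ h₂ => by
      simp only [Finset.mem_union, not_or] at h₁
      rw [lY', FinPFun.override_apply, hw₂ x h₁.2.1, hwx]
      rw [uY''] at h₂
      -- A private location of `X'` is not used by `X`, hence not on the label, and `X'` has its
      -- value. At other locations `X` has the current value, and by `h₂` this value is public in
      -- `Y` and thus on the label.
      by_cases hx : Name.loc x ∈ X'.used ∧ Name.loc x ∉ X'.pub
      · have hxX : Name.loc x ∉ X.used := fun hxX => hx.2 (h.common _ hxX hx.1).2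
        rw [h.loc_right x hx.1 hx.2, hnone x hxX]
        simp
      · have hx' : Name.loc x ∈ X'.used → Name.loc x ∈ X'.pub := by tauto
        rw [h.loc_left x h₁.1 hx']
        have hX'x : X.loc x = none → X'.loc x = none := by
          intro hn
          by_contra hc
          have h₃ := gX'.names_loc (LocStore.loc_mem_names hc)
          exact (h.loc_sub x (hx' h₃) hc).1 hn
        cases hXx : X.loc x with
        | none => simp [hX'x hXx]
        | some d =>
          have h₃ : Name.loc x ∈ X.used := by
            by_contra hc
            rw [hnone x hc] at hXx
            cases hXx
          rw [if_pos (h₂ (Or.inl h₃))]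
          rfl
    loc_sub := fun x h₁ h₂ => by
      rw [lY] at h₂
      have h₃ : Name.loc x ∈ X.used := by
        by_contra hc
        exact h₂ (hnone x hc)
      have h₄ : Name.loc x ∉ J := fun hc => (hJ _ hc).1 h₃
      have h₅ : w' x = X.loc x := by rw [hw₂ x h₄, hwx, if_pos h₁]
      refine ⟨?_, ?_⟩
      · rw [lY', FinPFun.override_apply, h₅]
        cases hXx : X.loc x with
        | none => exact absurd hXx h₂
        | some d => simp
      · have := (hX'.pub_used gX').1
        rw [this]
        simp only [Finset.mem_union]
        exact Or.inr (Or.inr (LocStore.loc_mem_names (by rwa [h₅]))) }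

end

end SLS

namespace SLS

open State

/-! ### Matching transitions with fresh private names -/

namespace Bisim

variable {X Y X' : State} {α : Label} {s : LocStore}

/-- Transitions are matched with private names that are fresh. -/
theorem exists_match (h : Bisim X Y) (gY : Y.Good) (hX : X.Trans α s X') (F : Finset Name) :
    ∃ π : NPerm, π.Fixes X.pub ∧ ∃ W Y', (Y.rename π).Steps W ∧ W.Trans α s Y' ∧ Bisim X' Y' ∧
      ∀ a ∈ Y'.used, a ∉ X'.pub → a ∉ F := by
  obtain ⟨π, hπ, Y', ⟨W, hW, hY'⟩, h'⟩ := h.trans_label hX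
  have gW : W.Good := Steps.good (gY.rename π) hW
  -- All names of the label are public in `Y'`, so `τ` moves the private names of `Y'` out of `F`
  -- without changing the label.
  obtain ⟨τ, hτ, hF⟩ := NPerm.exists_fresh (Y'.used \ Y'.pub) Y'.pub F
    Finset.disjoint_sdiff.symm
  obtain ⟨hp, -⟩ := hY'.pub_used gW
  have hα : τ.label α = α := by
    rw [NPerm.label_congr (ρ := 1), NPerm.label_one]
    intro a ha
    rw [NPerm.name_one]
    exact hτ a (by rw [hp]; simp [ha])
  have hs : τ.lstore s = s := by
    rw [NPerm.lstore_congr (ρ := 1), NPerm.lstore_one]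
    intro a ha
    rw [NPerm.name_one]
    exact hτ a (by rw [hp]; simp [ha])
  have hWp : X.pub = W.pub := by
    rw [Steps.pub_eq hW, pub_rename, ← h.pub_eq, hπ.names_eq]
  refine ⟨τ * π, (hτ.mono ?_).mul hπ, W.rename τ, Y'.rename τ, ?_, ?_, h'.rename_right ?_, ?_⟩
  · rw [hWp, hp]
    exact Finset.subset_union_left
  · rw [rename_mul]
    exact Steps.rename τ hW
  · have := hY'.rename τ
    rwa [hα, hs] at this
  · rwa [h'.pub_eq]
  · intro a ha ha'
    rw [used_rename] at ha
    obtain ⟨b, hb, rfl⟩ := Finset.mem_image.1 ha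
    refine hF b (Finset.mem_sdiff.2 ⟨hb, fun hb' => ha' ?_⟩)
    rwa [hτ b hb', h'.pub_eq]

/-- System configurations have no internal transitions, so the answer is a single labelled one. -/
theorem exists_match_sys (h : Bisim X Y) (gY : Y.Good) (hY : Y.ctrl = none)
    (hX : X.Trans α s X') (F : Finset Name) :
    ∃ π : NPerm, π.Fixes X.pub ∧ ∃ Y', (Y.rename π).Trans α s Y' ∧ Bisim X' Y' ∧
      ∀ a ∈ Y'.used, a ∉ X'.pub → a ∉ F := by
  obtain ⟨π, hπ, W, Y', hW, h⟩ := h.exists_match gY hX F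
  obtain rfl := Steps.eq_of_ctrl_eq_none hW (by rw [ctrl_rename, hY]; rfl)
  exact ⟨π, hπ, Y', h⟩

/-! ### Bisimilar system configurations -/

theorem names_restrictTo_pub (gX : X.Good) (hX : X.ctrl = none) :
    LocStore.names (X.loc.restrictTo X.pub) ⊆ X.pub :=
  names_restrictTo_subset (gX.closed hX)

/-- As a test, the empty tuple is returned to `k` along with the public part of the store of `X`.
Only a state that stores `k` can match this, and the matching permutation fixes `k` because it is
public. -/
theorem cont_ne_none (h : Bisim X Y) (gX : X.Good) (gY : Y.Good) (hX : X.ctrl = none)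
    (hY : Y.ctrl = none) {k : Cont} (hk : X.cont k ≠ none) : Y.cont k ≠ none := by
  have hkX : Name.cont k ∈ X.pub := by
    by_contra hc
    exact hk (gX.cont_eq_none fun h => hc (gX.cont_mem_pub h))
  obtain ⟨X', hX'⟩ := exists_sysRet (s := X.loc.restrictTo X.pub) hX (v := []) hk (by
    intro a ha _
    rw [Finset.mem_union] at ha
    rcases ha with ha | ha
    · simp only [Label.names, Value.names] at ha
      simp at ha
      rwa [ha]
    · exact names_restrictTo_pub gX hX ha) (by simp [Value.names]) (by
    intro x h₁ h₂
    rwa [LocStore.restrictTo_apply, if_pos h₂])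
  obtain ⟨π, hπ, Y', hY', -⟩ := h.exists_match_sys gY hY hX' ∅
  rcases hY'.sys_cases (by rw [ctrl_rename, hY]; rfl) with ⟨f, v, k, h, -⟩ | ⟨v, k', t, l, h, h', -⟩
  · cases h
  · cases h
    have e : π.cont k = k := by simpa [NPerm.name] using hπ _ hkX
    rw [cont_rename, ← e, NPerm.cstore_apply] at h'
    intro hc
    rw [hc] at h'
    cases h'

/-- As a test, `f` is called with a store defined exactly at the public locations where `X` has a
value. For `Y` to accept this call it must define `f`, and it must have no values at further public
locations, since a system supplies values at all of them. -/
theorem code_and_loc (h : Bisim X Y) (gX : X.Good) (gY : Y.Good) (hX : X.ctrl = none)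
    (hY : Y.ctrl = none) {f : Fn} (hf : X.code f ≠ none) (hfX : Name.fn f ∈ X.pub) :
    Y.code f ≠ none ∧ ∀ x, Name.loc x ∈ X.pub → Y.loc x ≠ none → X.loc x ≠ none := by
  obtain ⟨k, hk⟩ : ∃ k, Name.cont k ∉ X.used := by
    obtain ⟨π, -, h⟩ := NPerm.exists_fresh {.cont 0} ∅ X.used (by simp)
    exact ⟨_, h (.cont 0) (by simp)⟩
  obtain ⟨X', hX'⟩ := exists_sysCall (s := X.loc.restrictTo X.pub) hX (v := [])
    (Option.isSome_iff_ne_none.2 hf) (gX.cont_eq_none hk) (by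
    intro a ha ha'
    rw [Finset.mem_union] at ha
    rcases ha with ha | ha
    · simp only [Label.names, Value.names] at ha
      simp at ha
      rcases ha with rfl | rfl
      · exact hfX
      · exact absurd ha' hk
    · exact names_restrictTo_pub gX hX ha) (by simp [Value.names]) (by
    intro x h₁ h₂
    rwa [LocStore.restrictTo_apply, if_pos h₂])
  obtain ⟨π, hπ, Y', hY', -⟩ := h.exists_match_sys gY hY hX' ∅
  have hYc : (Y.rename π).ctrl = none := by rw [ctrl_rename, hY]; rfl
  constructor
  · rcases hY'.sys_cases hYc with ⟨f, v, k, h, h', -⟩ | ⟨v, k', t, l, h, -⟩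
    · cases h
      have e : π.fn f = f := by simpa [NPerm.name] using hπ _ hfX
      rw [code_rename, ← e, NPerm.code_apply] at h'
      intro hc
      rw [hc] at h'
      cases h'
    · cases h
  · intro x hx hxY
    have e : π.loc x = x := by simpa [NPerm.name] using hπ _ hx
    have := (hY'.sys_side hYc).2 x (by
      rw [loc_rename, ← e, NPerm.lstore_apply]
      intro hc
      rw [Option.map_eq_none_iff] at hc
      exact hxY hc) (by rwa [pub_rename, ← h.pub_eq, hπ.names_eq])
    rwa [LocStore.restrictTo_apply, if_pos hx] at this

end Bisim

end SLS

namespace SLS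

open State

/-! ### Pairs of composite states -/

/-- Composite program configurations with bisimilar components of which the first is running. -/
structure ActivePair (n : ℕ) (I : Finset Name) (C₁ C₂ X₁ X₁' X₂ X₂' : State) : Prop where
  pub_eq : C₁.pub = C₂.pub
  bisim_left : Bisim X₁ X₂
  bisim_right : Bisim X₁' X₂'
  fst : IsActive n I C₁ X₁ X₁'
  snd : ∃ m, IsActive m I C₂ X₂ X₂'

/-- Composite system configurations with bisimilar components. -/
structure PassivePair (I : Finset Name) (q₁ q₂ : LocStore) (C₁ C₂ X₁ X₁' X₂ X₂' : State) :
    Prop where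
  pub_eq : C₁.pub = C₂.pub
  bisim_left : Bisim X₁ X₂
  bisim_right : Bisim X₁' X₂'
  fst : IsPassive I q₁ C₁ X₁ X₁'
  snd : IsPassive I q₂ C₂ X₂ X₂'
  dom_eq : ∀ x, q₁ x = none ↔ q₂ x = none
  eq_of_notMem : ∀ x, Name.loc x ∉ C₁.pub → q₁ x = q₂ x

/-- Composite states with bisimilar components. -/
def Glued (C₁ C₂ : State) : Prop :=
  ∃ I X₁ X₁' X₂ X₂', (∃ n, ActivePair n I C₁ C₂ X₁ X₁' X₂ X₂') ∨
    ∃ q₁ q₂, PassivePair I q₁ q₂ C₁ C₂ X₁ X₁' X₂ X₂'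

section

variable {n : ℕ} {I : Finset Name} {q₁ q₂ : LocStore} {C₁ C₂ X₁ X₁' X₂ X₂' : State}

theorem ActivePair.rename (π : NPerm) (h : ActivePair n I C₁ C₂ X₁ X₁' X₂ X₂') :
    ActivePair n (π.names I) (C₁.rename π) (C₂.rename π) (X₁.rename π) (X₁'.rename π)
      (X₂.rename π) (X₂'.rename π) where
  pub_eq := by rw [pub_rename, pub_rename, h.pub_eq]
  bisim_left := h.bisim_left.rename π
  bisim_right := h.bisim_right.rename π
  fst := h.fst.rename π
  snd := h.snd.imp fun _ h => h.rename π

theorem PassivePair.rename (π : NPerm) (h : PassivePair I q₁ q₂ C₁ C₂ X₁ X₁' X₂ X₂') :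
    PassivePair (π.names I) (π.lstore q₁) (π.lstore q₂) (C₁.rename π) (C₂.rename π)
      (X₁.rename π) (X₁'.rename π) (X₂.rename π) (X₂'.rename π) where
  pub_eq := by rw [pub_rename, pub_rename, h.pub_eq]
  bisim_left := h.bisim_left.rename π
  bisim_right := h.bisim_right.rename π
  fst := h.fst.rename π
  snd := h.snd.rename π
  dom_eq x := by
    obtain ⟨x, rfl⟩ := π.loc.surjective x
    rw [NPerm.lstore_apply, NPerm.lstore_apply, Option.map_eq_none_iff, Option.map_eq_none_iff,
      h.dom_eq]
  eq_of_notMem x := by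
    obtain ⟨x, rfl⟩ := π.loc.surjective x
    rw [NPerm.lstore_apply, NPerm.lstore_apply, pub_rename, NPerm.loc_mem_names]
    intro hx
    rw [h.eq_of_notMem x hx]

theorem PassivePair.swap (h : PassivePair I q₁ q₂ C₁ C₂ X₁ X₁' X₂ X₂') :
    PassivePair I q₁ q₂ C₁ C₂ X₁' X₁ X₂' X₂ :=
  { h with
    bisim_left := h.bisim_right
    bisim_right := h.bisim_left
    fst := h.fst.symm
    snd := h.snd.symm }

/-- Internal names can be chosen fresh. -/
theorem ActivePair.freshen (h : ActivePair n I C₁ C₂ X₁ X₁' X₂ X₂') (F : Finset Name) :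
    ∃ I X₁ X₁' X₂ X₂', (∀ a ∈ I, a ∉ F) ∧ ActivePair n I C₁ C₂ X₁ X₁' X₂ X₂' := by
  obtain ⟨m, h₂⟩ := h.snd
  -- `I` avoids the used names of both composites, so `τ` can move it while `C₁` and `C₂` stay as
  -- they are.
  obtain ⟨τ, hτ, hF⟩ := NPerm.exists_fresh I (C₁.used ∪ C₂.used) F (by
    rw [Finset.disjoint_left]
    intro a ha hc
    rcases Finset.mem_union.1 hc with hc | hc
    · exact h.fst.notMem_int hc ha
    · exact h₂.notMem_int hc ha)
  have := h.rename τ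
  rw [h.fst.good.rename_eq_self (hτ.mono Finset.subset_union_left),
    h₂.good.rename_eq_self (hτ.mono Finset.subset_union_right)] at this
  refine ⟨_, _, _, _, _, fun a ha => ?_, this⟩
  obtain ⟨b, hb, rfl⟩ := Finset.mem_image.1 ha
  exact hF b hb

theorem PassivePair.freshen (h : PassivePair I q₁ q₂ C₁ C₂ X₁ X₁' X₂ X₂') (F : Finset Name) :
    ∃ I q₁ q₂ X₁ X₁' X₂ X₂', (∀ a ∈ I, a ∉ F) ∧
      PassivePair I q₁ q₂ C₁ C₂ X₁ X₁' X₂ X₂' := by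
  obtain ⟨τ, hτ, hF⟩ := NPerm.exists_fresh I (C₁.used ∪ C₂.used) F (by
    rw [Finset.disjoint_left]
    intro a ha hc
    rcases Finset.mem_union.1 hc with hc | hc
    · exact h.fst.notMem_int hc ha
    · exact h.snd.notMem_int hc ha)
  have := h.rename τ
  rw [h.fst.good.rename_eq_self (hτ.mono Finset.subset_union_left),
    h.snd.good.rename_eq_self (hτ.mono Finset.subset_union_right)] at this
  refine ⟨_, _, _, _, _, _, _, fun a ha => ?_, this⟩
  obtain ⟨b, hb, rfl⟩ := Finset.mem_image.1 ha
  exact hF b hb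

theorem Glued.rename (π : NPerm) (h : Glued C₁ C₂) : Glued (C₁.rename π) (C₂.rename π) := by
  obtain ⟨I, X₁, X₁', X₂, X₂', ⟨n, h⟩ | ⟨q₁, q₂, h⟩⟩ := h
  · exact ⟨_, _, _, _, _, Or.inl ⟨_, h.rename π⟩⟩
  · exact ⟨_, _, _, _, _, Or.inr ⟨_, _, h.rename π⟩⟩

theorem Glued.symm (h : Glued C₁ C₂) : Glued C₂ C₁ := by
  obtain ⟨I, X₁, X₁', X₂, X₂', ⟨n, h⟩ | ⟨q₁, q₂, h⟩⟩ := h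
  · obtain ⟨m, h₂⟩ := h.snd
    exact ⟨_, _, _, _, _, Or.inl ⟨m, h.pub_eq.symm, h.bisim_left.symm, h.bisim_right.symm, h₂,
      n, h.fst⟩⟩
  · exact ⟨_, _, _, _, _, Or.inr ⟨q₂, q₁, h.pub_eq.symm, h.bisim_left.symm, h.bisim_right.symm,
      h.snd, h.fst, fun x => (h.dom_eq x).symm,
      fun x hx => (h.eq_of_notMem x (h.pub_eq ▸ hx)).symm⟩⟩

theorem Glued.good (h : Glued C₁ C₂) : C₁.Good := by
  obtain ⟨I, X₁, X₁', X₂, X₂', ⟨n, h⟩ | ⟨q₁, q₂, h⟩⟩ := h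
  · exact h.fst.good
  · exact h.fst.good

theorem Glued.pub_eq (h : Glued C₁ C₂) : C₁.pub = C₂.pub := by
  obtain ⟨I, X₁, X₁', X₂, X₂', ⟨n, h⟩ | ⟨q₁, q₂, h⟩⟩ := h
  · exact h.pub_eq
  · exact h.pub_eq

end

/-! ### Computations of the running component -/

/-- By `hd`, the names used along the computation of the renamed `X` meet those of the renamed `X'`
in public names only. So both renamings come from one of `C`, and no location allocated on the way
is used by `X'`. -/
theorem IsActive.exists_rename_steps {n : ℕ} {I : Finset Name} {C X X' W : State}
    (h : IsActive n I C X X') {π π' : NPerm} (hπ : π.Fixes X.pub) (hπ' : π'.Fixes X'.pub)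
    (hW : (X.rename π).Steps W)
    (hd : ∀ a ∈ W.used, a ∈ π'.names X'.used → a ∈ X.pub ∧ a ∈ X'.pub) :
    ∃ ρ : NPerm, ρ.Fixes C.pub ∧ ∃ D, (C.rename ρ).Steps D ∧
      IsActive n I D W (X'.rename π') := by
  obtain ⟨ρ, hρ, h'⟩ := h.exists_rename hπ hπ' fun a ha ha' =>
    hd a (Steps.used_subset hW (by rwa [used_rename])) ha'
  obtain ⟨D, hD, hA⟩ := h'.exists_steps hW fun a ha ha' hc => ha' (by
    rw [used_rename] at hc
    rw [used_rename, ← hπ a (hd a ha hc).1, NPerm.name_mem_names]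
    exact h.good_left.pub_used (hd a ha hc).1)
  exact ⟨ρ, hρ, D, hD, hA⟩

/-! ### Dangling locations -/

/-- Adding dangling pointers to the locations of `v`. -/
theorem LocStore.exists_pointers (v : Value) (w : LocStore) {F : Finset Name}
    (hw : LocStore.names w ⊆ F) :
    ∃ (J : Finset Name) (w' : LocStore), (∀ a ∈ J, a ∉ F) ∧
      (∀ a, a ∈ LocStore.names w' → a ∈ Value.names v ∨ a ∈ LocStore.names w ∨ a ∈ J) ∧
      (∀ a, a ∈ LocStore.names w ∨ a ∈ J → a ∈ LocStore.names w') ∧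
      (∀ x, Name.loc x ∉ J → w' x = w x) ∧
      ∀ x, Name.loc x ∈ Value.names v → Name.loc x ∈ LocStore.names w' := by
  classical
  -- `b` exceeds the indices in `F`. The cell `y + b`, which is outside `F`, will point to the
  -- location `y` of `v`.
  obtain ⟨b, hb⟩ : ∃ b, ∀ a ∈ F, a.idx < b :=
    ⟨F.sup Name.idx + 1, fun a ha => Nat.lt_succ_of_le (Finset.le_sup (f := Name.idx) ha)⟩
  let p : LocStore :=
    { toFun := fun y => if b ≤ y ∧ Name.loc (y - b) ∈ Value.names v then some (.loc (y - b))
        else none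
      dom := ((Value.names v).image fun a => a.idx + b).filter
        fun y => b ≤ y ∧ Name.loc (y - b) ∈ Value.names v
      mem_dom := by
        intro y
        simp only [Finset.mem_filter, Finset.mem_image]
        constructor
        · rintro ⟨-, h⟩
          rw [if_pos h]
          rfl
        · intro h
          split at h
          · rename_i h'
            refine ⟨⟨_, h'.2, ?_⟩, h'⟩
            exact Nat.sub_add_cancel h'.1
          · cases h }
  have hp : ∀ y, p y = if b ≤ y ∧ Name.loc (y - b) ∈ Value.names v then some (.loc (y - b))
      else none := fun y => rfl
  have hJ : ∀ a, a ∈ p.dom.image Name.loc ↔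
      ∃ y, a = .loc (y + b) ∧ Name.loc y ∈ Value.names v := by
    intro a
    simp only [Finset.mem_image, FinPFun.mem_dom]
    constructor
    · rintro ⟨y, hy, rfl⟩
      rw [hp] at hy
      split at hy
      · rename_i h
        exact ⟨y - b, by rw [Nat.sub_add_cancel h.1], h.2⟩
      · cases hy
    · rintro ⟨y, rfl, hy⟩
      refine ⟨y + b, ?_, rfl⟩
      rw [hp, if_pos ⟨by omega, by rwa [Nat.add_sub_cancel]⟩]
      rfl
  have hJF : ∀ a ∈ p.dom.image Name.loc, a ∉ F := by
    intro a ha hF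
    obtain ⟨y, rfl, -⟩ := (hJ a).1 ha
    have := hb _ hF
    simp only [Name.idx] at this
    omega
  have hpn : ∀ x, Name.loc x ∈ Value.names v → p (x + b) = some (.loc x) := by
    intro x hx
    rw [hp, if_pos ⟨by omega, by rwa [Nat.add_sub_cancel]⟩, Nat.add_sub_cancel]
  refine ⟨p.dom.image Name.loc, w.override p, hJF, ?_, ?_, ?_, ?_⟩
  · intro a ha
    rcases LocStore.names_override_subset ha with ha | ha
    · exact Or.inr (Or.inl ha)
    · obtain ⟨y, d, hd, ha⟩ := LocStore.mem_names.1 ha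
      rcases ha with rfl | ha
      · refine Or.inr (Or.inr (Finset.mem_image.2 ⟨y, ?_, rfl⟩))
        rw [FinPFun.mem_dom, hd]
        rfl
      · rw [hp] at hd
        split at hd
        · rename_i h
          cases hd
          rw [Data.names, Finset.mem_singleton] at ha
          exact Or.inl (ha ▸ h.2)
        · cases hd
  · rintro a (ha | ha)
    · obtain ⟨x, d, hd, ha⟩ := LocStore.mem_names.1 ha
      refine LocStore.mem_names.2 ⟨x, d, ?_, ha⟩
      rw [FinPFun.override_apply]
      have hx : p x = none := by
        by_contra hc
        refine hJF (.loc x) (Finset.mem_image.2 ⟨x, ?_, rfl⟩)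
          (hw (LocStore.loc_mem_names (by rw [hd]; nofun)))
        rw [FinPFun.mem_dom, Option.isSome_iff_ne_none]
        exact hc
      rw [hx, hd]
      rfl
    · obtain ⟨y, rfl, hy⟩ := (hJ a).1 ha
      apply LocStore.names_subset_override
      exact LocStore.loc_mem_names (by rw [hpn y hy]; nofun)
  · intro x hx
    rw [FinPFun.override_apply]
    have : p x = none := by
      by_contra hc
      refine hx (Finset.mem_image.2 ⟨x, ?_, rfl⟩)
      rw [FinPFun.mem_dom, Option.isSome_iff_ne_none]
      exact hc
    rw [this]
    rfl
  · intro x hx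
    apply LocStore.names_subset_override
    exact LocStore.mem_names.2 ⟨x + b, _, hpn x hx, Or.inr (by simp [Data.names])⟩

end SLS

namespace SLS

open State

/-! ### Interaction of the components -/

section

variable {n : ℕ} {I : Finset Name} {C X X' : State}

theorem IsActive.cont_ne_none (h : IsActive n I C X X') {t : Stack} {e : Exp} {k : Cont}
    (hc : X.ctrl = some (t, e, k)) (hk : Name.cont k ∈ I) : X'.cont k ≠ none := by
  obtain ⟨t', e', k', u, l, h₁, -, hu⟩ := h.ctrl
  rw [h₁] at hc
  cases hc
  cases hu with
  | ext h => exact absurd hk h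
  | int _ h => rw [h]; nofun

/-- A pending interaction can be performed. -/
theorem IsActive.exists_sync (h : IsActive n I C X X') (hp : Pending I X X') (G : Finset Name) :
    ∃ (α : Label) (w w' : LocStore) (Y Y' : State) (J K : Finset Name),
      X.Trans α w Y ∧ X'.Trans α w' Y' ∧
      (∀ a, a ∈ K ↔ ∃ f v k, α = .call f v k ∧ a = .cont k) ∧ (∀ a ∈ K, a ∉ G) ∧
      (∀ v k, α = .ret v k → Name.cont k ∈ I) ∧ (∀ a ∈ J, a ∉ G ∧ a ∉ Y.used) ∧
      (∀ a, a ∈ α.names ∪ LocStore.names w' ↔ a ∈ α.names ∪ LocStore.names w ∨ a ∈ J) ∧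
      ∀ x, Name.loc x ∉ J → w' x = w x := by
  obtain ⟨t, v, k₀, hc, hp⟩ := hp
  have hne : X.ctrl ≠ none := by rw [hc]; nofun
  have gX := h.good_left
  obtain ⟨k', hk'⟩ : ∃ k, Name.cont k ∉ X.used ∪ X'.used ∪ G := by
    obtain ⟨π, -, h⟩ := NPerm.exists_fresh {.cont 0} ∅ (X.used ∪ X'.used ∪ G) (by simp)
    exact ⟨_, h (.cont 0) (by simp)⟩
  simp only [Finset.mem_union, not_or] at hk'
  obtain ⟨⟨hkX, hkX'⟩, hkG⟩ := hk'
  -- The store that `X'` receives is left open here, because the additional pointers depend on the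
  -- label of `X`.
  have key : ∃ (α : Label) (w : LocStore) (Y : State) (K : Finset Name), X.Trans α w Y ∧
      (∀ a, a ∈ K ↔ ∃ f v k, α = .call f v k ∧ a = .cont k) ∧
      (∀ a ∈ K, a ∉ G ∧ a ∉ X'.used) ∧
      (∀ v k, α = .ret v k → Name.cont k ∈ I) ∧
      ∀ w' : LocStore, (∀ a ∈ α.names ∪ LocStore.names w', a ∈ X'.used → a ∈ X'.pub) →
        (∀ x, Name.loc x ∈ Value.names α.val → Name.loc x ∈ LocStore.names w') →
        (∀ x, X'.loc x ≠ none → Name.loc x ∈ X'.pub → w' x ≠ none) →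
        ∃ Y', X'.Trans α w' Y' := by
    rcases hp with ⟨rfl, hk⟩ | ⟨f, r, rfl, hf⟩
    · obtain ⟨Y, hY⟩ := exists_progRet hc
      refine ⟨_, _, Y, ∅, hY, by simp, by simp, ?_, fun w' h₁ h₂ h₃ => ?_⟩
      · rintro v k ⟨⟩
        exact hk
      · exact exists_sysRet h.ctrl_right (h.cont_ne_none hc hk) h₁ h₂ h₃
    · have hfX : X.code f = none := (h.code_disj f).resolve_right hf
      obtain ⟨Y, hY⟩ := exists_progCall hc hfX hkX
      refine ⟨_, _, Y, {.cont k'}, hY, by simp, by simp [hkG, hkX'], by simp,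
        fun w' h₁ h₂ h₃ => ?_⟩
      exact exists_sysCall h.ctrl_right (Option.isSome_iff_ne_none.2 hf)
        (h.good_right.cont_eq_none hkX') h₁ h₂ h₃
  obtain ⟨α, w, Y, K, hY, hK, hKG, hret, hY'⟩ := key
  obtain ⟨pY, uY⟩ := hY.pub_used gX
  obtain ⟨-, -, hw⟩ := hY.prog_stores hne
  -- The value may contain a location without a value in `X`, which `w` need not mention. A system
  -- has to mention it in its store; the fresh cells `J` point to the locations of the value for
  -- this purpose and become internal names.
  obtain ⟨J, w', hJ, h₁, h₂, h₃, h₄⟩ := LocStore.exists_pointers α.val w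
    (F := G ∪ Y.used ∪ X'.used) (fun a ha => by rw [uY]; simp [ha])
  have hJ' : ∀ a ∈ J, a ∉ G ∧ a ∉ Y.used ∧ a ∉ X'.used := fun a ha => by
    simpa [and_assoc] using hJ a ha
  have hn : ∀ a, a ∈ α.names ∪ LocStore.names w' ↔ a ∈ α.names ∪ LocStore.names w ∨ a ∈ J := by
    intro a
    have h₅ := h₁ a
    have h₆ := h₂ a
    have h₇ : a ∈ Value.names α.val → a ∈ α.names := fun h => α.names_val_subset h
    simp only [Finset.mem_union]
    clear * - h₅ h₆ h₇
    tauto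
  obtain ⟨Y', hY'⟩ := hY' w' (by
    intro a ha ha'
    rcases (hn a).1 ha with h₅ | h₅
    · rcases hY.names_subset gX hne a h₅ with h₆ | ⟨-, h₆⟩
      · exact (h.common a h₆ ha').2
      · exact absurd ha' (hKG a ((hK a).2 h₆)).2
    · exact absurd ha' (hJ' a h₅).2.2) h₄ (by
    intro x hx hx'
    obtain ⟨h₅, h₆⟩ := h.loc_sub x hx' hx
    have h₇ : Name.loc x ∈ Y.pub := by rw [pY]; exact Finset.mem_union_left _ h₆
    rw [h₃ x fun hc => (hJ' _ hc).2.1 ?_, hw, LocStore.restrictTo_apply, if_pos h₇]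
    · exact h₅
    · rw [uY]
      exact Finset.mem_union_left _ (gX.pub_used h₆))
  exact ⟨α, w, w', Y, Y', J, K, hY, hY', hK, fun a ha => (hKG a ha).1, hret,
    fun a ha => ⟨(hJ' a ha).1, (hJ' a ha).2.1⟩, hn, h₃⟩

/-- After a call from one component to the other there is no pending interaction. -/
theorem not_pending_of_call {α : Label} {w w' : LocStore} {Y Y' : State} {I' : Finset Name}
    (h : IsActive n I C X X') (hX : X.Trans α w Y) (hX' : X'.Trans α w' Y')
    (hα : ∃ f v k, α = .call f v k) : ¬ Pending I' Y' Y := by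
  rintro ⟨t, v, k, hc, hp⟩
  obtain ⟨f, v', k', rfl⟩ := hα
  rcases hX'.sys_cases h.ctrl_right with ⟨_, _, _, e, hf, -, hY⟩ | ⟨_, _, _, _, e, -⟩
  · cases e
    rw [hY] at hc
    cases hc
    rcases hp with ⟨e, -⟩ | ⟨g, r, e, hg⟩
    · cases e
    · cases e
      rw [hX.1] at hg
      have := (h.code_disj f).resolve_left hg
      rw [this] at hf
      cases hf
  · cases e

/-- The composite of bisimilar components mimics an interaction of the components. -/
theorem ActivePair.exists_sync {C₁ C₂ X₂ X₂' : State} (h : ActivePair n I C₁ C₂ X X' X₂ X₂')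
    (hp : Pending I X X') {F : Finset Name} (hF : ∀ a ∈ I, a ∉ F) :
    ∃ ρ : NPerm, ρ.Fixes C₂.pub ∧ ∃ D, (C₂.rename ρ).Steps D ∧ ∃ m I' Y Y' Y₂ Y₂',
      (∀ a ∈ I', a ∉ F) ∧ ActivePair m I' C₁ D Y' Y Y₂' Y₂ ∧ (¬ Pending I' Y' Y ∨ n = m + 1) := by
  obtain ⟨m₂, h₂⟩ := h.snd
  have h₁ := h.fst
  obtain ⟨α, w, w', Y, Y', J, K, hY, hY', hK, hKG, hret, hJ, hw₁, hw₂⟩ :=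
    h₁.exists_sync hp (X.used ∪ X'.used ∪ F)
  simp only [Finset.mem_union, not_or] at hKG hJ
  have hne : X.ctrl ≠ none := by
    obtain ⟨t, v, k, hc, -⟩ := hp
    rw [hc]; nofun
  obtain ⟨n', hA₁, hn⟩ := h₁.sync hY hY' hK (fun a ha => (hKG a ha).1.2) hret
    (fun a ha => (hJ a ha).1.1) hw₁ hw₂
  -- `X₂` answers with private names outside `J` and `Y'.used`, and then `X₂'` with private names
  -- outside `Y₂.used`. So the private names of the answers do not clash.
  obtain ⟨π, hπ, W, Y₂, hW, hY₂, hB, hfr⟩ :=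
    h.bisim_left.exists_match h₂.good_left hY (J ∪ Y'.used)
  obtain ⟨π', hπ', Y₂', hY₂', hB', hfr'⟩ :=
    h.bisim_right.exists_match_sys h₂.good_right h₂.ctrl_right hY' Y₂.used
  have gW : W.Good := Steps.good (h₂.good_left.rename π) hW
  have gR : (X₂'.rename π').Good := h₂.good_right.rename π'
  have cR : (X₂'.rename π').ctrl = none := by rw [ctrl_rename, h₂.ctrl_right]; rfl
  have pR : (X₂'.rename π').pub = X'.pub := by
    rw [pub_rename, ← h.bisim_right.pub_eq, hπ'.names_eq]
  have hWY : W.used ⊆ Y₂.used := by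
    rw [(hY₂.pub_used gW).2]; exact Finset.subset_union_left
  have hRY : (X₂'.rename π').used ⊆ Y₂'.used := by
    rw [(hY₂'.pub_used gR).2]; exact Finset.subset_union_left
  obtain ⟨pY, uY⟩ := hY.pub_used h₁.good_left
  obtain ⟨pY', uY'⟩ := hY'.pub_used h₁.good_right
  -- By freshness a common name is public in `Y'` and in `Y`. It was public before: a system
  -- transition mentions no private names of its state, and the only new name a program communicates
  -- is a continuation in `K`, which `X'` does not use.
  have hd : ∀ a ∈ W.used, a ∈ (X₂'.rename π').used → a ∈ X.pub ∧ a ∈ X'.pub := by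
    intro a ha ha'
    have e₁ : a ∈ Y'.pub := by
      by_contra hc
      exact hfr' a (hRY ha') hc (hWY ha)
    have e₂ : a ∈ Y.pub := by
      by_contra hc
      exact hfr a (hWY ha) hc
        (Finset.mem_union_right _ ((hY'.good h₁.good_right).pub_used e₁))
    have e₃ : a ∈ X'.pub := by
      rw [pY', Finset.mem_union] at e₁
      rcases e₁ with e₁ | e₁
      · exact e₁
      · rw [← pR]
        exact hY₂'.names_inter gR cR a e₁ ha'
    refine ⟨?_, e₃⟩
    rw [pY, Finset.mem_union] at e₂
    rcases e₂ with e₂ | e₂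
    · exact e₂
    · rcases hY.names_subset h₁.good_left hne a e₂ with e | ⟨-, e⟩
      · exact (h₁.common a e (h₁.good_right.pub_used e₃)).1
      · exact absurd (h₁.good_right.pub_used e₃) (hKG a ((hK a).2 e)).1.2
  obtain ⟨ρ, hρ, D, hD, hA₂⟩ := h₂.exists_rename_steps (π := π) (π' := π')
    (h.bisim_left.pub_eq ▸ hπ) (h.bisim_right.pub_eq ▸ hπ') hW (by
      rw [← used_rename, ← h.bisim_left.pub_eq, ← h.bisim_right.pub_eq]
      exact hd)
  obtain ⟨m', hA₂', -⟩ := hA₂.sync hY₂ hY₂' hK (fun a ha hc => by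
      obtain ⟨f, v, k, -, rfl⟩ := (hK a).1 ha
      have := gR.cont_mem_pub hc
      rw [pR] at this
      exact (hKG _ ha).1.2 (h₁.good_right.pub_used this)) hret (fun a ha => by
      constructor
      · intro hc
        by_cases hc' : a ∈ Y.pub
        · exact (hJ a ha).2 ((hY.good h₁.good_left).pub_used hc')
        · exact hfr a (hWY hc) hc' (Finset.mem_union_left _ ha)
      · intro hc
        have := hY₂'.names_inter gR cR a ((hw₁ a).2 (Or.inr ha)) hc
        rw [pR] at this
        exact (hJ a ha).1.1.2 (h₁.good_right.pub_used this)) hw₁ hw₂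
  refine ⟨ρ, hρ, D, hD, n', _, Y, Y', Y₂, Y₂', ?_, ⟨?_, hB', hB, hA₁, m', hA₂'⟩, ?_⟩
  · intro a ha
    simp only [Finset.mem_union] at ha
    rcases ha with ha | ha | ha
    · exact hF a ha
    · exact (hJ a ha).1.2
    · exact (hKG a ha).2
  · rw [Steps.pub_eq hD, pub_rename, hρ.names_eq, h.pub_eq]
  · rcases hn with ⟨hα, -⟩ | ⟨-, hn⟩
    · exact Or.inl (not_pending_of_call h₁ hY hY' hα)
    · exact Or.inr hn

/-- The components can interact until the running component is ready for a transition of the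
composite. -/
theorem ActivePair.exists_normal {C₁ C₂ X₂ X₂' : State} (h : ActivePair n I C₁ C₂ X X' X₂ X₂')
    {F : Finset Name} (hF : ∀ a ∈ I, a ∉ F) :
    ∃ ρ : NPerm, ρ.Fixes C₂.pub ∧ ∃ D, (C₂.rename ρ).Steps D ∧ ∃ m I' Y Y' Y₂ Y₂',
      (∀ a ∈ I', a ∉ F) ∧ ActivePair m I' C₁ D Y Y' Y₂ Y₂' ∧ ¬ Pending I' Y Y' := by
  -- `n` counts the internal continuations on the way out. A return lowers it by one and may leave
  -- another return pending; a call raises it but leaves nothing pending.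
  induction n generalizing I C₂ X X' X₂ X₂' with
  | zero =>
    by_cases hp : Pending I X X'
    · obtain ⟨ρ, hρ, D, hD, m, I', Y, Y', Y₂, Y₂', hF', h', hp' | hp'⟩ := h.exists_sync hp hF
      · exact ⟨ρ, hρ, D, hD, m, I', Y', Y, Y₂', Y₂, hF', h', hp'⟩
      · omega
    · exact ⟨1, NPerm.Fixes.one _, C₂, by rw [rename_one], _, _, _, _, _, _, hF, h, hp⟩
  | succ n ih =>
    by_cases hp : Pending I X X'
    · obtain ⟨ρ, hρ, D, hD, m, I', Y, Y', Y₂, Y₂', hF', h', hp' | hp'⟩ := h.exists_sync hp hF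
      · exact ⟨ρ, hρ, D, hD, m, I', Y', Y, Y₂', Y₂, hF', h', hp'⟩
      · obtain rfl : n = m := by omega
        obtain ⟨σ, hσ, E, hE, h''⟩ := ih h' hF'
        rw [Steps.pub_eq hD, pub_rename, hρ.names_eq] at hσ
        refine ⟨σ * ρ, hσ.mul hρ, E, ?_, h''⟩
        rw [rename_mul]
        exact (Steps.rename σ hD).trans hE
    · exact ⟨1, NPerm.Fixes.one _, C₂, by rw [rename_one], _, _, _, _, _, _, hF, h, hp⟩

end

end SLS

namespace SLS

open State

/-! ### Labelled transitions of composites -/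

section

variable {n : ℕ} {I : Finset Name} {C D X X' : State} {α : Label} {s : LocStore}

/-- Labelled transitions of a composite program configuration are due to the running component. -/
theorem IsActive.trans_left (h : IsActive n I C X X') (hp : ¬ Pending I X X')
    (hC : C.Trans α s D) (hI : ∀ a ∈ α.names, a ∉ I) :
    ∃ w Y, X.Trans α w Y ∧
      (∀ f v k, α = .call f v k → X.code f = none ∧ X'.code f = none ∧
        Name.fn f ∈ X.used ∧ Name.cont k ∉ X.used ∧ Name.cont k ∉ X'.used) ∧
      ∀ v k, α = .ret v k → Name.cont k ∉ I := by
  obtain ⟨t, e, k₀, u, l, h₁, h₂, hu⟩ := h.ctrl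
  have hne : C.ctrl ≠ none := by rw [h₂]; nofun
  rcases hC.prog_cases hne with ⟨f, v, k, r, l', rfl, hf, hk, hctrl, -⟩ | ⟨v, k, rfl, hctrl, -⟩
  · rw [h₂] at hctrl
    simp only [Option.some.injEq, Prod.mk.injEq] at hctrl
    obtain ⟨ht, rfl, rfl⟩ := hctrl
    have hkI := hI (.cont k) (by simp [Label.names])
    have hk' : Name.cont k ∉ X.used ∧ Name.cont k ∉ X'.used := by
      rw [h.mem_used] at hk
      tauto
    -- An empty stack of the running component means that the calling frame lies in `u`. Then the
    -- component returns to an internal continuation, which would be pending.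
    rcases t with _ | ⟨fr, t⟩
    · exfalso
      cases hu with
      | ext => cases ht
      | int hk₀ => exact hp ⟨_, _, _, h₁, Or.inl ⟨rfl, hk₀⟩⟩
    · simp only [List.cons_append, List.cons.injEq] at ht
      obtain ⟨rfl, -⟩ := ht
      have hff : X.code f = none ∧ X'.code f = none := by
        rw [h.code_eq] at hf
        simpa using hf
      obtain ⟨Y, hY⟩ := exists_progCall h₁ hff.1 hk'.1
      refine ⟨_, Y, hY, ?_, by simp⟩
      rintro _ _ _ ⟨⟩
      refine ⟨hff.1, hff.2, ?_, hk'⟩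
      exact (h.good_left.ctrl_names _ _ _ h₁).1 (by
        simp [Stack.names, Frame.names, Value.names, Atom.names])
  · rw [h₂] at hctrl
    simp only [Option.some.injEq, Prod.mk.injEq, List.append_eq_nil_iff] at hctrl
    obtain ⟨⟨rfl, -⟩, rfl, rfl⟩ := hctrl
    have hk₀ : Name.cont k₀ ∉ I := fun hk₀ => hp ⟨_, _, _, h₁, Or.inl ⟨rfl, hk₀⟩⟩
    have hl : l = k₀ := by
      cases hu with
      | ext => rfl
      | int h => exact absurd h hk₀
    subst hl
    obtain ⟨Y, hY⟩ := exists_progRet h₁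
    refine ⟨_, Y, hY, by simp, ?_⟩
    rintro _ _ ⟨⟩
    exact hk₀

/-- The transition belongs to the running component and is matched by its partner under the same
label. Both composites show the same restriction of the store `w`, and `w` then serves as `q` on
both sides. -/
theorem ActivePair.exists_trans {C₁ C₂ X₂ X₂' : State} (h : ActivePair n I C₁ C₂ X X' X₂ X₂')
    (hp : ¬ Pending I X X') (hC : C₁.Trans α s D) (hI : ∀ a ∈ α.names, a ∉ I) :
    ∃ ρ : NPerm, ρ.Fixes C₂.pub ∧ ∃ E, (C₂.rename ρ).WeakTrans α s E ∧ Glued D E := by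
  obtain ⟨m, h₂⟩ := h.snd
  have h₁ := h.fst
  have hneC : C₁.ctrl ≠ none := by
    obtain ⟨t, e, k₀, u, l, -, h, -⟩ := h₁.ctrl
    rw [h]; nofun
  have hne : X.ctrl ≠ none := by
    obtain ⟨t, e, k₀, u, l, h, -, -⟩ := h₁.ctrl
    rw [h]; nofun
  obtain ⟨w, Y, hY, hcall, hret⟩ := h₁.trans_left hp hC hI
  obtain ⟨D', hD', hP₁⟩ := h₁.exists_emit hY
    (fun f v k e => ⟨(hcall f v k e).2.1, (hcall f v k e).2.2.2.2⟩) hret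
  obtain ⟨rfl, rfl⟩ := hC.eq_of_prog hneC hD'
  obtain ⟨π, hπ, W, Y₂, hW, hY₂, hB, hfr⟩ :=
    h.bisim_left.exists_match h₂.good_left hY X'.used
  obtain ⟨π', hπ', hfr'⟩ := NPerm.exists_fresh (X₂'.used \ X₂'.pub) X₂'.pub Y₂.used
    Finset.disjoint_sdiff.symm
  have gW : W.Good := Steps.good (h₂.good_left.rename π) hW
  have gR : (X₂'.rename π').Good := h₂.good_right.rename π'
  have cR : (X₂'.rename π').ctrl = none := by rw [ctrl_rename, h₂.ctrl_right]; rfl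
  have pR : (X₂'.rename π').pub = X'.pub := by
    rw [pub_rename, hπ'.names_eq, h.bisim_right.pub_eq]
  have hB' : Bisim X' (X₂'.rename π') :=
    h.bisim_right.rename_right (h.bisim_right.pub_eq ▸ hπ')
  have hWY : W.used ⊆ Y₂.used := by
    rw [(hY₂.pub_used gW).2]; exact Finset.subset_union_left
  have hWp : W.pub = X.pub := by
    rw [Steps.pub_eq hW, pub_rename, ← h.bisim_left.pub_eq, hπ.names_eq]
  obtain ⟨pY, uY⟩ := hY.pub_used h₁.good_left
  have hd : ∀ a ∈ W.used, a ∈ (X₂'.rename π').used → a ∈ X.pub ∧ a ∈ X'.pub := by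
    intro a ha ha'
    have e₁ : a ∈ X'.pub := by
      by_contra hc
      rw [used_rename] at ha'
      obtain ⟨b, hb, rfl⟩ := Finset.mem_image.1 ha'
      refine hfr' b (Finset.mem_sdiff.2 ⟨hb, fun hb' => hc ?_⟩) (hWY ha)
      rwa [hπ' b hb', h.bisim_right.pub_eq]
    have e₂ : a ∈ Y.pub := by
      by_contra hc
      exact hfr a (hWY ha) hc (h₁.good_right.pub_used e₁)
    refine ⟨?_, e₁⟩
    rw [pY, Finset.mem_union] at e₂
    rcases e₂ with e₂ | e₂
    · exact e₂
    · rcases hY.names_subset h₁.good_left hne a e₂ with e | ⟨-, f, v, k, rfl, rfl⟩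
      · exact (h₁.common a e (h₁.good_right.pub_used e₁)).1
      · exact absurd (h₁.good_right.pub_used e₁) (hcall f v k rfl).2.2.2.2
  obtain ⟨ρ, hρ, E, hE, hA₂⟩ := h₂.exists_rename_steps (π := π) (π' := π')
    (h.bisim_left.pub_eq ▸ hπ) hπ' hW (by
      rw [← used_rename, ← h.bisim_left.pub_eq, ← h.bisim_right.pub_eq]
      exact hd)
  have hEp : E.pub = C₁.pub := by
    rw [Steps.pub_eq hE, pub_rename, hρ.names_eq, h.pub_eq]
  obtain ⟨E', hE', hP₂⟩ := hA₂.exists_emit hY₂ (by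
    intro f v k e
    obtain ⟨hf, hf', hfu, hk, hk'⟩ := hcall f v k e
    have hfX : Name.fn f ∈ X.pub := h₁.good_left.fn_mem_pub hfu hf
    constructor
    -- If the partner of `X'` defined `f`, then `f` would be public there, and the test call of
    -- `Bisim.code_and_loc` would show that `X'` defines it too.
    · by_contra hc
      obtain ⟨F, hF⟩ := Option.ne_none_iff_exists'.1 hc
      have hfR := (gR.code_names f F hF).1
      have hfW : Name.fn f ∈ W.used := gW.pub_used (by rwa [hWp])
      have := (hd _ hfW hfR).2
      exact (hB'.symm.code_and_loc gR h₁.good_right cR h₁.ctrl_right hc (by rwa [pR])).1 hf'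
    · intro hc
      have := gR.cont_mem_pub hc
      rw [pR] at this
      exact hk' (h₁.good_right.pub_used this)) hret
  refine ⟨ρ, hρ, E', ⟨E, hE, ?_⟩, I, Y, X', Y₂, X₂'.rename π', Or.inr ⟨w, w, ?_, hB, hB', hP₁, hP₂,
    fun _ => Iff.rfl, fun _ _ => rfl⟩⟩
  · rwa [hEp] at hE'
  · rw [(hC.pub_used h₁.good).1, (hE'.pub_used hA₂.good).1, hEp]

/-- Names that the environment may mention to `C` are harmless for `X`, and those added by `q` are
public for `X` if it uses them. Values at all public locations of `X` that need one are provided by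
`q`. -/
theorem IsPassive.trans_component {q : LocStore} (h : IsPassive I q C X X') (hC : C.Trans α s D)
    (hI : ∀ a ∈ α.names ∪ LocStore.names s, a ∉ I)
    (hα : (∃ f v k, α = .call f v k ∧ X.code f ≠ none) ∨ ∃ v k, α = .ret v k ∧ X.cont k ≠ none) :
    ∃ Y, X.Trans α (q.override s) Y := by
  have g := h.good
  have hn : ∀ a ∈ α.names ∪ LocStore.names (q.override s), a ∈ X.used → a ∈ X.pub := by
    intro a ha ha'
    have key : a ∈ α.names ∪ LocStore.names s → a ∈ X.pub := fun h₁ =>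
      (h.pub a (hC.names_inter g h.ctrl a h₁ ((h.mem_used a).2 ⟨Or.inl ha', hI a h₁⟩))).1 ha'
    rw [Finset.mem_union] at ha
    rcases ha with ha | ha
    · exact key (Finset.mem_union_left _ ha)
    · rcases LocStore.names_override_subset ha with ha | ha
      · exact (h.q_pub a ha).1 ha'
      · exact key (Finset.mem_union_right _ ha)
  have hv : ∀ x, Name.loc x ∈ Value.names α.val → Name.loc x ∈ LocStore.names (q.override s) :=
    fun x hx => LocStore.names_subset_override ((hC.sys_side h.ctrl).1 x hx)
  have hd : ∀ x, X.loc x ≠ none → Name.loc x ∈ X.pub → (q.override s) x ≠ none := by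
    intro x h₁ h₂ h₃
    rw [FinPFun.override_apply, Option.or_eq_none_iff] at h₃
    exact h.dom_left x h₂ h₁ h₃.2
  rcases hα with ⟨f, v, k, rfl, hf⟩ | ⟨v, k, rfl, hk⟩
  · refine exists_sysCall h.ctrl_left (Option.isSome_iff_ne_none.2 hf) ?_ hn hv hd
    have hkC : C.cont k = none := by
      rcases hC.sys_cases h.ctrl with ⟨_, _, _, e, -, hk, -⟩ | ⟨_, _, _, _, e, -⟩
      · cases e
        exact hk
      · cases e
    cases h.cont k (hI _ (by simp [Label.names])) with
    | none _ h _ => exact h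
    | left _ _ _ h => rw [hkC] at h; cases h
    | right _ _ _ h => rw [hkC] at h; cases h
  · exact exists_sysRet h.ctrl_left hk hn hv hd

/-- A call is addressed to the component that defines the function, a return to the one that stores
the continuation. -/
theorem IsPassive.trans_cases {q : LocStore} (h : IsPassive I q C X X') (hC : C.Trans α s D)
    (hI : ∀ a ∈ α.names ∪ LocStore.names s, a ∉ I) :
    (∃ Y, X.Trans α (q.override s) Y) ∨ ∃ Y, X'.Trans α (q.override s) Y := by
  rcases hC.sys_cases h.ctrl with ⟨f, v, k, rfl, hf, -⟩ | ⟨v, k, t, l, rfl, hk, -⟩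
  · rw [h.code_eq, Option.isSome_or, Bool.or_eq_true] at hf
    simp only [Option.isSome_iff_ne_none] at hf
    rcases hf with hf | hf
    · exact Or.inl (h.trans_component hC hI (Or.inl ⟨_, _, _, rfl, hf⟩))
    · exact Or.inr (h.symm.trans_component hC hI (Or.inl ⟨_, _, _, rfl, hf⟩))
  · cases h.cont k (hI _ (by simp [Label.names])) with
    | none h => rw [hk] at h; cases h
    | left h' => exact Or.inl (h.trans_component hC hI (Or.inr ⟨_, _, rfl, by rw [h']; nofun⟩))
    | right h' =>
      exact Or.inr (h.symm.trans_component hC hI (Or.inr ⟨_, _, rfl, by rw [h']; nofun⟩))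

/-- The addressed component receives `q₁.override s`. Its partner must receive `q₂.override s`, and
the two stores turn out to be equal. -/
theorem PassivePair.exists_trans {q₁ q₂ : LocStore} {C₁ C₂ X₂ X₂' Y : State}
    (h : PassivePair I q₁ q₂ C₁ C₂ X X' X₂ X₂') (hC : C₁.Trans α s D)
    (hI : ∀ a ∈ α.names ∪ LocStore.names s, a ∉ I) (hY : X.Trans α (q₁.override s) Y) :
    ∃ ρ : NPerm, ρ.Fixes C₂.pub ∧ ∃ E, (C₂.rename ρ).WeakTrans α s E ∧ Glued D E := by
  have h₁ := h.fst
  have h₂ := h.snd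
  obtain ⟨hv, hs⟩ := hC.sys_side h₁.ctrl
  have hnC := hC.names_inter h₁.good h₁.ctrl
  have hcall : ∀ f v k, α = .call f v k → X'.cont k = none := by
    rintro f v k rfl
    have hkC : C₁.cont k = none := by
      rcases hC.sys_cases h₁.ctrl with ⟨_, _, _, e, -, hk, -⟩ | ⟨_, _, _, _, e, -⟩
      · cases e
        exact hk
      · cases e
    cases h₁.cont k (hI _ (by simp [Label.names])) with
    | none _ _ h => exact h
    | left _ _ _ h => rw [hkC] at h; cases h
    | right _ _ _ h => rw [hkC] at h; cases h
  obtain ⟨D', hD', n, hA₁⟩ := h₁.exists_receive hY hI hnC hv hs hcall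
  obtain rfl := hC.eq_of_sys h₁.ctrl hD'
  have hqC : ∀ x, Name.loc x ∈ C₁.pub → s x = none → q₁ x = none := by
    intro x hx hsx
    rw [← h₁.loc_pub x (h₁.notMem_int (h₁.good.pub_used hx)) (h₁.pub _ hx).1 (h₁.pub _ hx).2]
    by_contra hc
    exact hs x hc hx hsx
  -- `q₁` and `q₂` may differ at public locations of the composite, for instance in the initial
  -- values of exported variables. But `s` overwrites every such location that has a value.
  have hq : q₁.override s = q₂.override s := by
    apply FinPFun.ext_apply
    intro x
    rw [FinPFun.override_apply, FinPFun.override_apply]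
    cases hsx : s x with
    | some d => rfl
    | none =>
      by_cases hx : Name.loc x ∈ C₁.pub
      · have := hqC x hx hsx
        rw [this, (h.dom_eq x).1 this]
      · rw [h.eq_of_notMem x hx]
  obtain ⟨π, hπ, Y₂, hY₂, hB, hfr⟩ :=
    h.bisim_left.exists_match_sys h₂.good_left h₂.ctrl_left hY X'.used
  -- The waiting partner takes no part in the transition. Its private names are moved away from the
  -- answer and also from the label, so that the renamed composite accepts the label.
  obtain ⟨π', hπ', hfr'⟩ := NPerm.exists_fresh (X₂'.used \ X₂'.pub) X₂'.pub
    (Y₂.used ∪ (α.names ∪ LocStore.names s)) Finset.disjoint_sdiff.symm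
  have gL : (X₂.rename π).Good := h₂.good_left.rename π
  have cL : (X₂.rename π).ctrl = none := by rw [ctrl_rename, h₂.ctrl_left]; rfl
  have pL : (X₂.rename π).pub = X.pub := by
    rw [pub_rename, ← h.bisim_left.pub_eq, hπ.names_eq]
  have gR : (X₂'.rename π').Good := h₂.good_right.rename π'
  have cR : (X₂'.rename π').ctrl = none := by rw [ctrl_rename, h₂.ctrl_right]; rfl
  have pR : (X₂'.rename π').pub = X'.pub := by
    rw [pub_rename, hπ'.names_eq, h.bisim_right.pub_eq]
  have hB' : Bisim X' (X₂'.rename π') :=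
    h.bisim_right.rename_right (h.bisim_right.pub_eq ▸ hπ')
  have hLY : (X₂.rename π).used ⊆ Y₂.used := by
    rw [(hY₂.pub_used gL).2]; exact Finset.subset_union_left
  obtain ⟨pY, uY⟩ := hY.pub_used h₁.good_left
  have hR : ∀ a ∈ (X₂'.rename π').used, a ∈ Y₂.used ∪ (α.names ∪ LocStore.names s) →
      a ∈ X'.pub := by
    intro a ha' ha
    by_contra hc
    rw [used_rename] at ha'
    obtain ⟨b, hb, rfl⟩ := Finset.mem_image.1 ha'
    refine hfr' b (Finset.mem_sdiff.2 ⟨hb, fun hb' => hc ?_⟩) ha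
    rwa [hπ' b hb', h.bisim_right.pub_eq]
  have hd : ∀ a ∈ (X₂.rename π).used, a ∈ (X₂'.rename π').used → a ∈ X.pub ∧ a ∈ X'.pub := by
    intro a ha ha'
    have e₁ : a ∈ X'.pub := hR a ha' (Finset.mem_union_left _ (hLY ha))
    have e₂ : a ∈ Y.pub := by
      by_contra hc
      exact hfr a (hLY ha) hc (h₁.good_right.pub_used e₁)
    refine ⟨?_, e₁⟩
    rw [pY, Finset.mem_union] at e₂
    rcases e₂ with e₂ | e₂
    · exact e₂
    · rw [← pL]
      exact hY₂.names_inter gL cL a e₂ ha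
  obtain ⟨ρ, hρ, hP₂⟩ := h₂.exists_rename (π := π) (π' := π') (h.bisim_left.pub_eq ▸ hπ) hπ' (by
      rw [← used_rename, ← used_rename, ← h.bisim_left.pub_eq, ← h.bisim_right.pub_eq]
      exact hd)
  have hp : (C₂.rename ρ).pub = C₁.pub := by
    rw [pub_rename, hρ.names_eq, h.pub_eq]
  rw [hq] at hY₂
  obtain ⟨E, hE, m, hA₂⟩ := hP₂.exists_receive hY₂ hI (by
    intro a ha ha'
    rw [hp]
    refine hnC a ha ((h₁.mem_used a).2 ⟨?_, hI a ha⟩)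
    rcases ((hP₂.mem_used a).1 ha').1 with h₃ | h₃
    · left
      apply h₁.good_left.pub_used
      rw [← pL]
      refine hY₂.names_inter gL cL a ?_ h₃
      rw [Finset.mem_union] at ha ⊢
      exact ha.imp_right LocStore.names_subset_override
    · right
      exact h₁.good_right.pub_used (hR a h₃ (Finset.mem_union_right _ ha))) hv (by
    intro x hx hxp hsx
    have hq₂ := hP₂.loc_pub x (hP₂.notMem_int (hP₂.good.pub_used hxp)) (hP₂.pub _ hxp).1
      (hP₂.pub _ hxp).2
    rw [hp] at hxp
    rw [hq₂] at hx
    exact hx ((h.dom_eq x).1 (hqC x hxp hsx))) (by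
    intro f v k e
    by_contra hc
    exact hB'.symm.cont_ne_none gR h₁.good_right cR h₁.ctrl_right hc (hcall f v k e))
  refine ⟨ρ, hρ, E, ⟨_, .refl, hE⟩, I, Y, X', Y₂, X₂'.rename π', Or.inl ⟨n, ?_, hB, hB', hA₁,
    m, hA₂⟩⟩
  rw [(hC.pub_used h₁.good).1, (hE.pub_used hP₂.good).1, hp]

end

/-! ### Glued states are bisimilar -/

/-- Once pending interactions have been performed, the transition is internal to the running
component. Its partner stays put, so the second composite moves only for the interactions. -/
theorem Glued.exists_steps {C₁ C₂ D : State} (h : Glued C₁ C₂) (hC : C₁.Step D) :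
    ∃ ρ : NPerm, ρ.Fixes C₁.pub ∧ ∃ E, (C₂.rename ρ).Steps E ∧ Glued D E := by
  have hp := h.pub_eq
  obtain ⟨I, X, X', X₂, X₂', ⟨n, h⟩ | ⟨q₁, q₂, h⟩⟩ := h
  · obtain ⟨I, X, X', X₂, X₂', hI, h⟩ := h.freshen D.used
    obtain ⟨ρ, hρ, E, hE, m, I, Y, Y', Y₂, Y₂', hF, h, hP⟩ := h.exists_normal hI
    obtain ⟨Z, hZ, hA⟩ := h.fst.step_left hP hC fun a ha ha' => hF a ha' ha
    refine ⟨ρ, hp ▸ hρ, E, hE, I, Z, Y', Y₂, Y₂', Or.inl ⟨m, ?_, h.bisim_left.step hZ,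
      h.bisim_right, hA, h.snd⟩⟩
    rw [hC.pub_eq, h.pub_eq]
  · obtain ⟨t, e, k, hc⟩ := hC.exists_ctrl
    rw [h.fst.ctrl] at hc
    cases hc

theorem Glued.exists_trans {C₁ C₂ D : State} {α : Label} {s : LocStore} (h : Glued C₁ C₂)
    (hC : C₁.Trans α s D) :
    ∃ ρ : NPerm, ρ.Fixes C₁.pub ∧ ∃ E, (C₂.rename ρ).WeakTrans α s E ∧ Glued D E := by
  have hp := h.pub_eq
  obtain ⟨I, X, X', X₂, X₂', ⟨n, h⟩ | ⟨q₁, q₂, h⟩⟩ := h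
  -- Internal names are made to avoid the label first, as a fresh continuation chosen by `C₁` may be
  -- one of them.
  · obtain ⟨I, X, X', X₂, X₂', hI, h⟩ := h.freshen α.names
    obtain ⟨ρ, hρ, E, hE, m, I, Y, Y', Y₂, Y₂', hF, h, hP⟩ := h.exists_normal hI
    obtain ⟨σ, hσ, E', ⟨W, hW, hE'⟩, hG⟩ := h.exists_trans hP hC fun a ha ha' => hF a ha' ha
    rw [Steps.pub_eq hE, pub_rename, hρ.names_eq] at hσ
    refine ⟨σ * ρ, hp ▸ hσ.mul hρ, E', ⟨W, ?_, hE'⟩, hG⟩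
    rw [rename_mul]
    exact (Steps.rename σ hE).trans hW
  · obtain ⟨I, q₁, q₂, X, X', X₂, X₂', hI, h⟩ := h.freshen (α.names ∪ LocStore.names s)
    have hI' : ∀ a ∈ α.names ∪ LocStore.names s, a ∉ I := fun a ha ha' => hI a ha' ha
    rw [hp]
    rcases h.fst.trans_cases hC hI' with ⟨Y, hY⟩ | ⟨Y, hY⟩
    · exact h.exists_trans hC hI' hY
    · exact h.swap.exists_trans hC hI' hY

theorem Glued.bisim {C₁ C₂ : State} (h : Glued C₁ C₂) : Bisim C₁ C₂ :=
  Bisim.of_weak_simulation (fun _ _ => Glued.symm) (fun _ _ π => Glued.rename π)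
    (fun _ _ => Glued.good) (fun _ _ => Glued.pub_eq) (fun _ _ _ => Glued.exists_steps)
    (fun _ _ _ _ _ => Glued.exists_trans) h

end SLS

namespace SLS

open State

/-! ### Modules -/

theorem NPerm.free_exp (π : NPerm) (e : Exp) : (π.exp e).free = e.free := by
  induction e <;> simp_all [NPerm.exp, Exp.free]

namespace Module

variable {M M' : Module}

theorem mem_declared {a : Name} : a ∈ M.declared ↔
    (∃ x, a = .loc x ∧ M.vars x ≠ none) ∨ ∃ f, a = .fn f ∧ M.funs f ≠ none := by
  simp only [declared, Finset.mem_union, Finset.mem_image, FinPFun.mem_dom,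
    Option.isSome_iff_ne_none]
  constructor
  · rintro (⟨x, h, rfl⟩ | ⟨x, h, rfl⟩)
    · exact Or.inl ⟨x, rfl, h⟩
    · exact Or.inr ⟨x, rfl, h⟩
  · rintro (⟨x, rfl, h⟩ | ⟨x, rfl, h⟩)
    · exact Or.inl ⟨x, h, rfl⟩
    · exact Or.inr ⟨x, h, rfl⟩

theorem loc_mem_declared {x : Loc} : Name.loc x ∈ M.declared ↔ M.vars x ≠ none := by
  rw [mem_declared]
  simp

theorem fn_mem_declared {f : Fn} : Name.fn f ∈ M.declared ↔ M.funs f ≠ none := by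
  rw [mem_declared]
  simp

theorem mem_allNames {a : Name} : a ∈ M.allNames ↔ a ∈ M.pub ∨ a ∈ M.declared :=
  Finset.mem_union

theorem mem_pub {a : Name} : a ∈ M.pub ↔ a ∈ M.exports ∨ a ∈ M.imports :=
  Finset.mem_union

theorem mem_priv {a : Name} : a ∈ M.priv ↔ a ∈ M.declared ∧ a ∉ M.exports :=
  Finset.mem_sdiff

@[simp] theorem initState_used : M.initState.used = M.allNames := rfl
@[simp] theorem initState_pub : M.initState.pub = M.pub := rfl
theorem initState_loc (x : Loc) : M.initState.loc x = (M.vars x).map Data.int := rfl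

theorem initState_loc_eq_none {x : Loc} : M.initState.loc x = none ↔ M.vars x = none := by
  rw [initState_loc, Option.map_eq_none_iff]

theorem names_eq_empty_of_initState_loc {x : Loc} {d : Data} (h : M.initState.loc x = some d) :
    d.names = ∅ := by
  rw [initState_loc, Option.map_eq_some_iff] at h
  obtain ⟨n, -, rfl⟩ := h
  rfl

theorem WF.good (h : M.WF) : M.initState.Good where
  code_names f F hF := by
    have hF : M.funs f = some F := hF
    refine ⟨mem_allNames.2 (Or.inr (fn_mem_declared.2 (by rw [hF]; nofun))), fun a ha => ?_⟩
    rcases Finset.mem_union.1 (h.scope f F hF ha) with ha | ha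
    · exact mem_allNames.2 (Or.inr ha)
    · exact mem_allNames.2 (Or.inl (mem_pub.2 (Or.inr ha)))
  pub_used := Finset.subset_union_left
  loc_names x d hd := by
    refine ⟨mem_allNames.2 (Or.inr (loc_mem_declared.2 fun hc => ?_)), ?_⟩
    · rw [initState_loc, hc] at hd
      cases hd
    · rw [names_eq_empty_of_initState_loc hd]
      exact Finset.empty_subset _
  cont_names k t l hk := by cases hk
  ctrl_names t e k hk := by cases hk
  private_sort a ha ha' := by
    rcases mem_declared.1 ((mem_allNames.1 ha).resolve_left ha') with ⟨x, rfl, -⟩ | h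
    · exact Or.inl ⟨x, rfl⟩
    · exact Or.inr h
  closed _ x d hd _ := by
    rw [names_eq_empty_of_initState_loc hd]
    exact Finset.empty_subset _

theorem declared_rename (π : NPerm) : (M.rename π).declared = π.names M.declared := by
  ext a
  obtain ⟨a, rfl⟩ := π.name_surjective a
  rw [NPerm.name_mem_names]
  cases a with
  | loc x =>
    rw [NPerm.name_loc, loc_mem_declared, loc_mem_declared, rename, FinPFun.bimap_apply_apply]
    simp
  | fn f =>
    rw [NPerm.name_fn, fn_mem_declared, fn_mem_declared, rename, NPerm.code_apply]
    simp
  | cont k => simp [mem_declared]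

theorem pub_rename (π : NPerm) : (M.rename π).pub = π.names M.pub :=
  (π.names_union M.exports M.imports).symm

theorem WF.rename (π : NPerm) (h : M.WF) : (M.rename π).WF where
  exports_declared := by
    rw [declared_rename]
    exact π.names_subset.2 h.exports_declared
  imports_not_declared := by
    rw [declared_rename, Finset.disjoint_left]
    intro a ha ha'
    obtain ⟨a, rfl⟩ := π.name_surjective a
    exact Finset.disjoint_left.1 h.imports_not_declared (π.name_mem_names.1 ha)
      (π.name_mem_names.1 ha')
  imports_sort k := by
    obtain ⟨k, rfl⟩ := π.cont.surjective k
    exact fun hk => h.imports_sort k (π.cont_mem_names.1 hk)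
  scope f F hF := by
    obtain ⟨f, rfl⟩ := π.fn.surjective f
    rw [Module.rename, NPerm.code_apply, Option.map_eq_some_iff] at hF
    obtain ⟨F, hF, rfl⟩ := hF
    rw [declared_rename, Module.rename, ← NPerm.names_union, NPerm.func, NPerm.names_exp]
    exact π.names_subset.2 (h.scope f F hF)
  closed f F hF := by
    obtain ⟨f, rfl⟩ := π.fn.surjective f
    rw [Module.rename, NPerm.code_apply, Option.map_eq_some_iff] at hF
    obtain ⟨F, hF, rfl⟩ := hF
    rw [NPerm.func, NPerm.free_exp]
    exact h.closed f F hF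

theorem initState_rename (π : NPerm) : (M.rename π).initState = M.initState.rename π := by
  have h₁ : (M.rename π).vars.bimap 1 Data.int = π.lstore (M.vars.bimap 1 Data.int) := by
    apply FinPFun.ext_apply
    intro x
    obtain ⟨x, rfl⟩ := π.loc.surjective x
    rw [NPerm.lstore_apply]
    change Option.map _ ((M.vars.bimap π.loc id) (π.loc x)) =
      Option.map _ (Option.map _ (M.vars x))
    rw [FinPFun.bimap_apply_apply]
    cases M.vars x <;> rfl
  have h₂ : π.cstore FinPFun.empty = FinPFun.empty := by
    apply FinPFun.ext_apply
    intro k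
    rfl
  change State.mk _ (.sys _ _ _) = State.mk _ (.sys _ _ _)
  rw [h₁, allNames, pub_rename, declared_rename, ← NPerm.names_union]
  change _ = State.mk _ (.sys _ _ ⟨π.lstore _, π.cstore FinPFun.empty⟩)
  rw [h₂]
  rfl

theorem mem_declared_concat {a : Name} :
    a ∈ (M.concat M').declared ↔ a ∈ M.declared ∨ a ∈ M'.declared := by
  cases a with
  | loc x =>
    simp only [loc_mem_declared, concat, FinPFun.override_apply, ne_eq, Option.or_eq_none_iff]
    tauto
  | fn x =>
    simp only [fn_mem_declared, concat, FinPFun.override_apply, ne_eq, Option.or_eq_none_iff]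
    tauto
  | cont x => simp [mem_declared]

theorem mem_pub_concat {a : Name} : a ∈ (M.concat M').pub ↔ a ∈ M.pub ∨ a ∈ M'.pub := by
  simp only [pub, concat, Finset.mem_union, Finset.mem_sdiff]
  tauto

theorem mem_allNames_concat {a : Name} :
    a ∈ (M.concat M').allNames ↔ a ∈ M.allNames ∨ a ∈ M'.allNames := by
  simp only [mem_allNames, mem_declared_concat, mem_pub_concat]
  tauto

/-- The exported variables. -/
theorem WF.loc_mem_exports (h : M.WF) {x : Loc} :
    Name.loc x ∈ M.exports ↔ Name.loc x ∈ M.pub ∧ M.vars x ≠ none := by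
  rw [← loc_mem_declared, mem_pub]
  constructor
  · exact fun hx => ⟨Or.inl hx, h.exports_declared hx⟩
  · rintro ⟨hx | hx, hx'⟩
    · exact hx
    · exact absurd hx' (Finset.disjoint_left.1 h.imports_not_declared hx)

/-- Initial stores hold integers and no continuations, so only the scope of function bodies depends
on the two modules. -/
theorem good_concat (h : M.initState.Good) (h' : M'.initState.Good) :
    (M.concat M').initState.Good where
  code_names f F hF := by
    have hF : (M'.funs f).or (M.funs f) = some F := hF
    rw [Option.or_eq_some_iff] at hF
    rcases hF with hF | ⟨-, hF⟩
    · exact ⟨mem_allNames_concat.2 (Or.inr (h'.code_names f F hF).1),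
        fun a ha => mem_allNames_concat.2 (Or.inr ((h'.code_names f F hF).2 ha))⟩
    · exact ⟨mem_allNames_concat.2 (Or.inl (h.code_names f F hF).1),
        fun a ha => mem_allNames_concat.2 (Or.inl ((h.code_names f F hF).2 ha))⟩
  pub_used := Finset.subset_union_left
  loc_names x d hd := by
    refine ⟨mem_allNames.2 (Or.inr (loc_mem_declared.2 fun hc => ?_)), ?_⟩
    · rw [initState_loc, hc] at hd
      cases hd
    · rw [names_eq_empty_of_initState_loc hd]
      exact Finset.empty_subset _
  cont_names k t l hk := by cases hk
  ctrl_names t e k hk := by cases hk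
  private_sort a ha ha' := by
    rcases mem_declared.1 ((mem_allNames.1 ha).resolve_left ha') with ⟨x, rfl, -⟩ | h
    · exact Or.inl ⟨x, rfl⟩
    · exact Or.inr h
  closed _ x d hd _ := by
    rw [names_eq_empty_of_initState_loc hd]
    exact Finset.empty_subset _

/-- The initial state of a concatenation. -/
theorem isPassive_concat (hM : M.WF) (hM' : M'.WF) (hd : Disjoint M.exports M'.exports)
    (hp : Disjoint M.priv M'.allNames) (hp' : Disjoint M'.priv M.allNames) :
    IsPassive ∅ ((M.concat M').initState.loc.restrictTo (M.exports ∪ M'.exports))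
      (M.concat M').initState M.initState M'.initState := by
  -- A name declared by both modules would be exported by both, against `hd`, or private in one of
  -- them, against `hp` or `hp'`.
  have hdecl : ∀ a ∈ M.declared, a ∉ M'.declared := by
    intro a h h'
    by_cases he : a ∈ M.exports
    · refine Finset.disjoint_left.1 hp' (mem_priv.2 ⟨h', ?_⟩) (mem_allNames.2 (Or.inr h))
      exact Finset.disjoint_left.1 hd he
    · exact Finset.disjoint_left.1 hp (mem_priv.2 ⟨h, he⟩) (mem_allNames.2 (Or.inr h'))
  have hpub : ∀ {M M' : Module}, Disjoint M.priv M'.allNames → ∀ a ∈ M.allNames,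
      a ∈ M'.allNames → a ∈ M.pub := by
    intro M M' hp a h h'
    by_contra hc
    refine Finset.disjoint_left.1 hp (mem_priv.2 ⟨(mem_allNames.1 h).resolve_left hc, ?_⟩) h'
    exact fun he => hc (mem_pub.2 (Or.inl he))
  have hloc : ∀ x, (M.concat M').initState.loc x =
      ((M'.vars x).or (M.vars x)).map Data.int := fun x => rfl
  have hvd : ∀ x, M.vars x ≠ none → M'.vars x = none := by
    intro x hx
    by_contra hc
    exact hdecl (.loc x) (loc_mem_declared.2 hx) (loc_mem_declared.2 hc)
  have hCpub : ∀ a ∈ (M.concat M').pub, (a ∈ M.allNames → a ∈ M.pub) ∧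
      (a ∈ M'.allNames → a ∈ M'.pub) := by
    intro a ha
    rcases mem_pub_concat.1 ha with ha | ha
    · exact ⟨fun _ => ha, fun h => hpub hp' a h (mem_allNames.2 (Or.inl ha))⟩
    · exact ⟨fun h => hpub hp a h (mem_allNames.2 (Or.inl ha)), fun _ => ha⟩
  have hqn : ∀ a ∈ LocStore.names
      ((M.concat M').initState.loc.restrictTo (M.exports ∪ M'.exports)),
      a ∈ M.exports ∪ M'.exports :=
    names_restrictTo_subset fun x d hd _ => by
      rw [names_eq_empty_of_initState_loc hd]
      exact Finset.empty_subset _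
  -- There are no internal names yet. A public location of a component has a value only if it is an
  -- exported variable, so `q` is the initial store on the exports.
  refine ⟨⟨good_concat hM.good hM'.good, hM.good, hM'.good, ?_, ?_, ?_, by simp, by simp, ?_, hCpub,
    fun k _ => .none rfl rfl rfl⟩, rfl, rfl, rfl, ?_, ?_, ?_, ?_, ?_, ?_, ?_⟩
  · intro f
    change (M'.funs f).or (M.funs f) = (M.funs f).or (M'.funs f)
    have := hdecl (.fn f)
    rw [fn_mem_declared, fn_mem_declared] at this
    cases h : M.funs f <;> cases h' : M'.funs f <;> simp_all
  · intro f
    change M.funs f = none ∨ M'.funs f = none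
    have := hdecl (.fn f)
    rw [fn_mem_declared, fn_mem_declared] at this
    tauto
  · intro a
    simpa using mem_allNames_concat
  · exact fun a h h' => ⟨hpub hp a h h', hpub hp' a h' h⟩
  · intro x hx hx'
    have hx := loc_mem_declared.1 ((mem_allNames.1 hx).resolve_left hx')
    rw [hloc, hvd x hx]
    rfl
  · intro x hx hx'
    have hx := loc_mem_declared.1 ((mem_allNames.1 hx).resolve_left hx')
    have hx' : M.vars x = none := by
      by_contra hc
      exact hx (hvd x hc)
    rw [hloc, hx', initState_loc]
    simp
  · intro x _ h h'
    rw [LocStore.restrictTo_apply]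
    split
    · rfl
    · rename_i hx
      simp only [Finset.mem_union, not_or] at hx
      rw [hloc, Option.map_eq_none_iff, Option.or_eq_none_iff]
      constructor
      · by_contra hc
        exact hx.2 (hM'.loc_mem_exports.2
          ⟨h' (mem_allNames.2 (Or.inr (loc_mem_declared.2 hc))), hc⟩)
      · by_contra hc
        exact hx.1 (hM.loc_mem_exports.2
          ⟨h (mem_allNames.2 (Or.inr (loc_mem_declared.2 hc))), hc⟩)
  · intro x hx hx'
    rw [ne_eq, initState_loc_eq_none] at hx'
    have hxe := hM.loc_mem_exports.2 ⟨hx, hx'⟩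
    rw [LocStore.restrictTo_apply, if_pos (Finset.mem_union_left _ hxe), hloc, ne_eq,
      Option.map_eq_none_iff, Option.or_eq_none_iff]
    tauto
  · intro x hx hx'
    rw [ne_eq, initState_loc_eq_none] at hx'
    have hxe := hM'.loc_mem_exports.2 ⟨hx, hx'⟩
    rw [LocStore.restrictTo_apply, if_pos (Finset.mem_union_right _ hxe), hloc, ne_eq,
      Option.map_eq_none_iff, Option.or_eq_none_iff]
    tauto
  · intro a ha
    refine (Finset.mem_union.1 (hqn a ha)).imp (fun h => ?_) fun h => ?_
    · exact mem_allNames.2 (Or.inl (mem_pub.2 (Or.inl h)))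
    · exact mem_allNames.2 (Or.inl (mem_pub.2 (Or.inl h)))
  · intro a ha
    apply hCpub
    rw [mem_pub_concat]
    exact (Finset.mem_union.1 (hqn a ha)).imp (fun h => mem_pub.2 (Or.inl h))
      fun h => mem_pub.2 (Or.inl h)

end Module

/-! ### Composition of bisimilar modules -/

open SLS.Module

/-- Bisimilar modules export the same variables if they export a function. -/
theorem SameVars.loc_mem_exports {M₁ M₂ : Module} (h : SameVars M₁ M₂) (h₁ : M₁.WF) (h₂ : M₂.WF)
    (hb : Bisimilar M₁ M₂) (x : Loc) : Name.loc x ∈ M₁.exports ↔ Name.loc x ∈ M₂.exports := by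
  rcases h with ⟨f, hf⟩ | h
  · have hb : Bisim M₁.initState M₂.initState := hb
    have hp : M₁.pub = M₂.pub := hb.pub_eq
    have hf₁ : M₁.funs f ≠ none := fn_mem_declared.1 (h₁.exports_declared hf)
    have hfp : Name.fn f ∈ M₁.pub := mem_pub.2 (Or.inl hf)
    -- The test call shows that `M₂` defines `f` as well, so the test can be repeated with the
    -- modules interchanged.
    obtain ⟨hf₂, e₂⟩ := hb.code_and_loc h₁.good h₂.good rfl rfl hf₁ hfp
    obtain ⟨-, e₁⟩ := hb.symm.code_and_loc h₂.good h₁.good rfl rfl hf₂ (by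
      rwa [initState_pub, ← hp])
    simp only [ne_eq, initState_loc_eq_none, initState_pub] at e₁ e₂
    rw [h₁.loc_mem_exports, h₂.loc_mem_exports, ← hp]
    rw [← hp] at e₁
    exact ⟨fun hx => ⟨hx.1, e₁ x hx.1 hx.2⟩, fun hx => ⟨hx.1, e₂ x hx.1 hx.2⟩⟩
  · exact h x

/-- The initial states of the two composites are glued, with the initial states of the renamed
modules as components. Renaming private names preserves bisimilarity, so the choice of the
composites does not matter. -/
theorem Bisimilar.comp {M₁ M₂ M₁' M₂' C₁ C₂ : Module} (h₁ : M₁.WF) (h₂ : M₂.WF) (h₁' : M₁'.WF)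
    (h₂' : M₂'.WF) (hv : SameVars M₁ M₂) (hv' : SameVars M₁' M₂') (hb : Bisimilar M₁ M₂)
    (hb' : Bisimilar M₁' M₂') (hC₁ : IsComp M₁ M₁' C₁) (hC₂ : IsComp M₂ M₂' C₂) :
    Bisimilar C₁ C₂ := by
  have hx := hv.loc_mem_exports h₁ h₂ hb
  have hx' := hv'.loc_mem_exports h₁' h₂' hb'
  obtain ⟨hd₁, π₁, π₁', f₁, f₁', p₁, p₁', rfl⟩ := hC₁
  obtain ⟨hd₂, π₂, π₂', f₂, f₂', p₂, p₂', rfl⟩ := hC₂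
  have hexp : ∀ {M : Module} {π : NPerm}, (∀ a ∈ M.pub, π.name a = a) →
      (M.rename π).exports = M.exports ∧ (M.rename π).pub = M.pub := fun {M π} h =>
    ⟨NPerm.Fixes.names_eq fun a ha => h a (mem_pub.2 (Or.inl ha)),
      (Module.pub_rename π).trans (NPerm.Fixes.names_eq h)⟩
  have key : ∀ {M₁ M₂ : Module} {π₁ π₂ : NPerm}, Bisimilar M₁ M₂ →
      (∀ a ∈ M₁.pub, π₁.name a = a) → (∀ a ∈ M₂.pub, π₂.name a = a) →
      Bisim (M₁.rename π₁).initState (M₂.rename π₂).initState := by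
    intro M₁ M₂ π₁ π₂ h f₁ f₂
    have h : Bisim M₁.initState M₂.initState := h
    have hp : M₁.pub = M₂.pub := h.pub_eq
    rw [initState_rename, initState_rename]
    have h' := h.rename_right (π := π₂) (by rw [initState_pub, hp]; exact f₂)
    refine (h'.symm.rename_right (π := π₁) ?_).symm
    rw [← h'.pub_eq]
    exact f₁
  have hP₁ := isPassive_concat (h₁.rename π₁) (h₁'.rename π₁')
    (by rwa [(hexp f₁).1, (hexp f₁').1]) p₁ p₁'
  have hP₂ := isPassive_concat (h₂.rename π₂) (h₂'.rename π₂')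
    (by rwa [(hexp f₂).1, (hexp f₂').1]) p₂ p₂'
  rw [(hexp f₁).1, (hexp f₁').1] at hP₁
  rw [(hexp f₂).1, (hexp f₂').1] at hP₂
  have hq : ∀ {M M' : Module} {π π' : NPerm}, M.WF → M'.WF → (∀ a ∈ M.pub, π.name a = a) →
      (∀ a ∈ M'.pub, π'.name a = a) → ∀ x : Loc,
      (((M.rename π).concat (M'.rename π')).initState.loc.restrictTo
        (M.exports ∪ M'.exports)) x ≠ none ↔ Name.loc x ∈ M.exports ∨ Name.loc x ∈ M'.exports := by
    intro M M' π π' h h' f f' x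
    rw [LocStore.restrictTo_apply, ← Finset.mem_union]
    split
    · rename_i hx
      simp only [hx, iff_true]
      rw [ne_eq, initState_loc_eq_none, ← ne_eq, ← loc_mem_declared, mem_declared_concat]
      refine (Finset.mem_union.1 hx).imp (fun hx => ?_) fun hx => ?_
      · exact (h.rename π).exports_declared (by rwa [(hexp f).1])
      · exact (h'.rename π').exports_declared (by rwa [(hexp f').1])
    · rename_i hx
      simp [hx]
  have hq₁ := hq h₁ h₁' f₁ f₁'
  have hq₂ := hq h₂ h₂' f₂ f₂'
  have hb₁ : Bisim M₁.initState M₂.initState := hb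
  have hb₁' : Bisim M₁'.initState M₂'.initState := hb'
  have e : M₁.pub = M₂.pub := hb₁.pub_eq
  have e' : M₁'.pub = M₂'.pub := hb₁'.pub_eq
  -- Both stores are defined exactly at the exported variables, and these agree by `hx` and `hx'`.
  -- The assumption on exported variables is needed here.
  have hqq : ∀ x, (_ = none ↔ _ = none) := fun x =>
    not_iff_not.1 (((hq₁ x).trans (or_congr (hx x) (hx' x))).trans (hq₂ x).symm)
  refine Glued.bisim ⟨∅, _, _, _, _, Or.inr ⟨_, _, ?_, key hb f₁ f₂, key hb' f₁' f₂', hP₁, hP₂,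
    hqq, ?_⟩⟩
  · ext a
    rw [initState_pub, initState_pub, mem_pub_concat, mem_pub_concat, (hexp f₁).2, (hexp f₁').2,
      (hexp f₂).2, (hexp f₂').2, e, e']
  -- Exported variables are public, so outside the public names both stores are undefined.
  · intro x hxp
    have : (((M₁.rename π₁).concat (M₁'.rename π₁')).initState.loc.restrictTo
        (M₁.exports ∪ M₁'.exports)) x = none := by
      by_contra hc
      refine hxp ?_
      rw [initState_pub, mem_pub_concat, (hexp f₁).2, (hexp f₁').2]
      exact ((hq₁ x).1 hc).imp (fun h => mem_pub.2 (Or.inl h)) fun h => mem_pub.2 (Or.inl h)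
    rw [this, (hqq x).1 this]

end SLS

theorem proposition2 :
    Equivalence (fun M₁ M₂ : {M : SLS.Module // M.WF} => SLS.Bisimilar M₁.1 M₂.1) ∧
    ∀ M₁ M₂ M₁' M₂' C₁ C₂ : SLS.Module,
      M₁.WF → M₂.WF → M₁'.WF → M₂'.WF →
      SLS.SameVars M₁ M₂ → SLS.SameVars M₁' M₂' →
      SLS.Bisimilar M₁ M₂ → SLS.Bisimilar M₁' M₂' →
      SLS.Module.IsComp M₁ M₁' C₁ → SLS.Module.IsComp M₂ M₂' C₂ →
      SLS.Bisimilar C₁ C₂ := by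
  refine ⟨⟨fun M => SLS.Bisim.refl M.2.good, fun h => SLS.Bisim.symm h, fun h h' => SLS.Bisim.trans h h'⟩, ?_⟩
  intro M₁ M₂ M₁' M₂' C₁ C₂ h₁ h₂ h₁' h₂' hv hv' hb hb' hC₁ hC₂
  exact hb.comp h₁ h₂ h₁' h₂' hv hv' hb' hC₁ hC₂
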